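/- All graphs are finite and may have loops and parallel edges; $A\triangle B$ is the symmetric difference. A \emph{graft} $(G,T)$ is a graph $G$ with a set $T\subseteq V(G)$. A subgraph $F$ of $G$ is \emph{$T$-spanning} if $V(F)=V(G)$ and for each component $C$ of $F$ either $|V(C)\cap T|$ is odd, or $V(C)\cap T=\emptyset$ and $G[V(C)]$ is a component of $G$. The \emph{feasible sets} of $(G,T)$ are the edge sets of its $T$-spanning forests; $\mathcal F(\mathcal G(G,T))$ denotes their family. A \emph{cyclic decomposition} of $(G,T)$ is a pair $(H,\mathcal B)$ of a bipartite graph $H$ of maximum degree at most $2$ and a family $\mathcal B=\{B_x:x\in V(H)\}$ of subsets of $V(G)$ such that (C1) $\bigcup_x B_x=V(G)$; (C2) any two adjacent vertices of $G$ lie in a common $B_x$; (C3) for distinct $x,y\in V(H)$, $B_x\cap B_y\subseteq T$ and $|B_x\cap B_y|$ is the number of edges of $H$ joining $x$ and $y$; (C4) $|T\cap B_x|\le 2$ for all $x$. It is \emph{nice} if every $G[B_x]$ is connected and every $x$ with $|B_x\cap T|\le1$ is an isolated vertex of $H$. For $k\ge2$, $W_k$ is the wheel graph with vertices $s,t_1,\dots,t_k$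 and edges $e_1,\dots,e_{2k}$, where $e_{2i-1}=t_it_{i+1}$ and $e_{2i}=st_{i+1}$ for $1\le i\le k$, with $t_{k+1}=t_1$. $M(G)$ is the cycle matroid of $G$, $M^*(G)$ is its dual, and $\mathcal B(M)$ is the set of bases of a matroid $M$. If $E(M_1)\cap E(M_2)=\{e\}$ and $e$ is neither a loop nor a coloop of $M_1$ or $M_2$, then $M_1\oplus_2M_2$ is the matroid on $E(M_1)\triangle E(M_2)$ whose circuits are the circuits of $M_1$ and of $M_2$ avoiding $e$ and the sets $C_1\triangle C_2$ where $C_i$ is a circuit of $M_i$ containing $e$ ($i=1,2$). \textbf{Proposition.} Let $k\ge 2$ and let $(G,T)$ be a graft with a nice cyclic decomposition $(H,\mathcal B)$ such that $H$ is the even cycle $1,2,\dots,2k,1$ and $\mathcal B=\{B_i:1\le i\le 2k\}$; put $B_{2k+1}=B_1$. Let $G_1,\dots,G_{2k}$ be subgraphs of $G$ with $V(G_i)=B_i$ for all $i$ such that every edge of $G$ is in exactly one of them. Let $u_i$ be the vertex in $B_i\cap B_{i+1}$ for $1\le i\le 2k$, let $u_0=u_{2k}$, and let $\tilde G_i$ be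 obtained from $G_i$ by adding a new edge $e_i$ joining $u_{i-1}$ and $u_i$. Let \[M^{H,\mathcal B}=M(W_k)\oplus_2M(\tilde G_1)\oplus_2M^*(\tilde G_2)\oplus_2M(\tilde G_3)\oplus_2M^*(\tilde G_4)\oplus_2\cdots\oplus_2M(\tilde G_{2k-1})\oplus_2M^*(\tilde G_{2k}),\] where the edge $e_i$ of $W_k$ is identified with the edge $e_i$ of $\tilde G_i$ for $1\le i\le 2k$, and the expression is bracketed to the left. Then all these $2$-sums are defined, $M^{H,\mathcal B}$ is a matroid on $E(G)$, and \[\mathcal F(\mathcal G(G,T))=\Bigl\{X\triangle\bigcup_{i=1}^{k}E(G_{2i}) : X\in\mathcal B(M^{H,\mathcal B})\Bigr\}.\] -/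

import Mathlib

open scoped symmDiff Graph

namespace Graph

variable {α β : Type*}

/-- `C` is the edge set of a cycle of `G`: a closed walk `v 0, e 0, v 1, …, e (n-1), v n = v 0`
of length `n ≥ 1` in which `v 0, …, v (n-1)` are distinct and `e 0, …, e (n-1)` are distinct.
(A loop is a cycle of length 1; two parallel edges form a cycle of length 2.) -/
def IsCycle (G : Graph α β) (C : Set β) : Prop :=
  ∃ (n : ℕ) (v : ℕ → α) (e : ℕ → β), 1 ≤ n ∧ Set.InjOn v (Set.Iio n) ∧
    Set.InjOn e (Set.Iio n) ∧ v n = v 0 ∧ (∀ i < n, G.IsLink (e i) (v i) (v (i + 1))) ∧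
    C = e '' Set.Iio n

/-- `F` is a set of edges of `G` that contains no cycle. -/
def IsAcyclicSet (G : Graph α β) (F : Set β) : Prop :=
  F ⊆ E(G) ∧ ∀ C, G.IsCycle C → ¬ C ⊆ F

/-- `x` and `y` are joined by a walk of `G` all of whose edges are in `F`. -/
def JoinedIn (G : Graph α β) (F : Set β) : α → α → Prop :=
  Relation.ReflTransGen fun a b => ∃ f ∈ F, G.IsLink f a b

lemma JoinedIn.symm {G : Graph α β} {F : Set β} {x y : α} (h : G.JoinedIn F x y) :
    G.JoinedIn F y x := by
  induction h with
  | refl => exact .refl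
  | tail _ h ih =>
    obtain ⟨f, hf, hl⟩ := h
    exact (Relation.ReflTransGen.single ⟨f, hf, hl.symm⟩).trans ih

lemma IsAcyclicSet.insert_of_not_joinedIn {G : Graph α β} {F : Set β} {g : β} {x y : α}
    (hF : G.IsAcyclicSet F) (hg : G.IsLink g x y) (h : ¬ G.JoinedIn F x y) :
    G.IsAcyclicSet (insert g F) := by
  refine ⟨Set.insert_subset hg.edge_mem hF.1, ?_⟩
  rintro C ⟨n, v, e, hn, hv, he, hv0, hl, rfl⟩ hC
  have key : ∀ a b, a ≤ b → b ≤ n → (∀ j, a ≤ j → j < b → e j ∈ F) →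
      G.JoinedIn F (v a) (v b) := by
    intro a b hab
    induction b, hab using Nat.le_induction with
    | base => exact fun _ _ => .refl
    | succ b hab ih =>
      intro hb hj
      exact (ih (by omega) fun j h1 h2 => hj j h1 (by omega)).tail
        ⟨e b, hj b hab (by omega), hl b (by omega)⟩
  by_cases hgC : g ∈ e '' Set.Iio n
  · obtain ⟨i, hi, rfl⟩ := hgC
    have hi' : i < n := hi
    have hmem : ∀ j, j < n → j ≠ i → e j ∈ F := by
      intro j hj hji
      rcases hC ⟨j, hj, rfl⟩ with h' | h'
      · exact absurd (he hj hi h') hji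
      · exact h'
    have h1 := key (i + 1) n hi' le_rfl fun j h1 h2 => hmem j h2 (by omega)
    have h2 := key 0 i (by omega) hi'.le fun j _ h2 => hmem j (by omega) (by omega)
    rw [hv0] at h1
    have h3 : G.JoinedIn F (v (i + 1)) (v i) := h1.trans h2
    rcases hg.eq_and_eq_or_eq_and_eq (hl i hi') with ⟨rfl, rfl⟩ | ⟨rfl, rfl⟩
    · exact h h3.symm
    · exact h h3
  · refine hF.2 _ ⟨n, v, e, hn, hv, he, hv0, hl, rfl⟩ fun f hf => ?_
    rcases hC hf with rfl | h'
    · exact absurd hf hgC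
    · exact h'

lemma IsAcyclicSet.not_joinedIn {G : Graph α β} {F : Set β} {f : β} {x y : α}
    (hF : G.IsAcyclicSet F) (hf : f ∈ F) (hl : G.IsLink f x y) :
    ¬ G.JoinedIn (F \ {f}) x y := by
  classical
  intro h
  let S : SimpleGraph α :=
    { Adj := fun a b => a ≠ b ∧ ∃ f' ∈ F \ {f}, G.IsLink f' a b
      symm := ⟨fun a b h => ⟨h.1.symm, h.2.imp fun f' h' => ⟨h'.1, h'.2.symm⟩⟩⟩
      loopless := ⟨fun a h => h.1 rfl⟩ }
  have hr : S.Reachable x y := by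
    clear hl
    induction h with
    | refl => exact .refl _
    | @tail b c _ hbc ih =>
      by_cases hbc' : b = c
      · exact hbc' ▸ ih
      · exact ih.trans (SimpleGraph.Adj.reachable ⟨hbc', hbc⟩)
  obtain ⟨p, hp⟩ := hr.exists_isPath
  have hadj : ∀ i, i < p.length → ∃ f' ∈ F \ {f}, G.IsLink f' (p.getVert i) (p.getVert (i + 1)) :=
    fun i hi => (p.adj_getVert_succ hi).2
  have : Nonempty β := ⟨f⟩
  choose! e he hle using hadj
  have hinj := hp.getVert_injOn
  refine hF.2 _ ⟨p.length + 1, fun i => if i ≤ p.length then p.getVert i else x,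
    fun i => if i < p.length then e i else f, by omega, ?_, ?_, ?_, ?_, rfl⟩ ?_
  · intro i hi j hj hij
    have hi' : i ≤ p.length := Nat.lt_succ_iff.1 hi
    have hj' : j ≤ p.length := Nat.lt_succ_iff.1 hj
    simp only [hi', hj', if_true] at hij
    exact hinj hi' hj' hij
  · intro i hi j hj hij
    have hi' : i ≤ p.length := Nat.lt_succ_iff.1 hi
    have hj' : j ≤ p.length := Nat.lt_succ_iff.1 hj
    dsimp only at hij
    split_ifs at hij with h1 h2 h2
    · have hli := hle i h1
      have hlj := hle j h2
      rw [← hij] at hlj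
      rcases hli.eq_and_eq_or_eq_and_eq hlj with ⟨h3, -⟩ | ⟨h3, h4⟩
      · exact hinj hi' hj' h3
      · have := @hinj i hi' (j + 1) (Nat.succ_le_of_lt h2) h3
        have := @hinj (i + 1) (Nat.succ_le_of_lt h1) j hj' h4
        omega
    · exact absurd hij (he i h1).2
    · exact absurd hij.symm (he j h2).2
    · omega
  · simp
  · intro i hi
    rcases Nat.lt_succ_iff_lt_or_eq.1 hi with h1 | rfl
    · simp [h1, h1.le, Nat.succ_le_of_lt h1, hle i h1]
    · simpa using hl.symm
  · rintro _ ⟨i, -, rfl⟩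
    dsimp only
    split_ifs with h1
    · exact (he i h1).1
    · exact hf

lemma IsAcyclicSet.subset {G : Graph α β} {I J : Set β} (hJ : G.IsAcyclicSet J) (h : I ⊆ J) :
    G.IsAcyclicSet I :=
  ⟨h.trans hJ.1, fun C hC hCI => hJ.2 C hC (hCI.trans h)⟩

lemma IsAcyclicSet.ncard_le {G : Graph α β} {I : Set β}
    (hIf : I.Finite) : ∀ (n : ℕ) (J : Set β), G.IsAcyclicSet J → J.Finite → (J \ I).ncard = n →
    (∀ f ∈ J, ∀ x y, G.IsLink f x y → G.JoinedIn I x y) → J.ncard ≤ I.ncard := by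
  intro n
  induction n with
  | zero =>
    intro J hJ hJf hn _
    have : J \ I = ∅ := (Set.ncard_eq_zero (hJf.subset Set.sdiff_subset)).1 hn
    exact Set.ncard_le_ncard (Set.sdiff_eq_empty.1 this) hIf
  | succ n ih =>
    intro J hJ hJf hn hspan
    obtain ⟨f, hfJ, hfI⟩ : (J \ I).Nonempty := by
      rw [Set.nonempty_iff_ne_empty]
      intro h0
      simp [h0] at hn
    obtain ⟨x, y, hl⟩ := G.exists_isLink_of_mem_edgeSet (hJ.1 hfJ)
    have hnot := hJ.not_joinedIn hfJ hl
    obtain ⟨g, hgI, a, b, hgl, hgab⟩ : ∃ g ∈ I, ∃ a b, G.IsLink g a b ∧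
        ¬ G.JoinedIn (J \ {f}) a b := by
      by_contra! hcon
      refine hnot ?_
      have hxy := hspan f hfJ x y hl
      clear hnot hl
      induction hxy with
      | refl => exact .refl
      | tail _ h ih =>
        obtain ⟨g, hg, hgl⟩ := h
        exact ih.trans (hcon g hg _ _ hgl)
    have hgJ : g ∉ J := fun hgJ =>
      hgab (.single ⟨g, ⟨hgJ, fun h => hfI (h ▸ hgI)⟩, hgl⟩)
    have hJ' := (hJ.subset Set.sdiff_subset).insert_of_not_joinedIn hgl hgab
    have hsub : insert g (J \ {f}) \ I = (J \ I) \ {f} := by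
      ext z
      simp only [Set.mem_sdiff, Set.mem_insert_iff, Set.mem_singleton_iff]
      constructor
      · rintro ⟨rfl | h, h'⟩
        · exact absurd hgI h'
        · exact ⟨⟨h.1, h'⟩, h.2⟩
      · exact fun h => ⟨Or.inr ⟨h.1.1, h.2⟩, h.1.2⟩
    have hcard : (insert g (J \ {f})).ncard = J.ncard := by
      rw [Set.ncard_insert_of_notMem (fun h => hgJ h.1) (hJf.subset Set.sdiff_subset),
        Set.ncard_sdiff_singleton_add_one hfJ hJf]
    rw [← hcard]
    refine ih _ hJ' ((hJf.subset Set.sdiff_subset).insert g) ?_ ?_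
    · have := Set.ncard_sdiff_singleton_add_one (s := J \ I) ⟨hfJ, hfI⟩
        (hJf.subset Set.sdiff_subset)
      rw [hsub]
      omega
    · rintro f' (rfl | hf') x y hl'
      · exact .single ⟨f', hgI, hl'⟩
      · exact hspan f' hf'.1 x y hl'

/-- The cycle matroid `M(G)`: its ground set is `E(G)`, its independent sets are the edge sets
containing no cycle, and so its bases are the maximal such sets. -/
def cycleMatroid (G : Graph α β) : Matroid β :=
  (IndepMatroid.ofFinitaryCardAugment E(G) G.IsAcyclicSet
    ⟨Set.empty_subset _, by
      rintro C ⟨n, v, e, hn, -, -, -, -, rfl⟩ h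
      exact h ⟨0, hn, rfl⟩⟩
    (fun _ _ hJ h => hJ.subset h)
    (by
      intro I J hI hIf hJ hJf hlt
      by_contra! hcon
      refine (IsAcyclicSet.ncard_le hIf _ J hJ hJf rfl fun f hf x y hl => ?_).not_gt hlt
      by_cases hfI : f ∈ I
      · exact .single ⟨f, hfI, hl⟩
      · by_contra h
        exact hcon f hf hfI (hI.insert_of_not_joinedIn hl h))
    (by
      refine fun I h => ⟨fun f hf => (h {f} (by simpa using hf) (by simp)).1 rfl, ?_⟩
      rintro C hC hCI
      have hfin : C.Finite := by
        obtain ⟨n, v, e, hn, -, -, -, -, rfl⟩ := hC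
        exact (Set.finite_Iio n).image e
      exact (h C hCI hfin).2 C hC subset_rfl)
    fun _ h => h.1).matroid

@[simp] lemma cycleMatroid_ground (G : Graph α β) : G.cycleMatroid.E = E(G) := rfl

@[simp] lemma cycleMatroid_indep (G : Graph α β) (F : Set β) :
    G.cycleMatroid.Indep F ↔ G.IsAcyclicSet F := Iff.rfl

end Graph

namespace Matroid

variable {β : Type*}

/-- The 2-sum of `M₁` and `M₂` is defined: they are matroids on finite sets with exactly one common
element `e`, and `e` is neither a loop nor a coloop of `M₁` or `M₂`. -/
def HasTwoSum (M₁ M₂ : Matroid β) : Prop :=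
  M₁.E.Finite ∧ M₂.E.Finite ∧ ∃ e, M₁.E ∩ M₂.E = {e} ∧
    ¬ M₁.IsLoop e ∧ ¬ M₁.IsColoop e ∧ ¬ M₂.IsLoop e ∧ ¬ M₂.IsColoop e

/-- The circuits of the 2-sum: the circuits of `M₁` and of `M₂` avoiding the common element, and the
sets `C₁ ∆ C₂` where `C₁`, `C₂` are circuits of `M₁`, `M₂` both containing the common element. -/
def IsTwoSumCircuit (M₁ M₂ : Matroid β) (C : Set β) : Prop :=
  (M₁.IsCircuit C ∧ Disjoint C M₂.E) ∨ (M₂.IsCircuit C ∧ Disjoint C M₁.E) ∨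
    ∃ C₁ C₂, M₁.IsCircuit C₁ ∧ M₂.IsCircuit C₂ ∧ (C₁ ∩ C₂).Nonempty ∧ C = C₁ ∆ C₂

/-- A set is independent in the 2-sum if it contains none of the circuits of the 2-sum. -/
def IsTwoSumIndep (M₁ M₂ : Matroid β) (I : Set β) : Prop :=
  I ⊆ M₁.E ∆ M₂.E ∧ ∀ C, M₁.IsTwoSumCircuit M₂ C → ¬ C ⊆ I

lemma isTwoSumCircuit_comm {M₁ M₂ : Matroid β} {C : Set β} :
    M₁.IsTwoSumCircuit M₂ C ↔ M₂.IsTwoSumCircuit M₁ C := by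
  have key : ∀ {M₁ M₂ : Matroid β}, M₁.IsTwoSumCircuit M₂ C → M₂.IsTwoSumCircuit M₁ C := by
    rintro M₁ M₂ (h | h | ⟨C₁, C₂, h₁, h₂, h, rfl⟩)
    · exact Or.inr (Or.inl h)
    · exact Or.inl h
    · exact Or.inr (Or.inr ⟨C₂, C₁, h₂, h₁, by rwa [Set.inter_comm], symmDiff_comm _ _⟩)
  exact ⟨key, key⟩

lemma isTwoSumIndep_comm {M₁ M₂ : Matroid β} {I : Set β} :
    M₁.IsTwoSumIndep M₂ I ↔ M₂.IsTwoSumIndep M₁ I := by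
  simp only [IsTwoSumIndep, symmDiff_comm, isTwoSumCircuit_comm (M₁ := M₁)]

lemma isTwoSumIndep_iff {M₁ M₂ : Matroid β} {e : β} (he : M₁.E ∩ M₂.E = {e}) {I : Set β} :
    M₁.IsTwoSumIndep M₂ I ↔ I ⊆ M₁.E ∆ M₂.E ∧ M₁.Indep (I ∩ M₁.E) ∧ M₂.Indep (I ∩ M₂.E) ∧
      (M₁.Indep (insert e (I ∩ M₁.E)) ∨ M₂.Indep (insert e (I ∩ M₂.E))) := by
  have hee : e ∈ M₁.E ∩ M₂.E := he ▸ rfl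
  have hu : ∀ x, x ∈ M₁.E → x ∈ M₂.E → x = e := fun x h1 h2 => by
    have : x ∈ M₁.E ∩ M₂.E := ⟨h1, h2⟩
    rwa [he] at this
  refine and_congr_right fun hI => ?_
  have hI' : ∀ x ∈ I, (x ∈ M₁.E ∧ x ∉ M₂.E) ∨ (x ∈ M₂.E ∧ x ∉ M₁.E) := fun x hx =>
    Set.mem_symmDiff.1 (hI hx)
  have heI : e ∉ I := fun h => by have := hI' e h; have := hee.1; have := hee.2; tauto
  constructor
  · intro h
    have h1 : M₁.Indep (I ∩ M₁.E) := by
      by_contra hd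
      obtain ⟨C, hC, hCc⟩ := (not_indep_iff (M := M₁)).1 hd |>.exists_isCircuit_subset
      refine h C (Or.inl ⟨hCc, Set.disjoint_left.2 fun x hx hx2 => ?_⟩)
        (hC.trans Set.inter_subset_left)
      exact heI (hu x (hC hx).2 hx2 ▸ (hC hx).1)
    have h2 : M₂.Indep (I ∩ M₂.E) := by
      by_contra hd
      obtain ⟨C, hC, hCc⟩ := (not_indep_iff (M := M₂)).1 hd |>.exists_isCircuit_subset
      refine h C (Or.inr (Or.inl ⟨hCc, Set.disjoint_left.2 fun x hx hx2 => ?_⟩))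
        (hC.trans Set.inter_subset_left)
      exact heI (hu x hx2 (hC hx).2 ▸ (hC hx).1)
    refine ⟨h1, h2, ?_⟩
    by_contra! hcon
    obtain ⟨C₁, hC₁, hc₁⟩ := (not_indep_iff (M := M₁)
      (hX := Set.insert_subset hee.1 Set.inter_subset_right)).1 hcon.1 |>.exists_isCircuit_subset
    obtain ⟨C₂, hC₂, hc₂⟩ := (not_indep_iff (M := M₂)
      (hX := Set.insert_subset hee.2 Set.inter_subset_right)).1 hcon.2 |>.exists_isCircuit_subset
    have he1 : e ∈ C₁ := by
      by_contra hn
      exact hc₁.not_indep (h1.subset ((Set.subset_insert_iff_of_notMem hn).1 hC₁))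
    have he2 : e ∈ C₂ := by
      by_contra hn
      exact hc₂.not_indep (h2.subset ((Set.subset_insert_iff_of_notMem hn).1 hC₂))
    refine h _ (Or.inr (Or.inr ⟨C₁, C₂, hc₁, hc₂, ⟨e, he1, he2⟩, rfl⟩)) ?_
    intro x hx
    rcases Set.mem_symmDiff.1 hx with ⟨hx1, hx2⟩ | ⟨hx1, hx2⟩
    · rcases hC₁ hx1 with rfl | h'
      · exact absurd he2 hx2
      · exact h'.1
    · rcases hC₂ hx1 with rfl | h'
      · exact absurd he1 hx2
      · exact h'.1
  · rintro ⟨h1, h2, h3⟩ C (⟨hC, -⟩ | ⟨hC, -⟩ | ⟨C₁, C₂, hc₁, hc₂, ⟨x, hx1, hx2⟩, rfl⟩) hCI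
    · exact hC.not_indep (h1.subset (Set.subset_inter hCI hC.subset_ground))
    · exact hC.not_indep (h2.subset (Set.subset_inter hCI hC.subset_ground))
    · obtain rfl := hu x (hc₁.subset_ground hx1) (hc₂.subset_ground hx2)
      rcases h3 with h3 | h3
      · refine hc₁.not_indep (h3.subset fun y hy => ?_)
        by_cases hye : y = x
        · exact Or.inl hye
        · refine Or.inr ⟨hCI (Set.mem_symmDiff.2 (Or.inl ⟨hy, fun hy2 => hye ?_⟩)),
            hc₁.subset_ground hy⟩
          exact hu y (hc₁.subset_ground hy) (hc₂.subset_ground hy2)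
      · refine hc₂.not_indep (h3.subset fun y hy => ?_)
        by_cases hye : y = x
        · exact Or.inl hye
        · refine Or.inr ⟨hCI (Set.mem_symmDiff.2 (Or.inr ⟨hy, fun hy2 => hye ?_⟩)),
            hc₂.subset_ground hy⟩
          exact hu y (hc₁.subset_ground hy2) (hc₂.subset_ground hy)

lemma IsTwoSumIndep.exists_insert {M₁ M₂ : Matroid β} {e : β} (he : M₁.E ∩ M₂.E = {e})
    {I J : Set β} (hI : M₁.IsTwoSumIndep M₂ I) (hIf : I.Finite)
    (hJ : M₁.IsTwoSumIndep M₂ J) (hJf : J.Finite) (hlt : I.ncard < J.ncard)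
    (hlt₁ : (I ∩ M₁.E).ncard < (J ∩ M₁.E).ncard) :
    ∃ f ∈ J, f ∉ I ∧ M₁.IsTwoSumIndep M₂ (insert f I) := by
  have hee : e ∈ M₁.E ∩ M₂.E := he ▸ rfl
  have hu : ∀ x, x ∈ M₁.E → x ∈ M₂.E → x = e := fun x h1 h2 => by
    have : x ∈ M₁.E ∩ M₂.E := ⟨h1, h2⟩
    rwa [he] at this
  obtain ⟨hIE, hI1, hI2, hI3⟩ := (isTwoSumIndep_iff he).1 hI
  obtain ⟨hJE, hJ1, hJ2, hJ3⟩ := (isTwoSumIndep_iff he).1 hJ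
  have hnot : ∀ {X : Set β}, X ⊆ M₁.E ∆ M₂.E → e ∉ X := fun hX h => by
    rcases Set.mem_symmDiff.1 (hX h) with h' | h'
    · exact h'.2 hee.2
    · exact h'.2 hee.1
  have heI := hnot hIE
  have heJ := hnot hJE
  have hcard : ∀ {X : Set β}, X ⊆ M₁.E ∆ M₂.E → X.Finite →
      X.ncard = (X ∩ M₁.E).ncard + (X ∩ M₂.E).ncard := by
    intro X hX hXf
    rw [← Set.ncard_union_eq ?_ (hXf.inter_of_left _) (hXf.inter_of_left _),
      ← Set.inter_union_distrib_left, Set.inter_eq_left.2]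
    · intro x hx
      rcases Set.mem_symmDiff.1 (hX hx) with h' | h'
      · exact Or.inl h'.1
      · exact Or.inr h'.1
    · refine Set.disjoint_left.2 fun x h1 h2 => hnot hX (hu x h1.2 h2.2 ▸ h1.1)
  have hcI := hcard hIE hIf
  have hcJ := hcard hJE hJf
  have hI1f : (I ∩ M₁.E).Finite := hIf.inter_of_left _
  have hI2f : (I ∩ M₂.E).Finite := hIf.inter_of_left _
  have hJ1f : (J ∩ M₁.E).Finite := hJf.inter_of_left _
  have hJ2f : (J ∩ M₂.E).Finite := hJf.inter_of_left _
  have aug : ∀ {M : Matroid β} {A B : Set β}, M.Indep A → M.Indep B → A.Finite → B.Finite →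
      A.ncard < B.ncard → ∃ f ∈ B, f ∉ A ∧ M.Indep (insert f A) := by
    intro M A B hA hB hAf hBf hAB
    obtain ⟨f, hf, hfi⟩ := hA.augment hB
      (by rw [← hAf.cast_ncard_eq, ← hBf.cast_ncard_eq]; exact_mod_cast hAB)
    exact ⟨f, hf.1, hf.2, hfi⟩
  have hins₁ : ∀ {f}, f ∈ M₁.E → insert f I ∩ M₁.E = insert f (I ∩ M₁.E) :=
    fun hf => Set.insert_inter_of_mem hf
  have hins₂ : ∀ {f}, f ∈ M₂.E → insert f I ∩ M₂.E = insert f (I ∩ M₂.E) :=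
    fun hf => Set.insert_inter_of_mem hf
  have hinsE : ∀ {f}, f ∈ J → insert f I ⊆ M₁.E ∆ M₂.E := fun hf =>
    Set.insert_subset (hJE hf) hIE
  have hJne : ∀ {f}, f ∈ J → f ≠ e := fun hf h => heJ (h ▸ hf)
  have hn₂ : ∀ {f}, f ∈ J → f ∈ M₁.E → f ∉ M₂.E := fun hf h1 h2 => hJne hf (hu _ h1 h2)
  by_cases ha2 : M₂.Indep (insert e (I ∩ M₂.E))
  · obtain ⟨f, hfJ, hfI, hf⟩ := aug hI1 hJ1 hI1f hJ1f hlt₁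
    refine ⟨f, hfJ.1, fun h => hfI ⟨h, hfJ.2⟩, (isTwoSumIndep_iff he).2 ⟨hinsE hfJ.1, ?_⟩⟩
    rw [hins₁ hfJ.2, Set.insert_inter_of_notMem (hn₂ hfJ.1 hfJ.2)]
    exact ⟨hf, hI2, Or.inr ha2⟩
  have ha1 : M₁.Indep (insert e (I ∩ M₁.E)) := hI3.resolve_right ha2
  have hc1 : (insert e (I ∩ M₁.E)).ncard = (I ∩ M₁.E).ncard + 1 :=
    Set.ncard_insert_of_notMem (fun h => heI h.1) hI1f
  have fin : ∀ {f}, f ∈ J → f ∈ M₁.E → f ∉ insert e (I ∩ M₁.E) →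
      M₁.Indep (insert f (insert e (I ∩ M₁.E))) →
      ∃ f ∈ J, f ∉ I ∧ M₁.IsTwoSumIndep M₂ (insert f I) := by
    intro f hfJ hf1 hfI hf
    refine ⟨f, hfJ, fun h => hfI (Or.inr ⟨h, hf1⟩), (isTwoSumIndep_iff he).2 ⟨hinsE hfJ, ?_⟩⟩
    rw [hins₁ hf1, Set.insert_inter_of_notMem (hn₂ hfJ hf1)]
    refine ⟨hf.subset (Set.insert_subset_insert (Set.subset_insert _ _)), hI2, Or.inl ?_⟩
    rwa [Set.insert_comm]
  by_cases hlt' : (insert e (I ∩ M₁.E)).ncard < (J ∩ M₁.E).ncard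
  · obtain ⟨f, hfJ, hfI, hf⟩ := aug ha1 hJ1 (hI1f.insert _) hJ1f hlt'
    exact fin hfJ.1 hfJ.2 hfI hf
  rcases hJ3 with hJ3 | hJ3
  · have hc2 : (insert e (J ∩ M₁.E)).ncard = (J ∩ M₁.E).ncard + 1 :=
      Set.ncard_insert_of_notMem (fun h => heJ h.1) hJ1f
    obtain ⟨f, hfJ, hfI, hf⟩ := aug ha1 hJ3 (hI1f.insert _) (hJ1f.insert _) (by omega)
    rcases hfJ with rfl | hfJ
    · exact absurd (Set.mem_insert _ _) hfI
    · exact fin hfJ.1 hfJ.2 hfI hf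
  · have hc2 : (insert e (J ∩ M₂.E)).ncard = (J ∩ M₂.E).ncard + 1 :=
      Set.ncard_insert_of_notMem (fun h => heJ h.1) hJ2f
    obtain ⟨f, hfJ, hfI, hf⟩ := aug hI2 hJ3 hI2f (hJ2f.insert _) (by omega)
    rcases hfJ with rfl | hfJ
    · exact absurd hf ha2
    · have hf1 : f ∉ M₁.E := fun h => hJne hfJ.1 (hu f h hfJ.2)
      refine ⟨f, hfJ.1, fun h => hfI ⟨h, hfJ.2⟩, (isTwoSumIndep_iff he).2 ⟨hinsE hfJ.1, ?_⟩⟩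
      rw [hins₂ hfJ.2, Set.insert_inter_of_notMem hf1]
      exact ⟨hI1, hf, Or.inl ha1⟩

open Classical in
/-- The 2-sum `M₁ ⊕₂ M₂`, the matroid on `E(M₁) ∆ E(M₂)` with the circuits described by
`IsTwoSumCircuit`. Where the 2-sum is not defined the value is the empty matroid. -/
noncomputable def twoSum (M₁ M₂ : Matroid β) : Matroid β :=
  if h : M₁.HasTwoSum M₂ then
    (IndepMatroid.ofFinite (E := M₁.E ∆ M₂.E)
      ((h.1.union h.2.1).subset Set.symmDiff_subset_union) (M₁.IsTwoSumIndep M₂)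
      ⟨Set.empty_subset _, by
        obtain ⟨e, he, h1, -, h2, -⟩ := h.2.2
        have hee : e ∈ M₁.E ∩ M₂.E := he ▸ rfl
        refine (isTwoSumIndep_iff he).2 ⟨Set.empty_subset _, by simp, by simp, Or.inl ?_⟩ |>.2
        simpa using (not_isLoop_iff (M := M₁) (he := hee.1)).1 h1⟩
      (fun _ _ hJ hIJ => ⟨hIJ.trans hJ.1, fun C hC hCI => hJ.2 C hC (hCI.trans hIJ)⟩)
      (by
        intro I J hI hJ hlt
        obtain ⟨e, he, -⟩ := h.2.2
        have hfin : (M₁.E ∆ M₂.E).Finite := (h.1.union h.2.1).subset Set.symmDiff_subset_union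
        have hIf := hfin.subset hI.1
        have hJf := hfin.subset hJ.1
        by_cases h1 : (I ∩ M₁.E).ncard < (J ∩ M₁.E).ncard
        · exact hI.exists_insert he hIf hJ hJf hlt h1
        by_cases h2 : (I ∩ M₂.E).ncard < (J ∩ M₂.E).ncard
        · obtain ⟨f, hfJ, hfI, hf⟩ := (isTwoSumIndep_comm.1 hI).exists_insert
            (by rwa [Set.inter_comm]) hIf (isTwoSumIndep_comm.1 hJ) hJf hlt h2
          exact ⟨f, hfJ, hfI, isTwoSumIndep_comm.1 hf⟩
        have hle : J.ncard ≤ (J ∩ M₁.E).ncard + (J ∩ M₂.E).ncard := by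
          refine le_trans (Set.ncard_le_ncard (fun x hx => ?_)
            ((hJf.inter_of_left _).union (hJf.inter_of_left _))) (Set.ncard_union_le _ _)
          rcases Set.symmDiff_subset_union (hJ.1 hx) with h' | h'
          · exact Or.inl ⟨hx, h'⟩
          · exact Or.inr ⟨hx, h'⟩
        have hge : (I ∩ M₁.E).ncard + (I ∩ M₂.E).ncard ≤ I.ncard := by
          rw [← Set.ncard_union_eq ?_ (hIf.inter_of_left _) (hIf.inter_of_left _)]
          · exact Set.ncard_le_ncard
              (Set.union_subset Set.inter_subset_left Set.inter_subset_left) hIf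
          · refine Set.disjoint_left.2 fun x h1 h2 => ?_
            rcases Set.mem_symmDiff.1 (hI.1 h1.1) with h' | h'
            · exact h'.2 h2.2
            · exact h'.2 h1.2
        omega)
      fun _ h => h.1).matroid
  else emptyOn β

lemma twoSum_ground {M₁ M₂ : Matroid β} (h : M₁.HasTwoSum M₂) :
    (M₁.twoSum M₂).E = M₁.E ∆ M₂.E := by
  rw [twoSum, dif_pos h]; rfl

lemma twoSum_indep {M₁ M₂ : Matroid β} (h : M₁.HasTwoSum M₂) (I : Set β) :
    (M₁.twoSum M₂).Indep I ↔ M₁.IsTwoSumIndep M₂ I := by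
  rw [twoSum, dif_pos h]; rfl

lemma IsTwoSumCircuit.eq_of_subset {M₁ M₂ : Matroid β} (h : M₁.HasTwoSum M₂) {C D : Set β}
    (hC : M₁.IsTwoSumCircuit M₂ C) (hD : M₁.IsTwoSumCircuit M₂ D) (hDC : D ⊆ C) : D = C := by
  obtain ⟨-, -, e, he, hl₁, -, hl₂, -⟩ := h
  have hee : e ∈ M₁.E ∩ M₂.E := he ▸ rfl
  have hu : ∀ x, x ∈ M₁.E → x ∈ M₂.E → x = e := fun x h1 h2 => by
    have : x ∈ M₁.E ∩ M₂.E := ⟨h1, h2⟩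
    rwa [he] at this
  have hne : ∀ {M : Matroid β} {K : Set β}, ¬ M.IsLoop e → M.IsCircuit K → e ∈ K →
      ∃ x ∈ K, x ≠ e := by
    intro M K hl hK heK
    by_contra! hcon
    have : K = {e} := Set.eq_singleton_iff_unique_mem.2 ⟨heK, hcon⟩
    exact hl (singleton_isCircuit.1 (this ▸ hK))
  have hmem₁ : ∀ {K₁ K₂ : Set β}, M₁.IsCircuit K₁ → M₂.IsCircuit K₂ → ∀ x ∈ K₁, x ≠ e →
      x ∈ K₁ ∆ K₂ := fun h₁ h₂ x hx hxe => Set.mem_symmDiff.2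
    (Or.inl ⟨hx, fun hx2 => hxe (hu x (h₁.subset_ground hx) (h₂.subset_ground hx2))⟩)
  have hmem₂ : ∀ {K₁ K₂ : Set β}, M₁.IsCircuit K₁ → M₂.IsCircuit K₂ → ∀ x ∈ K₂, x ≠ e →
      x ∈ K₁ ∆ K₂ := fun h₁ h₂ x hx hxe => Set.mem_symmDiff.2
    (Or.inr ⟨hx, fun hx2 => hxe (hu x (h₁.subset_ground hx2) (h₂.subset_ground hx))⟩)
  have hboth : ∀ {K₁ K₂ : Set β}, M₁.IsCircuit K₁ → M₂.IsCircuit K₂ → (K₁ ∩ K₂).Nonempty →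
      e ∈ K₁ ∧ e ∈ K₂ := by
    rintro K₁ K₂ h₁ h₂ ⟨x, hx1, hx2⟩
    obtain rfl := hu x (h₁.subset_ground hx1) (h₂.subset_ground hx2)
    exact ⟨hx1, hx2⟩
  rcases hC with ⟨hC, hCd⟩ | ⟨hC, hCd⟩ | ⟨C₁, C₂, hC₁, hC₂, hCn, rfl⟩ <;>
  rcases hD with ⟨hD, hDd⟩ | ⟨hD, hDd⟩ | ⟨D₁, D₂, hD₁, hD₂, hDn, rfl⟩
  · exact hD.eq_of_subset_isCircuit hC hDC
  · obtain ⟨x, hx⟩ := hD.nonempty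
    exact absurd (hC.subset_ground (hDC hx)) (Set.disjoint_left.1 hDd hx)
  · obtain ⟨x, hx, hxe⟩ := hne hl₂ hD₂ (hboth hD₁ hD₂ hDn).2
    exact absurd (hD₂.subset_ground hx)
      (Set.disjoint_left.1 hCd (hDC (hmem₂ hD₁ hD₂ x hx hxe)))
  · obtain ⟨x, hx⟩ := hD.nonempty
    exact absurd (hC.subset_ground (hDC hx)) (Set.disjoint_left.1 hDd hx)
  · exact hD.eq_of_subset_isCircuit hC hDC
  · obtain ⟨x, hx, hxe⟩ := hne hl₁ hD₁ (hboth hD₁ hD₂ hDn).1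
    exact absurd (hD₁.subset_ground hx)
      (Set.disjoint_left.1 hCd (hDC (hmem₁ hD₁ hD₂ x hx hxe)))
  · have hDC₁ : D ⊆ C₁ := fun x hx => by
      rcases Set.mem_symmDiff.1 (hDC hx) with h' | h'
      · exact h'.1
      · exact absurd (hC₂.subset_ground h'.1) (Set.disjoint_left.1 hDd hx)
    obtain rfl := hD.eq_of_subset_isCircuit hC₁ hDC₁
    exact absurd hee.2 (Set.disjoint_left.1 hDd (hboth hC₁ hC₂ hCn).1)
  · have hDC₂ : D ⊆ C₂ := fun x hx => by
      rcases Set.mem_symmDiff.1 (hDC hx) with h' | h'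
      · exact absurd (hC₁.subset_ground h'.1) (Set.disjoint_left.1 hDd hx)
      · exact h'.1
    obtain rfl := hD.eq_of_subset_isCircuit hC₂ hDC₂
    exact absurd hee.1 (Set.disjoint_left.1 hDd (hboth hC₁ hC₂ hCn).2)
  · have heC := hboth hC₁ hC₂ hCn
    have h1 : D₁ ⊆ C₁ := fun x hx => by
      by_cases hxe : x = e
      · exact hxe ▸ heC.1
      rcases Set.mem_symmDiff.1 (hDC (hmem₁ hD₁ hD₂ x hx hxe)) with h' | h'
      · exact h'.1
      · exact absurd (hu x (hD₁.subset_ground hx) (hC₂.subset_ground h'.1)) hxe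
    have h2 : D₂ ⊆ C₂ := fun x hx => by
      by_cases hxe : x = e
      · exact hxe ▸ heC.2
      rcases Set.mem_symmDiff.1 (hDC (hmem₂ hD₁ hD₂ x hx hxe)) with h' | h'
      · exact absurd (hu x (hC₁.subset_ground h'.1) (hD₂.subset_ground hx)) hxe
      · exact h'.1
    rw [hD₁.eq_of_subset_isCircuit hC₁ h1, hD₂.eq_of_subset_isCircuit hC₂ h2]

/-- The circuits of the 2-sum are exactly the sets described by `IsTwoSumCircuit`. -/
lemma twoSum_isCircuit {M₁ M₂ : Matroid β} (h : M₁.HasTwoSum M₂) (C : Set β) :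
    (M₁.twoSum M₂).IsCircuit C ↔ M₁.IsTwoSumCircuit M₂ C := by
  have hground : ∀ {K}, M₁.IsTwoSumCircuit M₂ K → K ⊆ M₁.E ∆ M₂.E := by
    rintro K (⟨hK, hd⟩ | ⟨hK, hd⟩ | ⟨C₁, C₂, h₁, h₂, ⟨y, hy1, hy2⟩, rfl⟩) x hx
    · exact Set.mem_symmDiff.2 (Or.inl ⟨hK.subset_ground hx, Set.disjoint_left.1 hd hx⟩)
    · exact Set.mem_symmDiff.2 (Or.inr ⟨hK.subset_ground hx, Set.disjoint_left.1 hd hx⟩)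
    · obtain ⟨-, -, e, he, -⟩ := h
      have hu : ∀ x, x ∈ M₁.E → x ∈ M₂.E → x = e := fun x h1 h2 => by
        have : x ∈ M₁.E ∩ M₂.E := ⟨h1, h2⟩
        rwa [he] at this
      have hy := hu y (h₁.subset_ground hy1) (h₂.subset_ground hy2)
      rcases Set.mem_symmDiff.1 hx with ⟨hx1, hx2⟩ | ⟨hx1, hx2⟩
      · refine Set.mem_symmDiff.2 (Or.inl ⟨h₁.subset_ground hx1, fun h' => hx2 ?_⟩)
        exact (hu x (h₁.subset_ground hx1) h').trans hy.symm ▸ hy2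
      · refine Set.mem_symmDiff.2 (Or.inr ⟨h₂.subset_ground hx1, fun h' => hx2 ?_⟩)
        exact (hu x h' (h₂.subset_ground hx1)).trans hy.symm ▸ hy1
  have hdep : ∀ {K}, (M₁.twoSum M₂).Dep K ↔
      K ⊆ M₁.E ∆ M₂.E ∧ ∃ D, M₁.IsTwoSumCircuit M₂ D ∧ D ⊆ K := by
    intro K
    rw [Dep, twoSum_indep h, twoSum_ground h, IsTwoSumIndep]
    constructor
    · rintro ⟨h1, h2⟩
      refine ⟨h2, ?_⟩
      by_contra! hcon
      exact h1 ⟨h2, hcon⟩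
    · rintro ⟨h1, D, hD, hDK⟩
      exact ⟨fun h' => h'.2 D hD hDK, h1⟩
  rw [isCircuit_iff]
  constructor
  · rintro ⟨hC, hmin⟩
    obtain ⟨-, D, hD, hDC⟩ := hdep.1 hC
    exact hmin (hdep.2 ⟨hground hD, D, hD, subset_rfl⟩) hDC ▸ hD
  · intro hC
    refine ⟨hdep.2 ⟨hground hC, C, hC, subset_rfl⟩, fun K hK hKC => ?_⟩
    obtain ⟨-, D, hD, hDK⟩ := hdep.1 hK
    exact hKC.antisymm (IsTwoSumCircuit.eq_of_subset h hC hD (hDK.trans hKC) ▸ hDK)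

end Matroid

namespace Graph

variable {α β ι ε : Type*}

/-! ### Grafts and feasible sets -/

/-- `G` is nonempty and any two vertices of `G` are joined by a walk. -/
def IsConnected (G : Graph α β) : Prop :=
  V(G).Nonempty ∧ ∀ x ∈ V(G), ∀ y ∈ V(G), Relation.ReflTransGen G.Adj x y

/-- `C` is a component of `G`: a connected subgraph containing every edge of `G` incident with
one of its vertices. -/
def IsComponent (C G : Graph α β) : Prop :=
  C ≤c G ∧ C.IsConnected

/-- `G` has no cycle. -/
def IsForest (G : Graph α β) : Prop :=
  ∀ C, ¬ G.IsCycle C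

/-- `(G, T)` is a graft: `G` is a finite graph and `T` is a set of vertices of `G`. -/
structure IsGraft (G : Graph α β) (T : Set α) : Prop where
  finite_vertexSet : V(G).Finite
  finite_edgeSet : E(G).Finite
  subset : T ⊆ V(G)

/-- `H` is a `T`-spanning subgraph of `G`. -/
def IsTSpanning (G : Graph α β) (T : Set α) (H : Graph α β) : Prop :=
  H ≤ G ∧ V(H) = V(G) ∧ ∀ C : Graph α β, C.IsComponent H →
    Odd (V(C) ∩ T).ncard ∨ (V(C) ∩ T = ∅ ∧ (G.induce V(C)).IsComponent G)

/-- The feasible sets of `(G, T)`: the edge sets of the `T`-spanning forests of `G`. -/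
def feasibleSets (G : Graph α β) (T : Set α) : Set (Set β) :=
  {F | ∃ H : Graph α β, G.IsTSpanning T H ∧ H.IsForest ∧ E(H) = F}

/-! ### Cyclic decompositions -/

/-- `H` is bipartite. -/
def IsBipartite (H : Graph ι ε) : Prop :=
  ∃ c : ι → Bool, ∀ f x y, H.IsLink f x y → c x ≠ c y

/-- `(H, B)` is a cyclic decomposition of `(G, T)`. As `H` is bipartite, it has no loops, so the
degree of `x` is the number of edges incident with `x`. -/
structure IsCyclicDecomposition (G : Graph α β) (T : Set α) (H : Graph ι ε) (B : ι → Set α) :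
    Prop where
  finite_vertexSet : V(H).Finite
  finite_edgeSet : E(H).Finite
  bipartite : H.IsBipartite
  degree_le : ∀ x ∈ V(H), {f | H.Inc f x}.encard ≤ 2
  iUnion_eq : ⋃ x ∈ V(H), B x = V(G)
  adj : ∀ u v, G.Adj u v → ∃ x ∈ V(H), {u, v} ⊆ B x
  inter_subset : ∀ x ∈ V(H), ∀ y ∈ V(H), x ≠ y → B x ∩ B y ⊆ T
  encard_inter : ∀ x ∈ V(H), ∀ y ∈ V(H), x ≠ y → (B x ∩ B y).encard = {f | H.IsLink f x y}.encard
  encard_le : ∀ x ∈ V(H), (T ∩ B x).encard ≤ 2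

/-- A cyclic decomposition is nice if all its bags `G[B x]` are connected and every `x` with
`|B x ∩ T| ≤ 1` is an isolated vertex of `H`. -/
structure IsNiceCyclicDecomposition (G : Graph α β) (T : Set α) (H : Graph ι ε) (B : ι → Set α) :
    Prop extends IsCyclicDecomposition G T H B where
  connected : ∀ x ∈ V(H), (G.induce (B x)).IsConnected
  isolated : ∀ x ∈ V(H), (B x ∩ T).encard ≤ 1 → ∀ f, ¬ H.Inc f x

/-! ### Cycles, wheels, and the matroid of a cyclic decomposition -/

/-- The cyclic successor on `1, …, n`. -/
def cyclicSucc (n i : ℕ) : ℕ := if i = n then 1 else i + 1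

/-- The cycle `1, 2, …, n, 1` (for `n ≥ 1`): edge `i` joins `i` to its cyclic successor. -/
def cycleGraph (n : ℕ) : Graph ℕ ℕ where
  vertexSet := Set.Icc 1 n
  edgeSet := Set.Icc 1 n
  IsLink i x y := i ∈ Set.Icc 1 n ∧ s(x, y) = s(i, cyclicSucc n i)
  isLink_symm _ _ := ⟨fun _ _ h => ⟨h.1, Sym2.eq_swap.trans h.2⟩⟩
  eq_or_eq_of_isLink_of_isLink i x y v w h h' := by
    have := h.2.trans h'.2.symm
    simp only [Sym2.eq_iff] at this
    tauto
  edge_mem_iff_exists_isLink i := ⟨fun h => ⟨_, _, h, rfl⟩, fun ⟨_, _, h⟩ => h.1⟩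
  left_mem_of_isLink i x y h := by
    obtain ⟨⟨h1, h2⟩, h3⟩ := h
    simp only [Sym2.eq_iff, cyclicSucc] at h3
    simp only [Set.mem_Icc]
    split_ifs at h3 <;> omega

/-- The two ends of the edge `e_i` (`1 ≤ i ≤ 2k`) of the wheel graph `W_k`, where `0` is the centre
`s` and `j` is the rim vertex `t_j` for `1 ≤ j ≤ k`: the ends of `e_{2j-1}` are `t_j` and `t_{j+1}`,
and those of `e_{2j}` are `s` and `t_{j+1}`, where `t_{k+1} = t_1`. -/
def wheelEnds (k i : ℕ) : Sym2 ℕ :=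
  if Odd i then s((i + 1) / 2, cyclicSucc k ((i + 1) / 2)) else s(0, cyclicSucc k (i / 2))

/-- The wheel graph `W_k`, whose `2k` edges are labelled `e 1, …, e (2k)`. -/
def wheelGraph {β : Type*} (k : ℕ) (e : ℕ → β) (he : Set.InjOn e (Set.Icc 1 (2 * k))) :
    Graph ℕ β where
  vertexSet := Set.Icc 0 k
  edgeSet := e '' Set.Icc 1 (2 * k)
  IsLink f x y := ∃ i ∈ Set.Icc 1 (2 * k), f = e i ∧ s(x, y) = wheelEnds k i
  isLink_symm _ _ := ⟨fun _ _ ⟨i, hi, h, h'⟩ => ⟨i, hi, h, Sym2.eq_swap.trans h'⟩⟩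
  eq_or_eq_of_isLink_of_isLink f x y v w := by
    rintro ⟨i, hi, rfl, h⟩ ⟨j, hj, hij, h'⟩
    obtain rfl := he hi hj hij
    have := h.trans h'.symm
    simp only [Sym2.eq_iff] at this
    tauto
  edge_mem_iff_exists_isLink f := by
    constructor
    · rintro ⟨i, hi, rfl⟩
      induction h : wheelEnds k i with
      | _ x y => exact ⟨x, y, i, hi, rfl, h.symm⟩
    · rintro ⟨x, y, i, hi, rfl, -⟩
      exact ⟨i, hi, rfl⟩
  left_mem_of_isLink f x y := by
    rintro ⟨i, ⟨h1, h2⟩, -, h⟩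
    unfold wheelEnds at h
    simp only [Set.mem_Icc]
    split_ifs at h with hi
    · obtain ⟨m, rfl⟩ := hi
      simp only [Sym2.eq_iff, cyclicSucc] at h
      split_ifs at h <;> omega
    · obtain ⟨m, rfl⟩ := Nat.not_odd_iff_even.1 hi
      simp only [Sym2.eq_iff, cyclicSucc] at h
      split_ifs at h <;> omega

/-- The graph obtained from `G` by adding a new edge `e` joining `x` and `y`. -/
def addEdge (G : Graph α β) (e : β) (x y : α) : Graph α β where
  vertexSet := V(G) ∪ {x, y}
  edgeSet := insert e E(G)
  IsLink f a b := (f = e ∧ s(a, b) = s(x, y)) ∨ (f ≠ e ∧ G.IsLink f a b)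
  isLink_symm _ _ := ⟨fun _ _ h =>
    h.imp (fun h => ⟨h.1, Sym2.eq_swap.trans h.2⟩) fun h => ⟨h.1, h.2.symm⟩⟩
  eq_or_eq_of_isLink_of_isLink f a b c d := by
    rintro (⟨rfl, h⟩ | ⟨hf, h⟩) (⟨hf', h'⟩ | ⟨hf', h'⟩)
    · have := h.trans h'.symm
      simp only [Sym2.eq_iff] at this
      tauto
    · exact absurd rfl hf'
    · exact absurd hf' hf
    · exact h.left_eq_or_eq h'
  edge_mem_iff_exists_isLink f := by
    by_cases hf : f = e
    · subst hf
      exact ⟨fun _ => ⟨x, y, Or.inl ⟨rfl, rfl⟩⟩, fun _ => Or.inl rfl⟩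
    · simp [hf, edge_mem_iff_exists_isLink]
  left_mem_of_isLink f a b := by
    rintro (⟨-, h⟩ | ⟨-, h⟩)
    · simp only [Sym2.eq_iff] at h
      simp only [Set.mem_union, Set.mem_insert_iff, Set.mem_singleton_iff]
      tauto
    · exact Or.inl h.left_mem

/-- The `i`-th summand: `M(G̃ᵢ)` for odd `i` and `M*(G̃ᵢ)` for even `i`, where `G̃ᵢ` is obtained from
`Gs i` by adding the edge `e i` joining `u (i - 1)` and `u i`. -/
noncomputable def bagMatroid (Gs : ℕ → Graph α β) (u : ℕ → α) (e : ℕ → β) (i : ℕ) : Matroid β :=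
  if Odd i then ((Gs i).addEdge (e i) (u (i - 1)) (u i)).cycleMatroid
  else ((Gs i).addEdge (e i) (u (i - 1)) (u i)).cycleMatroid✶

end Graph

/-- `N ⊕₂ M 1 ⊕₂ M 2 ⊕₂ ⋯ ⊕₂ M n`, bracketed to the left. -/
noncomputable def Matroid.iteratedTwoSum {β : Type*} (N : Matroid β) (M : ℕ → Matroid β) :
    ℕ → Matroid β
  | 0 => N
  | n + 1 => (iteratedTwoSum N M n).twoSum (M (n + 1))

/-- `M(W_k) ⊕₂ M(G̃₁) ⊕₂ M*(G̃₂) ⊕₂ M(G̃₃) ⊕₂ M*(G̃₄) ⊕₂ ⋯`, up to the summand with index `n`; the edge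
`e i` of `W_k` is identified with the new edge `e i` of `G̃ᵢ`. -/
noncomputable def Graph.wheelTwoSum {α β : Type*} (k : ℕ) (e : ℕ → β)
    (he : Set.InjOn e (Set.Icc 1 (2 * k))) (Gs : ℕ → Graph α β) (u : ℕ → α) (n : ℕ) : Matroid β :=
  (Graph.wheelGraph k e he).cycleMatroid.iteratedTwoSum (Graph.bagMatroid Gs u e) n

/-!
The attachment vertices `u i` are all of `T`, so `G` is a cyclic chain of connected graphs `Gs i`,
each sharing one vertex of `T` with the next. Both sides of the claimed equality are described by
the same data: how `F` meets each `Gs i`, and a condition on the set `S` of those indices `i` for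
which `F` joins the attachment vertices `u (i - 1)` and `u i` inside `Gs i`.

Feasible sets. Since `G` is connected and `T` is nonempty, `F` is feasible if and only if it is
acyclic and each of its components contains an odd number of elements of `T`
(`Graph.mem_feasibleSets_iff`). Hence in each `Gs i` every component of `F` reaches `u (i - 1)` or
`u i`: the set `F` restricts to a spanning tree (`i ∈ S`) or to a forest with two components
separating `u (i - 1)` and `u i` (`i ∉ S`), which is `Graph.IsRootedForest`. The component of `F`
between two cyclically consecutive indices `a < b` outside `S` contains exactly
`u a, …, u (b - 1)`. So feasibility means that, moreover, `S` is not everything and consecutive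
indices outside `S` have odd distance, `HasOddGaps S`
(`Graph.IsCyclicChain.mem_feasibleSets_iff`).

Bases. A base of a 2-sum is the union of a base of each summand, exactly one of which contains the
common element, with that element deleted (`Matroid.twoSum_isBase_iff`); iterating, a base of the
whole sum is a base `A` of `M(W_k)` with a base of each summand containing `e i` precisely when
`e i ∉ A` (`Matroid.IsTwoSumFamily.isBase_iteratedTwoSum_iff`). The bases of `M(G̃ᵢ)` without and
with `e i` are the spanning trees and the two-component separating forests of `Gs i`, and
complementation in the bags of even index turns bases of `M*(G̃ᵢ)` into the same objects with the
two cases exchanged (`Graph.isBase_bagMatroid_iff`). Thus `A` consists of the `e i` with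
`Odd i ↔ i ∈ S`.

The wheel. It remains to see that this set is a spanning tree of the wheel if and only if
`HasOddGaps S` (`Graph.IsCyclicWheel.isBase_iff_hasOddGaps`). The indices outside `S` are those of
the missing rim edges, which are odd, and of the chosen spokes, which are even. To have only odd
gaps means that these alternate, so that every segment of the rim left by the missing edges has
exactly one spoke.

Cyclic indices are unrolled to `ℤ` throughout, by way of `cyclicIndex`; conditions on indices are
then stated on intervals whose length is the period.
-/

/-! ### Bases of 2-sums -/

namespace Matroid

variable {β : Type*}

lemma exists_isBase_mem_of_not_isLoop {M : Matroid β} {e : β} (he : e ∈ M.E) (h : ¬ M.IsLoop e) :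
    ∃ B, M.IsBase B ∧ e ∈ B := by
  rw [isLoop_iff_forall_notMem_isBase] at h
  push Not at h
  exact h

lemma exists_isBase_notMem_of_not_isColoop {M : Matroid β} {e : β} (h : ¬ M.IsColoop e) :
    ∃ B, M.IsBase B ∧ e ∉ B := by
  rw [isColoop_iff_forall_mem_isBase] at h
  push Not at h
  exact h

lemma not_isLoop_of_mem_isBase {M : Matroid β} {e : β} {B : Set β} (hB : M.IsBase B)
    (he : e ∈ B) : ¬ M.IsLoop e :=
  fun h => (isLoop_iff_forall_mem_compl_isBase.1 h B hB).2 he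

lemma not_isColoop_of_notMem_isBase {M : Matroid β} {e : β} {B : Set β} (hB : M.IsBase B)
    (he : e ∉ B) : ¬ M.IsColoop e :=
  fun h => he (isColoop_iff_forall_mem_isBase.1 h hB)

lemma Indep.isBase_of_ncard_ge {M : Matroid β} {I B : Set β} (hM : M.E.Finite) (hI : M.Indep I)
    (hB : M.IsBase B) (h : B.ncard ≤ I.ncard) : M.IsBase I := by
  obtain ⟨B', hB', hIB⟩ := hI.exists_isBase_superset
  have := Set.eq_of_subset_of_ncard_le hIB (hB'.ncard_eq_ncard_of_isBase hB ▸ h)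
    (hM.subset hB'.subset_ground)
  rwa [this]

lemma Indep.ncard_le_isBase {M : Matroid β} {I B : Set β} (hM : M.E.Finite) (hI : M.Indep I)
    (hB : M.IsBase B) : I.ncard ≤ B.ncard := by
  obtain ⟨B', hB', hIB⟩ := hI.exists_isBase_superset
  exact hB'.ncard_eq_ncard_of_isBase hB ▸ Set.ncard_le_ncard hIB (hM.subset hB'.subset_ground)

lemma HasTwoSum.twoSum_ground_finite {M₁ M₂ : Matroid β} (h : M₁.HasTwoSum M₂) :
    (M₁.twoSum M₂).E.Finite := by
  rw [twoSum_ground h]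
  exact (h.1.union h.2.1).subset Set.symmDiff_subset_union

lemma notMem_of_subset_symmDiff {E₁ E₂ X : Set β} {e : β} (he : E₁ ∩ E₂ = {e})
    (hX : X ⊆ E₁ ∆ E₂) : e ∉ X := by
  have hee : e ∈ E₁ ∩ E₂ := he ▸ rfl
  intro h
  rcases Set.mem_symmDiff.1 (hX h) with h' | h'
  · exact h'.2 hee.2
  · exact h'.2 hee.1

lemma ncard_eq_add_of_subset_symmDiff {E₁ E₂ X : Set β} (hX : X ⊆ E₁ ∆ E₂) (hXf : X.Finite) :
    X.ncard = (X ∩ E₁).ncard + (X ∩ E₂).ncard := by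
  rw [← Set.ncard_union_eq ?_ (hXf.inter_of_left _) (hXf.inter_of_left _),
    ← Set.inter_union_distrib_left,
    Set.inter_eq_left.2 (hX.trans Set.symmDiff_subset_union)]
  refine Set.disjoint_left.2 fun x h1 h2 => ?_
  rcases Set.mem_symmDiff.1 (hX h1.1) with h' | h'
  · exact h'.2 h2.2
  · exact h'.2 h1.2

lemma union_sdiff_subset_symmDiff {E₁ E₂ B₁ B₂ : Set β} {e : β} (he : E₁ ∩ E₂ = {e})
    (h₁ : B₁ ⊆ E₁) (h₂ : B₂ ⊆ E₂) : (B₁ ∪ B₂) \ {e} ⊆ E₁ ∆ E₂ := by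
  rintro x ⟨hx | hx, hxe⟩
  · refine Set.mem_symmDiff.2 (Or.inl ⟨h₁ hx, fun h => hxe ?_⟩)
    rw [← he]
    exact ⟨h₁ hx, h⟩
  · refine Set.mem_symmDiff.2 (Or.inr ⟨h₂ hx, fun h => hxe ?_⟩)
    rw [← he]
    exact ⟨h, h₂ hx⟩

lemma union_sdiff_inter_left {E₁ E₂ B₁ B₂ : Set β} {e : β} (he : E₁ ∩ E₂ = {e})
    (h₁ : B₁ ⊆ E₁) (h₂ : B₂ ⊆ E₂) : ((B₁ ∪ B₂) \ {e}) ∩ E₁ = B₁ \ {e} := by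
  ext x
  constructor
  · rintro ⟨⟨hx | hx, hxe⟩, hx1⟩
    · exact ⟨hx, hxe⟩
    · refine absurd ?_ hxe
      rw [← he]
      exact ⟨hx1, h₂ hx⟩
  · exact fun hx => ⟨⟨Or.inl hx.1, hx.2⟩, h₁ hx.1⟩

lemma union_sdiff_inter_right {E₁ E₂ B₁ B₂ : Set β} {e : β} (he : E₁ ∩ E₂ = {e})
    (h₁ : B₁ ⊆ E₁) (h₂ : B₂ ⊆ E₂) : ((B₁ ∪ B₂) \ {e}) ∩ E₂ = B₂ \ {e} := by
  rw [Set.union_comm]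
  exact union_sdiff_inter_left (Set.inter_comm E₁ E₂ ▸ he) h₂ h₁

/-- The bases of a 2-sum with common element `e` arise from a base of each summand, exactly one of
which contains `e`, by deleting `e` from the union. The rank of the 2-sum is therefore one less
than the sum of the ranks, and the proof compares cardinalities. -/
theorem twoSum_isBase_iff {M₁ M₂ : Matroid β} {e : β} (h : M₁.HasTwoSum M₂)
    (he : M₁.E ∩ M₂.E = {e}) {X : Set β} :
    (M₁.twoSum M₂).IsBase X ↔ X ⊆ M₁.E ∆ M₂.E ∧
      ((M₁.IsBase (X ∩ M₁.E) ∧ M₂.IsBase (insert e (X ∩ M₂.E))) ∨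
        (M₁.IsBase (insert e (X ∩ M₁.E)) ∧ M₂.IsBase (X ∩ M₂.E))) := by
  have hfin : (M₁.E ∆ M₂.E).Finite := (h.1.union h.2.1).subset Set.symmDiff_subset_union
  have hee : e ∈ M₁.E ∩ M₂.E := he ▸ rfl
  obtain ⟨hf₁, hf₂, e', he', hl, -, -, hc⟩ := id h
  obtain rfl : e' = e := by
    have : e' ∈ M₁.E ∩ M₂.E := he' ▸ rfl
    rwa [he] at this
  obtain ⟨B₁, hB₁, heB₁⟩ := exists_isBase_mem_of_not_isLoop hee.1 hl
  obtain ⟨B₂, hB₂, heB₂⟩ := exists_isBase_notMem_of_not_isColoop hc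
  have hind : ∀ {X}, (M₁.twoSum M₂).Indep X ↔ X ⊆ M₁.E ∆ M₂.E ∧ M₁.Indep (X ∩ M₁.E) ∧
      M₂.Indep (X ∩ M₂.E) ∧
      (M₁.Indep (insert e' (X ∩ M₁.E)) ∨ M₂.Indep (insert e' (X ∩ M₂.E))) :=
    fun {X} => (twoSum_indep h X).trans (isTwoSumIndep_iff he)
  have hcard : ∀ {X}, X ⊆ M₁.E ∆ M₂.E → X.ncard = (X ∩ M₁.E).ncard + (X ∩ M₂.E).ncard :=
    fun hX => ncard_eq_add_of_subset_symmDiff hX (hfin.subset hX)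
  have hins₁ : ∀ {X}, X ⊆ M₁.E ∆ M₂.E →
      (insert e' (X ∩ M₁.E)).ncard = (X ∩ M₁.E).ncard + 1 := fun hX =>
    Set.ncard_insert_of_notMem (fun h => notMem_of_subset_symmDiff he hX h.1)
      (hf₁.subset Set.inter_subset_right)
  have hins₂ : ∀ {X}, X ⊆ M₁.E ∆ M₂.E →
      (insert e' (X ∩ M₂.E)).ncard = (X ∩ M₂.E).ncard + 1 := fun hX =>
    Set.ncard_insert_of_notMem (fun h => notMem_of_subset_symmDiff he hX h.1)
      (hf₂.subset Set.inter_subset_right)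
  have hmp : ∀ {X}, (M₁.twoSum M₂).IsBase X → X ⊆ M₁.E ∆ M₂.E ∧
      ((M₁.IsBase (X ∩ M₁.E) ∧ M₂.IsBase (insert e' (X ∩ M₂.E))) ∨
        (M₁.IsBase (insert e' (X ∩ M₁.E)) ∧ M₂.IsBase (X ∩ M₂.E))) := by
    intro X hX
    obtain ⟨hXE, h1, h2, h3⟩ := hind.1 hX.indep
    have hYE := union_sdiff_subset_symmDiff he hB₁.subset_ground hB₂.subset_ground
    have hY1 := union_sdiff_inter_left he hB₁.subset_ground hB₂.subset_ground
    have hY2 := union_sdiff_inter_right he hB₁.subset_ground hB₂.subset_ground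
    have hY : (M₁.twoSum M₂).Indep ((B₁ ∪ B₂) \ {e'}) := by
      refine hind.2 ⟨hYE, ?_, ?_, Or.inl ?_⟩
      · rw [hY1]
        exact hB₁.indep.subset Set.sdiff_subset
      · rw [hY2]
        exact hB₂.indep.subset Set.sdiff_subset
      · rw [hY1, Set.insert_sdiff_singleton, Set.insert_eq_of_mem heB₁]
        exact hB₁.indep
    have hXY := hY.ncard_le_isBase h.twoSum_ground_finite hX
    have hYc := hcard hYE
    have hXc := hcard hXE
    have hd₁ := Set.ncard_sdiff_singleton_add_one heB₁ (hf₁.subset hB₁.subset_ground)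
    rw [hY1, hY2, Set.sdiff_singleton_eq_self heB₂] at hYc
    have hi₁ := hins₁ hXE
    have hi₂ := hins₂ hXE
    refine ⟨hXE, ?_⟩
    rcases h3 with h3 | h3
    · have l1 := h3.ncard_le_isBase hf₁ hB₁
      have l2 := h2.ncard_le_isBase hf₂ hB₂
      exact Or.inr ⟨h3.isBase_of_ncard_ge hf₁ hB₁ (by omega),
        h2.isBase_of_ncard_ge hf₂ hB₂ (by omega)⟩
    · have l1 := h3.ncard_le_isBase hf₂ hB₂
      have l2 := h1.ncard_le_isBase hf₁ hB₁
      exact Or.inl ⟨h1.isBase_of_ncard_ge hf₁ hB₁ (by omega),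
        h3.isBase_of_ncard_ge hf₂ hB₂ (by omega)⟩
  have hsize : ∀ {X}, X ⊆ M₁.E ∆ M₂.E →
      ((M₁.IsBase (X ∩ M₁.E) ∧ M₂.IsBase (insert e' (X ∩ M₂.E))) ∨
        (M₁.IsBase (insert e' (X ∩ M₁.E)) ∧ M₂.IsBase (X ∩ M₂.E))) →
      X.ncard + 1 = B₁.ncard + B₂.ncard := by
    intro X hXE hX
    have hXc := hcard hXE
    have hi₁ := hins₁ hXE
    have hi₂ := hins₂ hXE
    rcases hX with ⟨hX₁, hX₂⟩ | ⟨hX₁, hX₂⟩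
    all_goals
      have := hX₁.ncard_eq_ncard_of_isBase hB₁
      have := hX₂.ncard_eq_ncard_of_isBase hB₂
      omega
  refine ⟨hmp, fun ⟨hXE, hX⟩ => ?_⟩
  have hXi : (M₁.twoSum M₂).Indep X := by
    refine hind.2 ⟨hXE, ?_⟩
    rcases hX with ⟨hX₁, hX₂⟩ | ⟨hX₁, hX₂⟩
    · exact ⟨hX₁.indep, hX₂.indep.subset (Set.subset_insert _ _), Or.inr hX₂.indep⟩
    · exact ⟨hX₁.indep.subset (Set.subset_insert _ _), hX₂.indep, Or.inl hX₁.indep⟩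
  obtain ⟨Y, hY, hXY⟩ := hXi.exists_isBase_superset
  have hY' := hmp hY
  have h1 := hsize hXE hX
  have h2 := hsize hY'.1 hY'.2
  rwa [Set.eq_of_subset_of_ncard_le hXY (by omega) (hfin.subset hY'.1)]

/-- An element of the left summand, other than the common element, that is neither a loop nor a
coloop there is neither a loop nor a coloop of the 2-sum: a base of the left summand is completed
by a base of the right summand that contains the common element or avoids it, as needed. -/
lemma HasTwoSum.not_isLoop_and_not_isColoop {M₁ M₂ : Matroid β} {e f : β} (h : M₁.HasTwoSum M₂)
    (he : M₁.E ∩ M₂.E = {e}) (hf : f ∈ M₁.E) (hfe : f ≠ e) (hl : ¬ M₁.IsLoop f)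
    (hc : ¬ M₁.IsColoop f) :
    ¬ (M₁.twoSum M₂).IsLoop f ∧ ¬ (M₁.twoSum M₂).IsColoop f := by
  have hee : e ∈ M₁.E ∩ M₂.E := he ▸ rfl
  have key : ∀ B₁, M₁.IsBase B₁ → ∃ X, (M₁.twoSum M₂).IsBase X ∧ X ∩ M₁.E = B₁ \ {e} := by
    intro B₁ hB₁
    obtain ⟨-, -, e', he', -, -, hl', hc'⟩ := id h
    obtain rfl : e' = e := by
      have : e' ∈ M₁.E ∩ M₂.E := he' ▸ rfl
      rwa [he] at this
    by_cases heB : e' ∈ B₁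
    · obtain ⟨B₂, hB₂, heB₂⟩ := exists_isBase_notMem_of_not_isColoop hc'
      have h1 := union_sdiff_inter_left he hB₁.subset_ground hB₂.subset_ground
      refine ⟨(B₁ ∪ B₂) \ {e'}, (twoSum_isBase_iff h he).2
        ⟨union_sdiff_subset_symmDiff he hB₁.subset_ground hB₂.subset_ground, Or.inr ?_⟩, h1⟩
      rw [h1, union_sdiff_inter_right he hB₁.subset_ground hB₂.subset_ground,
        Set.insert_sdiff_singleton, Set.insert_eq_of_mem heB, Set.sdiff_singleton_eq_self heB₂]
      exact ⟨hB₁, hB₂⟩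
    · obtain ⟨B₂, hB₂, heB₂⟩ := exists_isBase_mem_of_not_isLoop hee.2 hl'
      have h1 := union_sdiff_inter_left he hB₁.subset_ground hB₂.subset_ground
      refine ⟨(B₁ ∪ B₂) \ {e'}, (twoSum_isBase_iff h he).2
        ⟨union_sdiff_subset_symmDiff he hB₁.subset_ground hB₂.subset_ground, Or.inl ?_⟩, h1⟩
      rw [h1, union_sdiff_inter_right he hB₁.subset_ground hB₂.subset_ground,
        Set.insert_sdiff_singleton, Set.insert_eq_of_mem heB₂, Set.sdiff_singleton_eq_self heB]
      exact ⟨hB₁, hB₂⟩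
  constructor
  · obtain ⟨B₁, hB₁, hfB⟩ := exists_isBase_mem_of_not_isLoop hf hl
    obtain ⟨X, hX, hX1⟩ := key B₁ hB₁
    have : f ∈ X ∩ M₁.E := hX1 ▸ ⟨hfB, hfe⟩
    exact not_isLoop_of_mem_isBase hX this.1
  · obtain ⟨B₁, hB₁, hfB⟩ := exists_isBase_notMem_of_not_isColoop hc
    obtain ⟨X, hX, hX1⟩ := key B₁ hB₁
    refine not_isColoop_of_notMem_isBase hX fun hfX => hfB ?_
    have : f ∈ X ∩ M₁.E := ⟨hfX, hf⟩
    rw [hX1] at this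
    exact this.1

/-- The hypotheses under which the matroids `M 1, …, M n` can be attached by 2-sums to the elements
`e 1, …, e n` of `N`: `M i` has ground set `S i` together with `e i`, the sets `S i` are disjoint
from each other and from `N`, and `e i` is neither a loop nor a coloop of `N` or `M i`. -/
structure IsTwoSumFamily (N : Matroid β) (M : ℕ → Matroid β) (e : ℕ → β) (S : ℕ → Set β)
    (n : ℕ) : Prop where
  finite : ∀ i ∈ Set.Icc 1 n, (S i).Finite
  injOn : Set.InjOn e (Set.Icc 1 n)
  ground : N.E = e '' Set.Icc 1 n
  ground_summand : ∀ i ∈ Set.Icc 1 n, (M i).E = insert (e i) (S i)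
  disjoint_ground : ∀ i ∈ Set.Icc 1 n, Disjoint (S i) N.E
  disjoint : ∀ i ∈ Set.Icc 1 n, ∀ j ∈ Set.Icc 1 n, i ≠ j → Disjoint (S i) (S j)
  not_isLoop : ∀ i ∈ Set.Icc 1 n, ¬ N.IsLoop (e i)
  not_isColoop : ∀ i ∈ Set.Icc 1 n, ¬ N.IsColoop (e i)
  not_isLoop_summand : ∀ i ∈ Set.Icc 1 n, ¬ (M i).IsLoop (e i)
  not_isColoop_summand : ∀ i ∈ Set.Icc 1 n, ¬ (M i).IsColoop (e i)

namespace IsTwoSumFamily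

variable {N : Matroid β} {M : ℕ → Matroid β} {e : ℕ → β} {S : ℕ → Set β} {n : ℕ}

/-- The ground set after the first `m` of `n` summands have been attached. -/
def partialGround (e : ℕ → β) (S : ℕ → Set β) (n m : ℕ) : Set β :=
  e '' Set.Ioc m n ∪ ⋃ i ∈ Set.Icc 1 m, S i

lemma apply_mem (h : IsTwoSumFamily N M e S n) {i : ℕ} (hi : i ∈ Set.Icc 1 n) : e i ∈ N.E :=
  h.ground ▸ ⟨i, hi, rfl⟩

lemma apply_notMem (h : IsTwoSumFamily N M e S n) {i j : ℕ} (hi : i ∈ Set.Icc 1 n)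
    (hj : j ∈ Set.Icc 1 n) : e i ∉ S j :=
  fun h' => Set.disjoint_left.1 (h.disjoint_ground j hj) h' (h.apply_mem hi)

lemma partialGround_inter (h : IsTwoSumFamily N M e S n) {m : ℕ} (hm : m < n) :
    partialGround e S n m ∩ (M (m + 1)).E = {e (m + 1)} := by
  have hm1 : m + 1 ∈ Set.Icc 1 n := ⟨by omega, by omega⟩
  rw [h.ground_summand _ hm1]
  ext x
  simp only [partialGround, Set.mem_inter_iff, Set.mem_union, Set.mem_image, Set.mem_iUnion,
    Set.mem_insert_iff, Set.mem_singleton_iff, exists_prop]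
  constructor
  · rintro ⟨⟨i, hi, rfl⟩ | ⟨i, hi, hx⟩, hx' | hx'⟩
    · exact hx'
    · exact absurd hx' (h.apply_notMem ⟨by have := hi.1; omega, hi.2⟩ hm1)
    · exact hx'
    · refine absurd hx' (Set.disjoint_left.1 (h.disjoint i ⟨hi.1, by have := hi.2; omega⟩ _ hm1 ?_) hx)
      have := hi.2
      omega
  · rintro rfl
    exact ⟨Or.inl ⟨m + 1, ⟨by omega, by omega⟩, rfl⟩, Or.inl rfl⟩

lemma partialGround_symmDiff (h : IsTwoSumFamily N M e S n) {m : ℕ} (hm : m < n) :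
    partialGround e S n m ∆ (M (m + 1)).E = partialGround e S n (m + 1) := by
  have hm1 : m + 1 ∈ Set.Icc 1 n := ⟨by omega, by omega⟩
  have hint := h.partialGround_inter hm
  have hdis : ∀ x ∈ partialGround e S n m, x ∈ (M (m + 1)).E → x = e (m + 1) := fun x h1 h2 => by
    have : x ∈ partialGround e S n m ∩ (M (m + 1)).E := ⟨h1, h2⟩
    rwa [hint] at this
  have heE : e (m + 1) ∈ partialGround e S n m ∩ (M (m + 1)).E := hint ▸ rfl
  ext x
  rw [Set.mem_symmDiff]
  constructor
  · rintro (⟨⟨i, hi, rfl⟩ | hx, hx'⟩ | ⟨hx, hx'⟩)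
    · refine Or.inl ⟨i, ⟨?_, hi.2⟩, rfl⟩
      have : i ≠ m + 1 := by
        rintro rfl
        exact hx' heE.2
      have := hi.1
      omega
    · refine Or.inr ?_
      simp only [Set.mem_iUnion, exists_prop] at hx ⊢
      obtain ⟨i, hi, hx⟩ := hx
      exact ⟨i, ⟨hi.1, hi.2.trans (by omega)⟩, hx⟩
    · refine Or.inr ?_
      rw [h.ground_summand _ hm1] at hx
      rcases hx with rfl | hx
      · exact absurd heE.1 hx'
      · simp only [Set.mem_iUnion, exists_prop]
        exact ⟨m + 1, ⟨by omega, le_rfl⟩, hx⟩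
  · rintro (⟨i, hi, rfl⟩ | hx)
    · have hi' : i ∈ Set.Icc 1 n := ⟨by have := hi.1; omega, hi.2⟩
      have hmem : e i ∈ partialGround e S n m := Or.inl ⟨i, ⟨by have := hi.1; omega, hi.2⟩, rfl⟩
      refine Or.inl ⟨hmem, fun h' => ?_⟩
      have := h.injOn hi' hm1 (hdis _ hmem h')
      have := hi.1
      omega
    · simp only [Set.mem_iUnion, exists_prop] at hx
      obtain ⟨i, hi, hx⟩ := hx
      have hi' : i ∈ Set.Icc 1 n := ⟨hi.1, hi.2.trans (by omega)⟩
      have hxe : x ≠ e (m + 1) := by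
        rintro rfl
        exact h.apply_notMem hm1 hi' hx
      rcases Nat.lt_or_ge m i with him | him
      · obtain rfl : i = m + 1 := le_antisymm hi.2 him
        have hx2 : x ∈ (M (m + 1)).E := by
          rw [h.ground_summand _ hm1]
          exact Or.inr hx
        exact Or.inr ⟨hx2, fun h' => hxe (hdis _ h' hx2)⟩
      · have hmem : x ∈ partialGround e S n m :=
          Or.inr (by
            simp only [Set.mem_iUnion, exists_prop]
            exact ⟨i, ⟨hi.1, him⟩, hx⟩)
        exact Or.inl ⟨hmem, fun h' => hxe (hdis _ hmem h')⟩

/-- The 2-sums are defined at every stage: the ground set of the partial sum is as expected and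
the elements `e i` still to be used remain neither loops nor coloops. -/
lemma partial_spec (h : IsTwoSumFamily N M e S n) {m : ℕ} (hm : m ≤ n) :
    (N.iteratedTwoSum M m).E = partialGround e S n m ∧
      (∀ i ∈ Set.Ioc m n, ¬ (N.iteratedTwoSum M m).IsLoop (e i) ∧
        ¬ (N.iteratedTwoSum M m).IsColoop (e i)) ∧
      ∀ j < m, (N.iteratedTwoSum M j).HasTwoSum (M (j + 1)) := by
  induction m with
  | zero =>
    refine ⟨?_, fun i hi => ?_, fun j hj => absurd hj (by omega)⟩
    · simp [partialGround, iteratedTwoSum, h.ground]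
      rfl
    · have hi' : i ∈ Set.Icc 1 n := ⟨hi.1, hi.2⟩
      exact ⟨h.not_isLoop i hi', h.not_isColoop i hi'⟩
  | succ m ih =>
    obtain ⟨hE, hlc, hts⟩ := ih (by omega)
    have hm1 : m + 1 ∈ Set.Icc 1 n := ⟨by omega, by omega⟩
    have hint : (N.iteratedTwoSum M m).E ∩ (M (m + 1)).E = {e (m + 1)} := by
      rw [hE, h.partialGround_inter (by omega)]
    have hfinE : (N.iteratedTwoSum M m).E.Finite := by
      rw [hE]
      refine ((Set.finite_Ioc m n).image e).union
        ((Set.finite_Icc 1 m).biUnion fun i hi => h.finite i ⟨hi.1, hi.2.trans (by omega)⟩)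
    have hlc1 := hlc (m + 1) ⟨by omega, by omega⟩
    have hsum : (N.iteratedTwoSum M m).HasTwoSum (M (m + 1)) := by
      refine ⟨hfinE, ?_, e (m + 1), hint, hlc1.1, hlc1.2, h.not_isLoop_summand _ hm1,
        h.not_isColoop_summand _ hm1⟩
      rw [h.ground_summand _ hm1]
      exact (h.finite _ hm1).insert _
    refine ⟨?_, fun i hi => ?_, fun j hj => ?_⟩
    · rw [iteratedTwoSum, twoSum_ground hsum, hE, h.partialGround_symmDiff (by omega)]
    · have hi' : i ∈ Set.Ioc m n := ⟨by have := hi.1; omega, hi.2⟩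
      refine hsum.not_isLoop_and_not_isColoop hint ?_ ?_ (hlc i hi').1 (hlc i hi').2
      · rw [hE]
        exact Or.inl ⟨i, hi', rfl⟩
      · intro h'
        have := h.injOn ⟨by have := hi.1; omega, hi.2⟩ hm1 h'
        have := hi.1
        omega
    · rcases Nat.lt_succ_iff_lt_or_eq.1 hj with hj | rfl
      · exact hts j hj
      · exact hsum

lemma hasTwoSum (h : IsTwoSumFamily N M e S n) {m : ℕ} (hm : m < n) :
    (N.iteratedTwoSum M m).HasTwoSum (M (m + 1)) :=
  (h.partial_spec (Nat.succ_le_of_lt hm)).2.2 m (Nat.lt_succ_self m)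

lemma partial_isBase_iff (h : IsTwoSumFamily N M e S n) {m : ℕ} (hm : m ≤ n) (X : Set β) :
    (N.iteratedTwoSum M m).IsBase X ↔ X ⊆ partialGround e S n m ∧
      ∃ A, N.IsBase A ∧ (∀ i ∈ Set.Ioc m n, e i ∈ A ↔ e i ∈ X) ∧ ∀ i ∈ Set.Icc 1 m,
        (e i ∈ A → (M i).IsBase (X ∩ S i)) ∧
          (e i ∉ A → (M i).IsBase (insert (e i) (X ∩ S i))) := by
  induction m generalizing X with
  | zero =>
    have hE : partialGround e S n 0 = N.E := (h.partial_spec (Nat.zero_le n)).1.symm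
    rw [hE]
    constructor
    · exact fun hX => ⟨hX.subset_ground, X, hX, fun _ _ => Iff.rfl,
        fun i hi => absurd hi.1 (by have := hi.2; omega)⟩
    · rintro ⟨hX, A, hA, hAX, -⟩
      have : A = X := by
        ext x
        constructor
        · intro hx
          obtain ⟨i, hi, rfl⟩ := h.ground ▸ hA.subset_ground hx
          exact (hAX i ⟨hi.1, hi.2⟩).1 hx
        · intro hx
          obtain ⟨i, hi, rfl⟩ := h.ground ▸ hX hx
          exact (hAX i ⟨hi.1, hi.2⟩).2 hx
      exact this ▸ hA
  | succ m ih =>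
    have hm1 : m + 1 ∈ Set.Icc 1 n := ⟨by omega, by omega⟩
    have hsum := h.hasTwoSum (m := m) (by omega)
    have hE := (h.partial_spec (m := m) (by omega)).1
    have hint : (N.iteratedTwoSum M m).E ∩ (M (m + 1)).E = {e (m + 1)} := by
      rw [hE, h.partialGround_inter (by omega)]
    rw [iteratedTwoSum, twoSum_isBase_iff hsum hint, hE, h.partialGround_symmDiff (by omega)]
    refine and_congr_right fun hX => ?_
    have heX : e (m + 1) ∉ X :=
      notMem_of_subset_symmDiff hint (by rwa [hE, h.partialGround_symmDiff (by omega)])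
    have hX2 : X ∩ (M (m + 1)).E = X ∩ S (m + 1) := by
      rw [h.ground_summand _ hm1, Set.inter_insert_of_notMem heX]
    have hIcc : ∀ {i}, i ∈ Set.Icc 1 m → i ∈ Set.Icc 1 n :=
      fun hi => ⟨hi.1, hi.2.trans (by omega)⟩
    have hS : ∀ i ∈ Set.Icc 1 m, X ∩ partialGround e S n m ∩ S i = X ∩ S i := fun i hi => by
      have hsub : S i ⊆ partialGround e S n m := fun x hx => Or.inr (Set.mem_biUnion hi hx)
      rw [Set.inter_assoc, Set.inter_eq_right.2 hsub]
    have hS' : ∀ i ∈ Set.Icc 1 m,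
        insert (e (m + 1)) (X ∩ partialGround e S n m) ∩ S i = X ∩ S i := fun i hi => by
      rw [Set.insert_inter_of_notMem (h.apply_notMem hm1 (hIcc hi)), hS i hi]
    have hemem : ∀ i ∈ Set.Ioc m n, e i ∈ partialGround e S n m :=
      fun i hi => Or.inl ⟨i, hi, rfl⟩
    have hne : ∀ i ∈ Set.Ioc (m + 1) n, e i ≠ e (m + 1) := fun i hi h' => by
      have := h.injOn ⟨by have := hi.1; omega, hi.2⟩ hm1 h'
      have := hi.1
      omega
    have hIoc : ∀ {i}, i ∈ Set.Ioc (m + 1) n → i ∈ Set.Ioc m n :=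
      fun hi => ⟨by have := hi.1; omega, hi.2⟩
    rw [ih (by omega), ih (by omega), hX2]
    constructor
    · rintro (⟨⟨-, A, hA, hAX, hAM⟩, hM⟩ | ⟨⟨-, A, hA, hAX, hAM⟩, hM⟩)
      · refine ⟨A, hA, fun i hi => ?_, fun i hi => ?_⟩
        · rw [hAX i (hIoc hi)]
          exact ⟨fun h' => h'.1, fun h' => ⟨h', hemem i (hIoc hi)⟩⟩
        · rcases Nat.lt_or_ge m i with him | him
          · obtain rfl : i = m + 1 := le_antisymm hi.2 him
            have heA : e (m + 1) ∉ A := fun h' =>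
              heX ((hAX _ ⟨by omega, by omega⟩).1 h').1
            exact ⟨fun h' => absurd h' heA, fun _ => hM⟩
          · rw [← hS i ⟨hi.1, him⟩]
            exact hAM i ⟨hi.1, him⟩
      · refine ⟨A, hA, fun i hi => ?_, fun i hi => ?_⟩
        · rw [hAX i (hIoc hi)]
          exact ⟨fun h' => (h'.resolve_left (hne i hi)).1, fun h' => Or.inr ⟨h', hemem i (hIoc hi)⟩⟩
        · rcases Nat.lt_or_ge m i with him | him
          · obtain rfl : i = m + 1 := le_antisymm hi.2 him
            have heA : e (m + 1) ∈ A := (hAX _ ⟨by omega, by omega⟩).2 (Or.inl rfl)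
            exact ⟨fun _ => hM, fun h' => absurd heA h'⟩
          · rw [← hS' i ⟨hi.1, him⟩]
            exact hAM i ⟨hi.1, him⟩
    · rintro ⟨A, hA, hAX, hAM⟩
      have hM := hAM (m + 1) ⟨by omega, le_rfl⟩
      by_cases heA : e (m + 1) ∈ A
      · refine Or.inr ⟨⟨Set.insert_subset (hemem _ ⟨by omega, by omega⟩) Set.inter_subset_right,
          A, hA, fun i hi => ?_, fun i hi => ?_⟩, hM.1 heA⟩
        · by_cases him : i = m + 1
          · subst him
            exact iff_of_true heA (Or.inl rfl)
          · have hi' : i ∈ Set.Ioc (m + 1) n := ⟨by have := hi.1; omega, hi.2⟩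
            rw [hAX i hi']
            exact ⟨fun h' => Or.inr ⟨h', hemem i hi⟩, fun h' => (h'.resolve_left (hne i hi')).1⟩
        · rw [hS' i hi]
          exact hAM i ⟨hi.1, hi.2.trans (by omega)⟩
      · refine Or.inl ⟨⟨Set.inter_subset_right,
          A, hA, fun i hi => ?_, fun i hi => ?_⟩, hM.2 heA⟩
        · by_cases him : i = m + 1
          · subst him
            exact iff_of_false heA fun h' => heX h'.1
          · have hi' : i ∈ Set.Ioc (m + 1) n := ⟨by have := hi.1; omega, hi.2⟩
            rw [hAX i hi']
            exact ⟨fun h' => ⟨h', hemem i hi⟩, fun h' => h'.1⟩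
        · rw [hS i hi]
          exact hAM i ⟨hi.1, hi.2.trans (by omega)⟩

lemma ground_iteratedTwoSum (h : IsTwoSumFamily N M e S n) :
    (N.iteratedTwoSum M n).E = ⋃ i ∈ Set.Icc 1 n, S i := by
  rw [(h.partial_spec le_rfl).1]
  simp [partialGround]

/-- A base of `N ⊕₂ M 1 ⊕₂ ⋯ ⊕₂ M n` consists of a base `A` of `N` and a base of each `M i`, where
`e i` is in exactly one of `A` and the base of `M i`, with all the elements `e i` deleted. -/
theorem isBase_iteratedTwoSum_iff (h : IsTwoSumFamily N M e S n) (X : Set β) :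
    (N.iteratedTwoSum M n).IsBase X ↔ X ⊆ ⋃ i ∈ Set.Icc 1 n, S i ∧
      ∃ A, N.IsBase A ∧ ∀ i ∈ Set.Icc 1 n, (e i ∈ A → (M i).IsBase (X ∩ S i)) ∧
        (e i ∉ A → (M i).IsBase (insert (e i) (X ∩ S i))) := by
  rw [h.partial_isBase_iff le_rfl]
  simp [partialGround]

end IsTwoSumFamily

end Matroid

/-! ### Acyclic sets and bases of cycle matroids -/

namespace Graph

variable {α β : Type*} {G K : Graph α β} {F F' : Set β} {x y z : α}

lemma JoinedIn.trans (h : G.JoinedIn F x y) (h' : G.JoinedIn F y z) : G.JoinedIn F x z :=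
  Relation.ReflTransGen.trans h h'

lemma JoinedIn.rfl : G.JoinedIn F x x := Relation.ReflTransGen.refl

lemma IsLink.joinedIn {f : β} (h : G.IsLink f x y) (hf : f ∈ F) : G.JoinedIn F x y :=
  .single ⟨f, hf, h⟩

/-- A set of vertices that no edge of `F` leaves is not left by walks with edges in `F`. -/
lemma JoinedIn.mem_of_closed (h : G.JoinedIn F x y) {Z : Set α}
    (hZ : ∀ f ∈ F, ∀ a b, G.IsLink f a b → a ∈ Z → b ∈ Z) (hx : x ∈ Z) : y ∈ Z := by
  induction h with
  | refl => exact hx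
  | tail _ h ih =>
    obtain ⟨f, hf, hl⟩ := h
    exact hZ f hf _ _ hl ih

lemma JoinedIn.mem (h : G.JoinedIn F x y) (hx : x ∈ V(G)) : y ∈ V(G) :=
  h.mem_of_closed (fun _ _ _ _ hl _ => hl.right_mem) hx

lemma JoinedIn.of_forall_isLink (h : G.JoinedIn F x y)
    (hF : ∀ f ∈ F, ∀ a b, G.IsLink f a b → K.JoinedIn F' a b) : K.JoinedIn F' x y :=
  h.mem_of_closed (Z := {z | K.JoinedIn F' x z}) (fun f hf a b hl ha => ha.trans (hF f hf a b hl))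
    .rfl

lemma JoinedIn.mono (h : K.JoinedIn F x y) (hK : K ≤ G) (hF : F ⊆ F') : G.JoinedIn F' x y :=
  h.of_forall_isLink fun _ hf _ _ hl => (hK.isLink_mono hl).joinedIn (hF hf)

lemma JoinedIn.inter_edgeSet (h : G.JoinedIn F x y) : G.JoinedIn (F ∩ E(G)) x y :=
  h.of_forall_isLink fun _ hf _ _ hl => hl.joinedIn ⟨hf, hl.edge_mem⟩

lemma joinedIn_of_forall_Ico (v : ℤ → α) {a b : ℤ} (hab : a ≤ b)
    (h : ∀ i, a ≤ i → i < b → G.JoinedIn F (v i) (v (i + 1))) : G.JoinedIn F (v a) (v b) := by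
  induction b, hab using Int.leInduction with
  | base => exact .rfl
  | succ b hab ih => exact (ih fun i h1 h2 => h i h1 (by omega)).trans (h b hab (by omega))

lemma IsCycle.of_le {C : Set β} (h : K.IsCycle C) (hK : K ≤ G) : G.IsCycle C := by
  obtain ⟨n, v, e, hn, hv, he, hv0, hl, rfl⟩ := h
  exact ⟨n, v, e, hn, hv, he, hv0, fun i hi => hK.isLink_mono (hl i hi), rfl⟩

lemma IsCycle.of_isLink_mem {C : Set β} (h : G.IsCycle C)
    (hK : ∀ f ∈ C, ∀ a b, G.IsLink f a b → K.IsLink f a b) : K.IsCycle C := by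
  obtain ⟨n, v, e, hn, hv, he, hv0, hl, rfl⟩ := h
  exact ⟨n, v, e, hn, hv, he, hv0, fun i hi => hK _ ⟨i, hi, rfl⟩ _ _ (hl i hi), rfl⟩

lemma IsAcyclicSet.of_le (h : G.IsAcyclicSet F) (hK : K ≤ G) : K.IsAcyclicSet (F ∩ E(K)) :=
  ⟨Set.inter_subset_right, fun _ hC hCF =>
    h.2 _ (hC.of_le hK) (hCF.trans Set.inter_subset_left)⟩

/-- The converse of `IsAcyclicSet.not_joinedIn`: if deleting any edge of `F` separates its ends
then `F` contains no cycle. -/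
lemma isAcyclicSet_of_forall_not_joinedIn (hF : F ⊆ E(G))
    (h : ∀ f ∈ F, ∀ x y, G.IsLink f x y → ¬ G.JoinedIn (F \ {f}) x y) : G.IsAcyclicSet F := by
  refine ⟨hF, ?_⟩
  rintro C ⟨n, v, e, hn, hv, he, hv0, hl, rfl⟩ hC
  have key : ∀ m, 1 ≤ m → m ≤ n → G.JoinedIn (F \ {e 0}) (v 1) (v m) := by
    intro m hm
    induction m, hm using Nat.le_induction with
    | base => exact fun _ => .rfl
    | succ m hm ih =>
      refine fun hmn => (ih (by omega)).trans ((hl m (by omega)).joinedIn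
        ⟨hC ⟨m, (by omega : m < n), rfl⟩, fun h0 => ?_⟩)
      have := he (by omega : m < n) (by omega : 0 < n) h0
      omega
  have h1 := key n hn le_rfl
  rw [hv0] at h1
  exact h _ (hC ⟨0, (by omega : 0 < n), rfl⟩) _ _ (hl 0 (by omega)) h1.symm

/-- In a connected graph the bases of the cycle matroid are the edge sets of spanning trees. -/
lemma isBase_cycleMatroid_iff (hG : G.IsConnected) (hx : x ∈ V(G)) :
    G.cycleMatroid.IsBase F ↔ G.IsAcyclicSet F ∧ ∀ z ∈ V(G), G.JoinedIn F z x := by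
  rw [Matroid.isBase_iff_maximal_indep, maximal_subset_iff, cycleMatroid_indep]
  refine and_congr_right fun hF => ⟨fun hmax z hz => ?_, fun hj J hJ hFJ => ?_⟩
  · have hxz := hG.2 z hz x hx
    clear hz hx
    induction hxz with
    | refl => exact .rfl
    | @tail a b _ hab ih =>
      obtain ⟨f, hf⟩ := hab
      refine ih.trans ?_
      by_contra hn
      have hfF : f ∉ F := fun h => hn (hf.joinedIn h)
      exact hfF (hmax (hF.insert_of_not_joinedIn hf hn) (Set.subset_insert _ _) ▸
        Set.mem_insert _ _)
  · refine hFJ.antisymm fun f hf => ?_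
    by_contra hfF
    obtain ⟨a, b, hl⟩ := G.exists_isLink_of_mem_edgeSet (hJ.1 hf)
    refine hJ.not_joinedIn hf hl (((hj a hl.left_mem).trans (hj b hl.right_mem).symm).mono le_rfl ?_)
    exact fun g hg => ⟨hFJ hg, fun h => hfF (h ▸ hg)⟩

lemma not_isLoop_cycleMatroid {e : β} (he : G.IsLink e x y) (hxy : x ≠ y) :
    ¬ G.cycleMatroid.IsLoop e := by
  have hemp : G.IsAcyclicSet ∅ := G.cycleMatroid.empty_indep
  have h := hemp.insert_of_not_joinedIn he fun h =>
    hxy (h.mem_of_closed (Z := {x}) (fun _ hf => absurd hf (Set.notMem_empty _)) rfl).symm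
  rw [insert_empty_eq] at h
  exact fun hl => hl.isCircuit.not_indep h

/-- An edge whose ends are joined by the other edges is not a coloop: in a basis that contains it,
it can be exchanged for an edge that reconnects its ends. -/
lemma not_isColoop_cycleMatroid {e : β} (he : G.IsLink e x y)
    (hxy : G.JoinedIn (E(G) \ {e}) x y) : ¬ G.cycleMatroid.IsColoop e := by
  intro hco
  obtain ⟨B, hB⟩ := G.cycleMatroid.exists_isBase
  have heB := hco.mem_of_isBase hB
  have hac : G.IsAcyclicSet B := hB.indep
  refine hac.not_joinedIn heB he (hxy.of_forall_isLink fun f hf a b hl => ?_)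
  by_contra hab
  have hfB : f ∉ B := fun h => hab (hl.joinedIn ⟨h, hf.2⟩)
  obtain ⟨B', hB', hsub⟩ := Matroid.Indep.exists_isBase_superset (M := G.cycleMatroid)
    ((hac.subset Set.sdiff_subset).insert_of_not_joinedIn hl hab)
  have hBB' : B ⊆ B' := fun g hg => by
    by_cases hge : g = e
    · exact hge ▸ hco.mem_of_isBase hB'
    · exact hsub (Or.inr ⟨hg, hge⟩)
  exact hfB (hB.eq_of_subset_isBase hB' hBB' ▸ hsub (Set.mem_insert _ _))

/-- `F` is a forest of `G` each of whose components contains `x` or `y`; so it is a spanning tree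
if `x` and `y` are joined in `F`, and otherwise has two components, one for each of `x`, `y`. -/
def IsRootedForest (G : Graph α β) (F : Set β) (x y : α) : Prop :=
  G.IsAcyclicSet F ∧ ∀ z ∈ V(G), G.JoinedIn F z x ∨ G.JoinedIn F z y

section addEdge

variable {e : β}

lemma le_addEdge (he : e ∉ E(G)) : G ≤ G.addEdge e x y :=
  ⟨Set.subset_union_left, fun _ _ _ hl => Or.inr ⟨fun h => he (h ▸ hl.edge_mem), hl⟩⟩

lemma isLink_addEdge : (G.addEdge e x y).IsLink e x y := Or.inl ⟨rfl, rfl⟩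

lemma IsLink.of_addEdge {f : β} {a b : α} (h : (G.addEdge e x y).IsLink f a b) (hf : f ≠ e) :
    G.IsLink f a b :=
  (h.resolve_left fun h' => hf h'.1).2

lemma vertexSet_addEdge (hx : x ∈ V(G)) (hy : y ∈ V(G)) : V(G.addEdge e x y) = V(G) :=
  Set.union_eq_self_of_subset_right (Set.insert_subset hx (Set.singleton_subset_iff.2 hy))

lemma edgeSet_addEdge : E(G.addEdge e x y) = insert e E(G) := rfl

lemma IsConnected.addEdge (hG : G.IsConnected) (he : e ∉ E(G)) (hx : x ∈ V(G)) (hy : y ∈ V(G)) :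
    (G.addEdge e x y).IsConnected := by
  rw [IsConnected, vertexSet_addEdge hx hy]
  exact ⟨hG.1, fun a ha b hb => Relation.ReflTransGen.mono
    (fun _ _ ⟨f, hf⟩ => ⟨f, (le_addEdge he).isLink_mono hf⟩) _ _ (hG.2 a ha b hb)⟩

lemma joinedIn_addEdge (he : e ∉ E(G)) (heF : e ∉ F) {a b : α} :
    (G.addEdge e x y).JoinedIn F a b ↔ G.JoinedIn F a b :=
  ⟨fun h => h.of_forall_isLink fun _ hf _ _ hl =>
    (hl.of_addEdge fun h' => heF (h' ▸ hf)).joinedIn hf, fun h => h.mono (le_addEdge he) subset_rfl⟩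

lemma isAcyclicSet_addEdge (he : e ∉ E(G)) (heF : e ∉ F) :
    (G.addEdge e x y).IsAcyclicSet F ↔ G.IsAcyclicSet F := by
  constructor
  · refine fun h => ⟨fun f hf => (h.1 hf).resolve_left fun h' => heF (h' ▸ hf), fun C hC hCF => ?_⟩
    exact h.2 C (hC.of_le (le_addEdge he)) hCF
  · refine fun h => ⟨h.1.trans (Set.subset_insert _ _), fun C hC hCF => ?_⟩
    exact h.2 C (hC.of_isLink_mem fun f hf _ _ hl => hl.of_addEdge fun h' => heF (h' ▸ hCF hf)) hCF

lemma isBase_addEdge_iff (hG : G.IsConnected) (he : e ∉ E(G)) (hx : x ∈ V(G)) (hy : y ∈ V(G))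
    (heF : e ∉ F) :
    (G.addEdge e x y).cycleMatroid.IsBase F ↔ G.IsRootedForest F x y ∧ G.JoinedIn F x y := by
  rw [isBase_cycleMatroid_iff (hG.addEdge he hx hy) (x := x) (vertexSet_addEdge hx hy ▸ hx),
    isAcyclicSet_addEdge he heF, vertexSet_addEdge hx hy]
  simp only [joinedIn_addEdge he heF]
  constructor
  · exact fun h => ⟨⟨h.1, fun z hz => Or.inl (h.2 z hz)⟩, (h.2 y hy).symm⟩
  · exact fun h => ⟨h.1.1, fun z hz => (h.1.2 z hz).elim id fun h' => h'.trans h.2.symm⟩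

lemma isBase_addEdge_insert_iff (hG : G.IsConnected) (he : e ∉ E(G)) (hx : x ∈ V(G))
    (hy : y ∈ V(G)) (heF : e ∉ F) :
    (G.addEdge e x y).cycleMatroid.IsBase (insert e F) ↔
      G.IsRootedForest F x y ∧ ¬ G.JoinedIn F x y := by
  rw [isBase_cycleMatroid_iff (hG.addEdge he hx hy) (x := x) (vertexSet_addEdge hx hy ▸ hx),
    vertexSet_addEdge hx hy]
  constructor
  · rintro ⟨hac, hj⟩
    refine ⟨⟨(isAcyclicSet_addEdge he heF).1 (hac.subset (Set.subset_insert _ _)),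
      fun z hz => ?_⟩, fun hxy => ?_⟩
    · refine ((hj z hz).symm).mem_of_closed (Z := {z | G.JoinedIn F z x ∨ G.JoinedIn F z y}) ?_
        (Or.inl .rfl)
      intro f hf a b hl ha
      by_cases hfe : f = e
      · subst hfe
        rcases hl.eq_and_eq_or_eq_and_eq isLink_addEdge with ⟨-, rfl⟩ | ⟨-, rfl⟩
        · exact Or.inr .rfl
        · exact Or.inl .rfl
      · have hba := ((hl.of_addEdge hfe).joinedIn (hf.resolve_left hfe)).symm
        exact ha.imp hba.trans hba.trans
    · refine hac.not_joinedIn (Set.mem_insert e F) isLink_addEdge ?_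
      rw [Set.insert_sdiff_self_of_notMem heF]
      exact (joinedIn_addEdge he heF).2 hxy
  · rintro ⟨⟨hac, hj⟩, hxy⟩
    refine ⟨((isAcyclicSet_addEdge he heF).2 hac).insert_of_not_joinedIn isLink_addEdge
      fun h => hxy ((joinedIn_addEdge he heF).1 h), fun z hz => ?_⟩
    rcases hj z hz with h | h
    · exact h.mono (le_addEdge he) (Set.subset_insert _ _)
    · exact (h.mono (le_addEdge he) (Set.subset_insert _ _)).trans
        (isLink_addEdge.symm.joinedIn (Set.mem_insert _ _))

/-- The new edge of `G.addEdge e x y` is not a coloop of the cycle matroid if `G` is connected. -/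
lemma not_isColoop_addEdge (hG : G.IsConnected) (he : e ∉ E(G)) (hx : x ∈ V(G))
    (hy : y ∈ V(G)) : ¬ (G.addEdge e x y).cycleMatroid.IsColoop e := by
  refine not_isColoop_cycleMatroid isLink_addEdge ?_
  suffices ∀ z, Relation.ReflTransGen G.Adj x z →
      (G.addEdge e x y).JoinedIn (E(G.addEdge e x y) \ {e}) x z from this y (hG.2 x hx y hy)
  intro z hz
  induction hz with
  | refl => exact .rfl
  | tail _ hab ih =>
    obtain ⟨f, hf⟩ := hab
    exact ih.trans (((le_addEdge he).isLink_mono hf).joinedIn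
      ⟨Set.mem_insert_of_mem _ hf.edge_mem, fun h => he (h ▸ hf.edge_mem)⟩)

end addEdge

end Graph

/-! ### Periodic sets of integers with odd gaps -/

section Periodic

variable {γ δ : Type*}

/-- If `f` has period `n` and takes distinct values on each interval of length `n`, then the value
of `f` determines that of every function of period `n`. -/
lemma Function.Periodic.eq_of_apply_eq {f : ℤ → γ} {φ : ℤ → δ} {n : ℤ} (hn : 0 < n)
    (hf : Function.Periodic f n) (hφ : Function.Periodic φ n)
    (hinj : ∀ i j, i < j → j < i + n → f i ≠ f j) {i j : ℤ} (h : f i = f j) : φ i = φ j := by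
  have hp : Function.Periodic (fun m => (f m, φ m)) n := fun m => by simp only [hf m, hφ m]
  obtain ⟨m, hm, hjm⟩ := hp.exists_mem_Ico hn j i
  simp only [Prod.mk.injEq] at hjm
  rcases hm.1.eq_or_lt with rfl | him
  · exact hjm.2.symm
  · exact absurd (h.trans hjm.1) (hinj i m him hm.2)

lemma not_odd_two_mul (m : ℤ) : ¬ Odd (2 * m) := Int.not_odd_iff_even.2 ⟨m, two_mul m⟩

/-- `S` is not everything, and the distance of two consecutive integers outside `S` is odd. -/
def HasOddGaps (S : Set ℤ) : Prop :=
  (∃ a, a ∉ S) ∧ ∀ a b, a < b → a ∉ S → b ∉ S → (∀ c, a < c → c < b → c ∈ S) → Odd (b - a)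

lemma exists_last_notMem_lt {S : Set ℤ} {n : ℤ} (hn : 0 < n)
    (hS : Function.Periodic (· ∈ S) n) (h : ∃ a, a ∉ S) (i : ℤ) :
    ∃ a < i, a ∉ S ∧ ∀ c, a < c → c < i → c ∈ S := by
  obtain ⟨a₀, ha₀⟩ := h
  obtain ⟨m, hm, ham⟩ := hS.exists_mem_Ico hn a₀ (i - n)
  obtain ⟨a, ⟨ha, haS⟩, hmax⟩ := Int.exists_greatest_of_bdd (P := fun z => z < i ∧ z ∉ S)
    ⟨i, fun z hz => hz.1.le⟩ ⟨m, by have := hm.2; omega, fun h' => ha₀ (ham.mpr h')⟩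
  refine ⟨a, ha, haS, fun c hac hci => ?_⟩
  by_contra hc
  exact absurd (hmax c ⟨hci, hc⟩) (by omega)

lemma exists_first_notMem_gt {S : Set ℤ} {n : ℤ} (hn : 0 < n)
    (hS : Function.Periodic (· ∈ S) n) (h : ∃ a, a ∉ S) (i : ℤ) :
    ∃ b > i, b ∉ S ∧ ∀ c, i < c → c < b → c ∈ S := by
  obtain ⟨a₀, ha₀⟩ := h
  obtain ⟨m, hm, ham⟩ := hS.exists_mem_Ico hn a₀ (i + 1)
  obtain ⟨b, ⟨hb, hbS⟩, hmin⟩ := Int.exists_least_of_bdd (P := fun z => i < z ∧ z ∉ S)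
    ⟨i, fun z hz => hz.1.le⟩ ⟨m, by have := hm.1; omega, fun h' => ha₀ (ham.mpr h')⟩
  refine ⟨b, hb, hbS, fun c hic hcb => ?_⟩
  by_contra hc
  exact absurd (hmin c ⟨hic, hc⟩) (by omega)

lemma le_add_of_forall_mem {S : Set ℤ} {n : ℤ} (hn : 0 < n) (hS : Function.Periodic (· ∈ S) n)
    {a b : ℤ} (ha : a ∉ S) (h : ∀ c, a < c → c < b → c ∈ S) : b ≤ a + n := by
  by_contra! hlt
  exact ha ((hS a).mp (h (a + n) (by omega) hlt))

end Periodic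

/-! ### Spanning trees of wheels -/

namespace Graph

variable {γ β : Type*}

/-- `W` is a wheel with centre `s` and rim vertices `t j`, where the indices of vertices are read
modulo `k` and those of edges modulo `2 * k`: the rim edge `e (2 * m - 1)` joins `t m` and
`t (m + 1)`, and the spoke `e (2 * m)` joins `s` and `t (m + 1)`. -/
structure IsCyclicWheel (W : Graph γ β) (k : ℤ) (s : γ) (t : ℤ → γ) (e : ℤ → β) : Prop where
  two_le : 2 ≤ k
  periodic_vertex : Function.Periodic t k
  periodic_edge : Function.Periodic e (2 * k)
  vertex_ne_center : ∀ j, t j ≠ s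
  vertex_ne : ∀ i j, i < j → j < i + k → t i ≠ t j
  edge_ne : ∀ i j, i < j → j < i + 2 * k → e i ≠ e j
  rim : ∀ m, W.IsLink (e (2 * m - 1)) (t m) (t (m + 1))
  spoke : ∀ m, W.IsLink (e (2 * m)) s (t (m + 1))
  exists_edge : ∀ f ∈ E(W), ∃ i, f = e i
  exists_vertex : ∀ x ∈ V(W), x = s ∨ ∃ j, x = t j

namespace IsCyclicWheel

variable {W : Graph γ β} {k : ℤ} {s : γ} {t : ℤ → γ} {e : ℤ → β} {S : Set ℤ} {A : Set β}

lemma center_mem (h : W.IsCyclicWheel k s t e) : s ∈ V(W) := (h.spoke 0).left_mem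

lemma isConnected (h : W.IsCyclicWheel k s t e) : W.IsConnected := by
  have key : ∀ x ∈ V(W), Relation.ReflTransGen W.Adj x s := by
    intro x hx
    rcases h.exists_vertex x hx with rfl | ⟨j, rfl⟩
    · exact .refl
    · have := (h.spoke (j - 1)).symm
      rw [sub_add_cancel] at this
      exact .single ⟨_, this⟩
  exact ⟨⟨s, h.center_mem⟩, fun x hx y hy =>
    (key x hx).trans (Std.Symm.symm _ _ (key y hy))⟩

lemma apply_mem_iff (h : W.IsCyclicWheel k s t e) (hS : Function.Periodic (· ∈ S) (2 * k))
    (i : ℤ) : e i ∈ e '' {i | Odd i ↔ i ∈ S} ↔ (Odd i ↔ i ∈ S) := by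
  have hk := h.two_le
  refine ⟨fun ⟨j, hj, hji⟩ => ?_, fun hi => ⟨i, hi, rfl⟩⟩
  refine (Function.Periodic.eq_of_apply_eq (φ := fun i => (Odd i ↔ i ∈ S)) (by omega)
    h.periodic_edge (fun m => ?_) h.edge_ne hji).mp hj
  have h1 : (m + 2 * k ∈ S) = (m ∈ S) := hS m
  have h2 : Odd (m + 2 * k) ↔ Odd m := by
    simp [Int.odd_add, parity_simps]
  simp only [h1, h2]

/-- If `A` contains neither of the two rim edges that leave the segment `t (j + 1), …, t l` of the
rim, and no spoke at this segment, then no edge of `A` leaves the segment. -/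
lemma segment_closed (h : W.IsCyclicWheel k s t e) {j l : ℤ}
    (hj : e (2 * j - 1) ∉ A) (hl : e (2 * l - 1) ∉ A)
    (hm : ∀ m, j ≤ m → m < l → e (2 * m) ∉ A) :
    ∀ f ∈ A, ∀ x y, W.IsLink f x y → x ∈ t '' Set.Icc (j + 1) l → y ∈ t '' Set.Icc (j + 1) l := by
  have hk := h.two_le
  have hper : ∀ c, Function.Periodic (fun m => (e (2 * m + c))) k := fun c m => by
    have := h.periodic_edge (2 * m + c)
    simp only
    rw [← this]
    ring_nf
  have hper' : ∀ c, Function.Periodic (fun m => (t (m + c))) k := fun c m => by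
    have := h.periodic_vertex (m + c)
    simp only
    rw [← this]
    ring_nf
  rintro f hf x y hxy ⟨p, ⟨hp1, hp2⟩, rfl⟩
  -- the rim vertex `t p` determines the edges at it and their other ends
  have hE : ∀ c {m}, t p = t m → e (2 * p + c) = e (2 * m + c) := fun c m hpm =>
    Function.Periodic.eq_of_apply_eq (φ := fun m => e (2 * m + c)) (by omega) h.periodic_vertex
      (hper c) h.vertex_ne hpm
  have hT : ∀ c {m}, t p = t m → t (p + c) = t (m + c) := fun c m hpm =>
    Function.Periodic.eq_of_apply_eq (φ := fun m => t (m + c)) (by omega) h.periodic_vertex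
      (hper' c) h.vertex_ne hpm
  obtain ⟨i, rfl⟩ := h.exists_edge f hxy.edge_mem
  rcases Int.even_or_odd' i with ⟨m, rfl | rfl⟩
  · rcases hxy.eq_and_eq_or_eq_and_eq (h.spoke m) with ⟨hp, -⟩ | ⟨hp, -⟩
    · exact absurd hp (h.vertex_ne_center p)
    · have := hE (-2) hp
      rw [show 2 * (m + 1) + (-2) = 2 * m by ring, show 2 * p + (-2) = 2 * (p - 1) by ring] at this
      exact absurd (this ▸ hf) (hm (p - 1) (by omega) (by omega))
  · have hrim := h.rim (m + 1)
    rw [show 2 * (m + 1) - 1 = 2 * m + 1 by ring] at hrim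
    rcases hxy.eq_and_eq_or_eq_and_eq hrim with ⟨hp, rfl⟩ | ⟨hp, rfl⟩
    · have := hE (-1) hp
      rw [show 2 * (m + 1) + (-1) = 2 * m + 1 by ring] at this
      refine ⟨p + 1, ⟨by omega, ?_⟩, hT 1 hp⟩
      have hpl : p ≠ l := by
        rintro rfl
        exact hl (by rw [sub_eq_add_neg, this]; exact hf)
      omega
    · have := hE (-3) hp
      rw [show 2 * (m + 1 + 1) + (-3) = 2 * m + 1 by ring] at this
      have h1 := hT (-1) hp
      rw [show m + 1 + 1 + (-1) = m + 1 by ring] at h1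
      refine ⟨p - 1, ⟨?_, by omega⟩, h1⟩
      have hpj : p ≠ j + 1 := by
        rintro rfl
        refine hj ?_
        rw [← this, show 2 * (j + 1) + (-3) = 2 * j - 1 by ring] at hf
        exact hf
      omega

lemma joinedIn_rim (h : W.IsCyclicWheel k s t e) {j l : ℤ} (hjl : j ≤ l)
    (hA : ∀ m, j ≤ m → m < l → e (2 * m - 1) ∈ A) : W.JoinedIn A (t j) (t l) :=
  joinedIn_of_forall_Ico t hjl fun m h1 h2 => (h.rim m).joinedIn (hA m h1 h2)

lemma not_joinedIn_segment (h : W.IsCyclicWheel k s t e) {j l p : ℤ} {y : γ}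
    (hj : e (2 * j - 1) ∉ A) (hl : e (2 * l - 1) ∉ A)
    (hm : ∀ m, j ≤ m → m < l → e (2 * m) ∉ A) (hp1 : j < p) (hp2 : p ≤ l)
    (hy : ∀ q, j < q → q ≤ l → t q ≠ y) : ¬ W.JoinedIn A (t p) y := by
  intro hpy
  obtain ⟨q, hq, hqy⟩ := hpy.mem_of_closed (h.segment_closed hj hl hm) ⟨p, ⟨by omega, hp2⟩, rfl⟩
  exact hy q (by have := hq.1; omega) hq.2 hqy

lemma hasOddGaps_of_isBase (h : W.IsCyclicWheel k s t e)
    (hS : Function.Periodic (· ∈ S) (2 * k))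
    (hB : W.cycleMatroid.IsBase (e '' {i | Odd i ↔ i ∈ S})) : HasOddGaps S := by
  have hk := h.two_le
  have hmem := h.apply_mem_iff hS
  rw [isBase_cycleMatroid_iff h.isConnected h.center_mem] at hB
  obtain ⟨hac, hj⟩ := hB
  have htV : ∀ j, t j ∈ V(W) := fun j => (h.rim j).left_mem
  constructor
  · by_contra! hall
    refine h.vertex_ne_center 0 ((hj _ (htV 0)).symm.mem_of_closed (Z := {s}) ?_ rfl)
    rintro _ ⟨i, hi, rfl⟩ a b hl rfl
    obtain ⟨m, rfl⟩ := hi.2 (hall i)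
    have hrim := h.rim (m + 1)
    rw [show 2 * (m + 1) - 1 = 2 * m + 1 by ring] at hrim
    rcases hl.eq_and_eq_or_eq_and_eq hrim with ⟨hp, -⟩ | ⟨hp, -⟩
    · exact absurd hp.symm (h.vertex_ne_center _)
    · exact absurd hp.symm (h.vertex_ne_center _)
  · intro a b hab ha hb hgap
    have hle := le_add_of_forall_mem (by omega) hS ha hgap
    by_contra hodd
    have hev := Int.not_odd_iff_even.1 hodd
    rcases Int.even_or_odd' a with ⟨j, rfl | rfl⟩
    · -- two spokes whose ends are joined on the rim
      obtain ⟨l, rfl⟩ : ∃ l, b = 2 * l := by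
        obtain ⟨r, hr⟩ := hev
        exact ⟨j + r, by omega⟩
      have hrimA : ∀ m, j < m → m ≤ l → e (2 * m - 1) ∈ e '' {i | Odd i ↔ i ∈ S} := by
        intro m h1 h2
        exact (hmem _).2 (iff_of_true ⟨m - 1, by ring⟩ (hgap _ (by omega) (by omega)))
      have hspA : ∀ m, 2 * m ∉ S → e (2 * m) ∈ e '' {i | Odd i ↔ i ∈ S} := fun m hm =>
        (hmem _).2 (iff_of_false (not_odd_two_mul m) hm)
      by_cases hlj : l < j + k
      · refine hac.not_joinedIn (hspA j ha) (h.spoke j) ?_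
        refine JoinedIn.trans ((h.spoke l).joinedIn ⟨hspA l hb,
          (h.edge_ne (2 * j) (2 * l) (by omega) (by omega)).symm⟩) (JoinedIn.symm
          (h.joinedIn_rim (by omega) fun m h1 h2 => ⟨hrimA m (by omega) (by omega), ?_⟩))
        exact (h.edge_ne (2 * j) (2 * m - 1) (by omega) (by omega)).symm
      · -- the whole rim
        obtain rfl : l = j + k := by omega
        refine hac.not_joinedIn (hrimA (j + 1) (by omega) (by omega)) (h.rim (j + 1)) ?_
        have : t (j + k + 1) = t (j + 1) := by
          rw [← h.periodic_vertex (j + 1)]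
          ring_nf
        rw [← this]
        refine JoinedIn.symm
          (h.joinedIn_rim (by omega) fun m h1 h2 => ⟨hrimA m (by omega) (by omega), ?_⟩)
        exact (h.edge_ne (2 * (j + 1) - 1) (2 * m - 1) (by omega) (by omega)).symm
    · -- a segment of the rim without spokes
      obtain ⟨l, rfl⟩ : ∃ l, b = 2 * l - 1 := by
        obtain ⟨r, hr⟩ := hev
        exact ⟨j + r + 1, by omega⟩
      refine h.not_joinedIn_segment (j := j + 1) (l := l) (p := l) ?_ ?_ ?_ (by omega) le_rfl
        (fun q _ _ => h.vertex_ne_center q) (hj _ (htV l))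
      · rw [show 2 * (j + 1) - 1 = 2 * j + 1 by ring, hmem]
        exact fun h' => ha (h'.1 ⟨j, rfl⟩)
      · rw [hmem]
        exact fun h' => hb (h'.1 ⟨l - 1, by ring⟩)
      · intro m h1 h2
        rw [hmem]
        intro h'
        exact not_odd_two_mul m (h'.2 (hgap _ (by omega) (by omega)))

lemma isBase_of_hasOddGaps (h : W.IsCyclicWheel k s t e)
    (hS : Function.Periodic (· ∈ S) (2 * k)) (hodd : HasOddGaps S) :
    W.cycleMatroid.IsBase (e '' {i | Odd i ↔ i ∈ S}) := by
  have hk := h.two_le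
  have hmem := h.apply_mem_iff hS
  have hprev := exists_last_notMem_lt (by omega : 0 < 2 * k) hS hodd.1
  have hnext := exists_first_notMem_gt (by omega : 0 < 2 * k) hS hodd.1
  have hrimA : ∀ m, e (2 * m - 1) ∈ e '' {i | Odd i ↔ i ∈ S} ↔ 2 * m - 1 ∈ S := fun m => by
    rw [hmem]
    exact ⟨fun h' => h'.1 ⟨m - 1, by ring⟩, iff_of_true ⟨m - 1, by ring⟩⟩
  have hspA : ∀ m, e (2 * m) ∈ e '' {i | Odd i ↔ i ∈ S} ↔ 2 * m ∉ S := fun m => by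
    rw [hmem]
    exact ⟨fun h' h'' => not_odd_two_mul m (h'.2 h''), iff_of_false (not_odd_two_mul m)⟩
  rw [isBase_cycleMatroid_iff h.isConnected h.center_mem]
  constructor
  · refine isAcyclicSet_of_forall_not_joinedIn ?_ ?_
    · rintro _ ⟨i, -, rfl⟩
      rcases Int.even_or_odd' i with ⟨m, rfl | rfl⟩
      · exact (h.spoke m).edge_mem
      · have := (h.rim (m + 1)).edge_mem
        rwa [show 2 * (m + 1) - 1 = 2 * m + 1 by ring] at this
    have hsymm : ∀ {f x y p q}, W.IsLink f x y → W.IsLink f p q →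
        ¬ W.JoinedIn (e '' {i | Odd i ↔ i ∈ S} \ {f}) p q →
        ¬ W.JoinedIn (e '' {i | Odd i ↔ i ∈ S} \ {f}) x y := by
      intro f x y p q h1 h2 h3 h4
      rcases h1.eq_and_eq_or_eq_and_eq h2 with ⟨rfl, rfl⟩ | ⟨rfl, rfl⟩
      · exact h3 h4
      · exact h3 h4.symm
    rintro _ ⟨i, hi, rfl⟩ x y hxy
    obtain ⟨c, hci, hc, hcgap⟩ := hprev i
    obtain ⟨b, hib, hb, hbgap⟩ := hnext i
    rcases Int.even_or_odd' i with ⟨m, rfl | rfl⟩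
    · -- the spoke `e (2 * m)`, the only one at its segment of the rim
      have hiS := (hspA m).1 ⟨_, hi, rfl⟩
      obtain ⟨r, hr⟩ := hodd.2 c (2 * m) hci hc hiS hcgap
      obtain ⟨r', hr'⟩ := hodd.2 (2 * m) b hib hiS hb hbgap
      obtain rfl : c = 2 * (m - r) - 1 := by omega
      obtain rfl : b = 2 * (m + r' + 1) - 1 := by omega
      refine hsymm hxy (h.spoke m).symm ?_
      refine h.not_joinedIn_segment (j := m - r) (l := m + r' + 1) (fun h' => ?_) (fun h' => ?_)
        (fun m' h1 h2 h' => ?_) (by omega) (by omega) fun q _ _ => h.vertex_ne_center q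
      · exact hc ((hrimA _).1 h'.1)
      · exact hb ((hrimA _).1 h'.1)
      · rcases lt_trichotomy m' m with hlt | rfl | hlt
        · exact (hspA _).1 h'.1 (hcgap _ (by omega) (by omega))
        · exact h'.2 rfl
        · exact (hspA _).1 h'.1 (hbgap _ (by omega) (by omega))
    · -- a rim edge: the part of the rim on the side away from the nearest spoke gets cut off
      have hrim := h.rim (m + 1)
      rw [show 2 * (m + 1) - 1 = 2 * m + 1 by ring] at hrim
      have hiS : 2 * m + 1 ∈ S := hi.1 ⟨m, rfl⟩
      have hgap : ∀ d, c < d → d < b → d ∈ S := by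
        intro d h1 h2
        rcases lt_trichotomy d (2 * m + 1) with hlt | rfl | hlt
        · exact hcgap d h1 hlt
        · exact hiS
        · exact hbgap d hlt h2
      have hle := le_add_of_forall_mem (by omega) hS hc hgap
      obtain ⟨r, hr⟩ := hodd.2 c b (by omega) hc hb hgap
      rcases Int.even_or_odd' c with ⟨j, rfl | rfl⟩
      · obtain rfl : b = 2 * (j + r + 1) - 1 := by omega
        refine hsymm hxy hrim.symm ?_
        refine h.not_joinedIn_segment (j := m + 1) (l := j + r + 1) (fun h' => ?_) (fun h' => ?_)
          (fun m' h1 h2 h' => ?_) (by omega) (by omega) fun q h1 h2 => ?_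
        · exact h'.2 (by rw [show 2 * (m + 1) - 1 = 2 * m + 1 by ring]; rfl)
        · exact hb ((hrimA _).1 h'.1)
        · exact (hspA _).1 h'.1 (hbgap _ (by omega) (by omega))
        · exact (h.vertex_ne (m + 1) q (by omega) (by omega)).symm
      · obtain rfl : b = 2 * (j + r + 1) := by omega
        refine hsymm hxy hrim ?_
        refine h.not_joinedIn_segment (j := j + 1) (l := m + 1) (fun h' => ?_) (fun h' => ?_)
          (fun m' h1 h2 h' => ?_) (by omega) (by omega) fun q h1 h2 => ?_
        · have := (hrimA _).1 h'.1
          rw [show 2 * (j + 1) - 1 = 2 * j + 1 by ring] at this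
          exact hc this
        · exact h'.2 (by rw [show 2 * (m + 1) - 1 = 2 * m + 1 by ring]; rfl)
        · exact (hspA _).1 h'.1 (hcgap _ (by omega) (by omega))
        · exact h.vertex_ne q (m + 1 + 1) (by omega) (by omega)
  · intro z hz
    rcases h.exists_vertex z hz with rfl | ⟨p, rfl⟩
    · exact .rfl
    have hsp : ∀ m, 2 * m ∉ S → W.JoinedIn (e '' {i | Odd i ↔ i ∈ S}) (t (m + 1)) s :=
      fun m hm => ((h.spoke m).joinedIn ((hspA m).2 hm)).symm
    by_cases hpS : 2 * (p - 1) ∈ S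
    · obtain ⟨c, hci, hc, hcgap⟩ := hprev (2 * (p - 1))
      obtain ⟨b, hib, hb, hbgap⟩ := hnext (2 * (p - 1))
      have hgap : ∀ d, c < d → d < b → d ∈ S := by
        intro d h1 h2
        rcases lt_trichotomy d (2 * (p - 1)) with hlt | rfl | hlt
        · exact hcgap d h1 hlt
        · exact hpS
        · exact hbgap d hlt h2
      obtain ⟨r, hr⟩ := hodd.2 c b (by omega) hc hb hgap
      rcases Int.even_or_odd' c with ⟨j, rfl | rfl⟩
      · refine (h.joinedIn_rim (j := j + 1) (l := p) (by omega) fun m h1 h2 => ?_).symm.trans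
          (hsp j hc)
        exact (hrimA m).2 (hgap _ (by omega) (by omega))
      · obtain rfl : b = 2 * (j + r + 1) := by omega
        refine (h.joinedIn_rim (j := p) (l := j + r + 1 + 1) (by omega) fun m h1 h2 => ?_).trans
          (hsp _ hb)
        exact (hrimA m).2 (hgap _ (by omega) (by omega))
    · have := hsp _ hpS
      rwa [sub_add_cancel] at this

/-- A set of edges of a wheel is a spanning tree if and only if the missing rim edges and the
spokes in the set alternate around the rim. If `S` has period `2 * k` and is such that `e i` is in
the set just when `Odd i ↔ i ∈ S`, these are the elements with index outside `S`. -/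
theorem isBase_iff_hasOddGaps (h : W.IsCyclicWheel k s t e)
    (hS : Function.Periodic (· ∈ S) (2 * k)) :
    W.cycleMatroid.IsBase (e '' {i | Odd i ↔ i ∈ S}) ↔ HasOddGaps S :=
  ⟨h.hasOddGaps_of_isBase hS, h.isBase_of_hasOddGaps hS⟩

end IsCyclicWheel

end Graph

/-! ### Feasible sets of connected grafts -/

namespace Graph

variable {α β : Type*}

lemma IsLink.of_le_of_mem {G K : Graph α β} {f : β} {x y : α} (h : G.IsLink f x y) (hK : K ≤ G)
    (hf : f ∈ E(K)) : K.IsLink f x y := by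
  obtain ⟨a, b, hab⟩ := K.exists_isLink_of_mem_edgeSet hf
  rcases h.eq_and_eq_or_eq_and_eq (hK.isLink_mono hab) with ⟨rfl, rfl⟩ | ⟨rfl, rfl⟩
  · exact hab
  · exact hab.symm

/-- In a connected graph with `T ≠ ∅` no component of a `T`-spanning forest can avoid `T`, so the
feasible sets are the acyclic sets all of whose components contain an odd number of elements
of `T`. -/
theorem mem_feasibleSets_iff {G : Graph α β} {T : Set α} (hG : G.IsConnected) (hT : T ⊆ V(G))
    (hne : T.Nonempty) {F : Set β} :
    F ∈ G.feasibleSets T ↔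
      G.IsAcyclicSet F ∧ ∀ x ∈ V(G), Odd ({y | G.JoinedIn F x y} ∩ T).ncard := by
  constructor
  · rintro ⟨H, ⟨hle, hV, hC⟩, hfor, rfl⟩
    have hEH : E(H) ⊆ E(G) := fun f hf => by
      obtain ⟨a, b, hab⟩ := H.exists_isLink_of_mem_edgeSet hf
      exact (hle.isLink_mono hab).edge_mem
    refine ⟨⟨hEH, fun C hcyc hCE => hfor C (hcyc.of_isLink_mem fun f hf a b hl =>
      hl.of_le_of_mem hle (hCE hf))⟩, fun x hx => ?_⟩
    have hX : {y | G.JoinedIn E(H) x y} ⊆ V(H) := fun y hy => hV ▸ JoinedIn.mem hy hx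
    have hcomp : (H.induce {y | G.JoinedIn E(H) x y}).IsComponent H := by
      refine ⟨IsClosedSubgraph.mk' (induce_le hX) ?_, ⟨x, JoinedIn.rfl⟩, ?_⟩
      · rintro f v ⟨w, hl⟩ hv
        have hv' : G.JoinedIn E(H) x v := hv
        have hw : G.JoinedIn E(H) x w :=
          hv'.trans ((hle.isLink_mono hl).joinedIn hl.edge_mem)
        exact (show (H.induce {y | G.JoinedIn E(H) x y}).IsLink f v w from ⟨hl, hv, hw⟩).edge_mem
      · have key : ∀ y, G.JoinedIn E(H) x y → Relation.ReflTransGen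
            (H.induce {y | G.JoinedIn E(H) x y}).Adj x y := by
          intro y hy
          induction hy with
          | refl => exact .refl
          | @tail b c hxb hbc ih =>
            obtain ⟨f, hf, hl⟩ := hbc
            have hb : G.JoinedIn E(H) x b := hxb
            exact ih.tail ⟨f, hl.of_le_of_mem hle hf, hb, hb.trans (hl.joinedIn hf)⟩
        exact fun y hy z hz => (Std.Symm.symm _ _ (key y hy)).trans (key z hz)
    rcases hC _ hcomp with hodd | ⟨hemp, hcl, -⟩
    · exact hodd
    · exfalso
      obtain ⟨t, ht⟩ := hne
      have hxt : t ∈ {y | G.JoinedIn E(H) x y} := by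
        have hr := hG.2 x hx t (hT ht)
        clear ht
        induction hr with
        | refl => exact JoinedIn.rfl
        | tail _ hab ih =>
          obtain ⟨f, hl⟩ := hab
          have := hcl.closed hl.inc_left ih
          exact (hl.of_le_of_mem hcl.le this).right_mem
      exact Set.notMem_empty t (hemp ▸ ⟨hxt, ht⟩)
  · rintro ⟨hac, hodd⟩
    have hHl : ∀ {f a b}, (G.restrict F).IsLink f a b ↔ G.IsLink f a b ∧ f ∈ F := by
      intro f a b
      simp [and_comm]
    refine ⟨G.restrict F, ⟨restrict_le, rfl, fun C hC => Or.inl ?_⟩, ?_, ?_⟩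
    · obtain ⟨hcl, ⟨x, hx⟩, hconn⟩ := hC
      have hVC : V(C) = {y | G.JoinedIn F x y} := by
        ext y
        constructor
        · intro hy
          have hr := hconn x hx y hy
          clear hy
          induction hr with
          | refl => exact JoinedIn.rfl
          | tail _ hab ih =>
            obtain ⟨f, hl⟩ := hab
            obtain ⟨hl', hf⟩ := hHl.1 (hcl.le.isLink_mono hl)
            exact JoinedIn.trans ih (hl'.joinedIn hf)
        · intro hy
          refine JoinedIn.mem_of_closed hy (fun f hf a b hl ha => ?_) hx
          have hl' := hHl.2 ⟨hl, hf⟩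
          exact (hl'.of_le_of_mem hcl.le (hcl.closed hl'.inc_left ha)).right_mem
      rw [hVC]
      exact hodd x (hcl.le.vertexSet_mono hx)
    · intro C hC
      refine hac.2 C (hC.of_le restrict_le) ?_
      obtain ⟨n, v, e, -, -, -, -, hl, rfl⟩ := hC
      rintro _ ⟨i, hi, rfl⟩
      exact (hHl.1 (hl i hi)).2
    · ext f
      constructor
      · intro hf
        obtain ⟨a, b, hl⟩ := exists_isLink_of_mem_edgeSet hf
        exact (hHl.1 hl).2
      · intro hf
        obtain ⟨a, b, hl⟩ := G.exists_isLink_of_mem_edgeSet (hac.1 hf)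
        exact (hHl.2 ⟨hl, hf⟩).edge_mem

/-! ### Cyclic chains of graphs -/

/-- `G` is the union of connected subgraphs `K i` arranged in a cycle of length `n`, with indices
read modulo `n`: consecutive subgraphs `K i` and `K (i + 1)` share exactly the vertex `u i`, and
other pairs have no common vertex. -/
structure IsCyclicChain (G : Graph α β) (n : ℤ) (K : ℤ → Graph α β) (u : ℤ → α) : Prop where
  four_le : 4 ≤ n
  periodic_graph : Function.Periodic K n
  periodic_vertex : Function.Periodic u n
  le : ∀ i, K i ≤ G
  isConnected : ∀ i, (K i).IsConnected
  mem : ∀ i, u i ∈ V(K i)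
  mem_succ : ∀ i, u i ∈ V(K (i + 1))
  eq_of_mem : ∀ i j x, i < j → j < i + n → x ∈ V(K i) → x ∈ V(K j) →
    (j = i + 1 ∧ x = u i) ∨ (j = i + n - 1 ∧ x = u j)
  exists_edge : ∀ f ∈ E(G), ∃ i, f ∈ E(K i)
  exists_vertex : ∀ x ∈ V(G), ∃ i, x ∈ V(K i)

namespace IsCyclicChain

variable {G : Graph α β} {n : ℤ} {K : ℤ → Graph α β} {u : ℤ → α} {F : Set β} {x y : α}

lemma pos (h : G.IsCyclicChain n K u) : 0 < n := by
  have := h.four_le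
  omega

lemma mem_pred (h : G.IsCyclicChain n K u) (i : ℤ) : u (i - 1) ∈ V(K i) := by
  have := h.mem_succ (i - 1)
  rwa [sub_add_cancel] at this

lemma apply_add_sub_one (h : G.IsCyclicChain n K u) (i : ℤ) : u (i + n - 1) = u (i - 1) := by
  rw [← h.periodic_vertex (i - 1)]
  ring_nf

lemma exists_eq_mem_Ico (h : G.IsCyclicChain n K u) (i a : ℤ) :
    ∃ j, a ≤ j ∧ j < a + n ∧ K j = K i ∧ u j = u i := by
  have hp : Function.Periodic (fun i => (K i, u i)) n := fun m => by
    simp only [h.periodic_graph m, h.periodic_vertex m]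
  obtain ⟨j, hj, hij⟩ := hp.exists_mem_Ico h.pos i a
  simp only [Prod.mk.injEq] at hij
  exact ⟨j, hj.1, hj.2, hij.1.symm, hij.2.symm⟩

lemma exists_isLink (h : G.IsCyclicChain n K u) {f : β} (hl : G.IsLink f x y) (a : ℤ) :
    ∃ i, a ≤ i ∧ i < a + n ∧ (K i).IsLink f x y := by
  obtain ⟨i, hi⟩ := h.exists_edge f hl.edge_mem
  obtain ⟨j, h1, h2, hK, -⟩ := h.exists_eq_mem_Ico i a
  exact ⟨j, h1, h2, hK ▸ hl.of_le_of_mem (h.le i) hi⟩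

lemma vertex_ne (h : G.IsCyclicChain n K u) {i j : ℤ} (hij : i < j) (hj : j < i + n) :
    u i ≠ u j := by
  intro huv
  have hn := h.four_le
  have h1 := h.mem i
  have h2 := h.mem j
  by_cases hji : j = i + 1
  · have h3 := h.mem_succ j
    rw [← huv] at h3
    rcases h.eq_of_mem i (j + 1) (u i) (by omega) (by omega) h1 h3 with h' | h' <;> omega
  · have h3 := h.mem_succ i
    rw [← huv] at h2
    rcases h.eq_of_mem i j (u i) hij hj h1 h2 with h' | h'
    · omega
    · rcases h.eq_of_mem (i + 1) j (u i) (by omega) (by omega) h3 h2 with h' | h' <;> omega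

lemma eq_of_vertex_mem (h : G.IsCyclicChain n K u) {i j : ℤ} (hij : i ≤ j) (hj : j < i + n)
    (hm : u j ∈ V(K i)) : j = i ∨ j = i + n - 1 := by
  rcases hij.eq_or_lt with rfl | hij
  · exact Or.inl rfl
  · rcases h.eq_of_mem i j (u j) hij hj hm (h.mem j) with h' | h'
    · exact absurd h'.2.symm (h.vertex_ne hij hj)
    · exact Or.inr h'.1

lemma eq_or_eq_of_vertex_mem (h : G.IsCyclicChain n K u) {i j : ℤ} (hm : u j ∈ V(K i)) :
    u j = u (i - 1) ∨ u j = u i := by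
  obtain ⟨m, h1, h2, -, hu⟩ := h.exists_eq_mem_Ico j i
  rw [← hu] at hm ⊢
  rcases h.eq_of_vertex_mem h1 h2 hm with rfl | rfl
  · exact Or.inr rfl
  · exact Or.inl (h.apply_add_sub_one i)

lemma graph_eq_of_mem (h : G.IsCyclicChain n K u) {i j : ℤ} (hi : x ∈ V(K i)) (hj : x ∈ V(K j))
    (h1 : x ≠ u (i - 1)) (h2 : x ≠ u i) : K j = K i := by
  obtain ⟨m, hm1, hm2, hK, -⟩ := h.exists_eq_mem_Ico j i
  rw [← hK] at hj ⊢
  rcases hm1.eq_or_lt with rfl | hm1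
  · rfl
  · rcases h.eq_of_mem i m x hm1 hm2 hi hj with h' | ⟨rfl, h'⟩
    · exact absurd h'.2 h2
    · exact absurd (h'.trans (h.apply_add_sub_one i)) h1

lemma isConnected_union (h : G.IsCyclicChain n K u) : G.IsConnected := by
  have hK : ∀ i, ∀ x ∈ V(K i), ∀ y ∈ V(K i), Relation.ReflTransGen G.Adj x y :=
    fun i x hx y hy => Relation.ReflTransGen.mono
      (fun _ _ ⟨f, hf⟩ => ⟨f, (h.le i).isLink_mono hf⟩) _ _ ((h.isConnected i).2 x hx y hy)
  have hu : ∀ i, Relation.ReflTransGen G.Adj (u i) (u 0) := by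
    intro i
    induction i using Int.induction_on with
    | zero => exact .refl
    | succ i ih => exact (hK _ _ (h.mem _) _ (h.mem_succ _)).trans ih
    | pred i ih => exact (hK _ _ (h.mem_pred _) _ (h.mem _)).trans ih
  have key : ∀ x ∈ V(G), Relation.ReflTransGen G.Adj x (u 0) := fun x hx => by
    obtain ⟨i, hi⟩ := h.exists_vertex x hx
    exact (hK i x hi _ (h.mem i)).trans (hu i)
  exact ⟨⟨u 0, (h.le 0).vertexSet_mono (h.mem 0)⟩, fun x hx y hy =>
    (key x hx).trans (Std.Symm.symm _ _ (key y hy))⟩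

/-- A component of `K i` that contains neither `u (i - 1)` nor `u i` is not joined to anything
outside `K i`. -/
lemma joinedIn_of_not_joinedIn (h : G.IsCyclicChain n K u) {i : ℤ} (hx : x ∈ V(K i))
    (h1 : ¬ (K i).JoinedIn F x (u (i - 1))) (h2 : ¬ (K i).JoinedIn F x (u i))
    (hxy : G.JoinedIn F x y) : (K i).JoinedIn F x y := by
  refine hxy.mem_of_closed (Z := {y | (K i).JoinedIn F x y}) ?_ .rfl
  intro f hf a b hl ha
  have ha' : (K i).JoinedIn F x a := ha
  obtain ⟨j, -, -, hlj⟩ := h.exists_isLink hl 0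
  rw [h.graph_eq_of_mem (ha'.mem hx) hlj.left_mem (fun h' => h1 (h' ▸ ha'))
    (fun h' => h2 (h' ▸ ha'))] at hlj
  exact ha'.trans (hlj.joinedIn hf)

/-- The part of `G` between two subgraphs `K a` and `K b` in each of which `F` separates the two
attachment vertices: everything from the component of `u a` in `K a` up to that of `u (b - 1)` in
`K b`. -/
def between (K : ℤ → Graph α β) (u : ℤ → α) (F : Set β) (a b : ℤ) : Set α :=
  {v | (K a).JoinedIn F (u a) v ∨ (∃ c, a < c ∧ c < b ∧ v ∈ V(K c)) ∨
    (K b).JoinedIn F (u (b - 1)) v}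

/-- No edge of `F` leaves `between K u F a b`. Only the attachment vertices of the subgraphs can
lead out of it, and those at its two ends are separated from it. -/
lemma between_closed (h : G.IsCyclicChain n K u) {a b : ℤ} (hab : a < b) (hb : b ≤ a + n)
    (ha' : ¬ (K a).JoinedIn F (u (a - 1)) (u a)) (hb' : ¬ (K b).JoinedIn F (u (b - 1)) (u b)) :
    ∀ f ∈ F, ∀ x y, G.IsLink f x y → x ∈ between K u F a b → y ∈ between K u F a b := by
  have hn := h.four_le
  intro f hf x y hl hx
  obtain ⟨i, hai, hin, hli⟩ := h.exists_isLink hl a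
  have hxi := hli.left_mem
  have hxy := hli.joinedIn hf
  have hVa : ∀ {v}, (K a).JoinedIn F (u a) v → v ∈ V(K a) := fun hv => hv.mem (h.mem a)
  have hVb : ∀ {v}, (K b).JoinedIn F (u (b - 1)) v → v ∈ V(K b) := fun hv => hv.mem (h.mem_pred b)
  rcases lt_trichotomy i b with hib | rfl | hib
  · rcases hai.eq_or_lt with rfl | hai
    · rcases hx with hx | ⟨c, hc1, hc2, hx⟩ | hx
      · exact Or.inl (hx.trans hxy)
      · rcases h.eq_of_mem a c x hc1 (by omega) hxi hx with ⟨rfl, rfl⟩ | ⟨rfl, rfl⟩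
        · exact Or.inl hxy
        · -- here `K b = K a`, and `x` is its other attachment vertex
          obtain rfl : b = a + n := by omega
          refine Or.inr (Or.inr ?_)
          rw [h.periodic_graph a]
          exact hxy
      · by_cases hban : b = a + n
        · subst hban
          refine Or.inr (Or.inr (hx.trans ?_))
          rw [h.periodic_graph a]
          exact hxy
        · rcases h.eq_of_mem a b x hab (by omega) hxi (hVb hx) with ⟨rfl, rfl⟩ | ⟨h', rfl⟩
          · exact Or.inl hxy
          · exact absurd hx hb'
    · exact Or.inr (Or.inl ⟨i, hai, hib, hli.right_mem⟩)
  · rcases hx with hx | ⟨c, hc1, hc2, hx⟩ | hx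
    · rcases h.eq_of_mem a i x hab hin (hVa hx) hxi with ⟨rfl, rfl⟩ | ⟨rfl, rfl⟩
      · refine Or.inr (Or.inr ?_)
        rw [add_sub_cancel_right]
        exact hxy
      · rw [h.apply_add_sub_one] at hx
        exact absurd hx.symm ha'
    · rcases h.eq_of_mem c i x hc2 (by omega) hx hxi with ⟨rfl, rfl⟩ | ⟨h', -⟩
      · refine Or.inr (Or.inr ?_)
        rw [add_sub_cancel_right]
        exact hxy
      · omega
    · exact Or.inr (Or.inr (hx.trans hxy))
  · rcases hx with hx | ⟨c, hc1, hc2, hx⟩ | hx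
    · rcases h.eq_of_mem a i x (by omega) hin (hVa hx) hxi with ⟨h', -⟩ | ⟨rfl, rfl⟩
      · omega
      · rw [h.apply_add_sub_one] at hx
        exact absurd hx.symm ha'
    · rcases h.eq_of_mem c i x (by omega) (by omega) hx hxi with ⟨h', -⟩ | ⟨h', -⟩ <;> omega
    · rcases h.eq_of_mem b i x hib (by omega) (hVb hx) hxi with ⟨rfl, rfl⟩ | ⟨h', -⟩
      · exact absurd hx hb'
      · omega

lemma vertex_mem_between (h : G.IsCyclicChain n K u) {a b j : ℤ} (hab : a < b) (hb : b ≤ a + n)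
    (ha' : ¬ (K a).JoinedIn F (u (a - 1)) (u a)) (hb' : ¬ (K b).JoinedIn F (u (b - 1)) (u b))
    (hj : u j ∈ between K u F a b) : u j ∈ u '' Set.Ico a b := by
  have hn := h.four_le
  obtain ⟨m, h1, h2, -, hu⟩ := h.exists_eq_mem_Ico j a
  rw [← hu] at hj ⊢
  refine ⟨m, ⟨h1, ?_⟩, rfl⟩
  by_contra! hbm
  rcases hj with hj | ⟨c, hc1, hc2, hj⟩ | hj
  · rcases h.eq_of_vertex_mem h1 h2 (hj.mem (h.mem a)) with rfl | rfl
    · omega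
    · rw [h.apply_add_sub_one] at hj
      exact ha' hj.symm
  · rcases h.eq_of_vertex_mem (by omega) (by omega) hj with rfl | rfl <;> omega
  · rcases h.eq_of_vertex_mem hbm (by omega) (hj.mem (h.mem_pred b)) with rfl | rfl
    · exact hb' hj
    · omega

/-- The indices of the subgraphs in which `F` joins the two attachment vertices. -/
def bridged (K : ℤ → Graph α β) (u : ℤ → α) (F : Set β) : Set ℤ :=
  {i | (K i).JoinedIn F (u (i - 1)) (u i)}

lemma periodic_bridged (h : G.IsCyclicChain n K u) :
    Function.Periodic (· ∈ bridged K u F) n := fun i => by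
  simp only [bridged, Set.mem_ofPred_eq]
  rw [h.periodic_graph i, h.periodic_vertex i, h.apply_add_sub_one]

lemma joinedIn_of_mem_bridged (h : G.IsCyclicChain n K u) {a b : ℤ} (hab : a ≤ b)
    (hS : ∀ c, a < c → c ≤ b → c ∈ bridged K u F) : G.JoinedIn F (u a) (u b) := by
  refine joinedIn_of_forall_Ico u hab fun i h1 h2 => ?_
  have : (K (i + 1)).JoinedIn F (u (i + 1 - 1)) (u (i + 1)) := hS (i + 1) (by omega) (by omega)
  rw [add_sub_cancel_right] at this
  exact this.mono (h.le _) subset_rfl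

lemma joined_inter_range (h : G.IsCyclicChain n K u) {a b m : ℤ} (ha : a ∉ bridged K u F)
    (hb : b ∉ bridged K u F) (hgap : ∀ c, a < c → c < b → c ∈ bridged K u F) (ham : a ≤ m)
    (hmb : m < b) : {y | G.JoinedIn F (u m) y} ∩ Set.range u = u '' Set.Ico a b := by
  have hle := le_add_of_forall_mem h.pos h.periodic_bridged ha hgap
  ext y
  constructor
  · rintro ⟨hy, j, rfl⟩
    refine h.vertex_mem_between (F := F) (by omega) hle ha hb (JoinedIn.mem_of_closed hy
      (h.between_closed (by omega) hle ha hb) ?_)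
    rcases ham.eq_or_lt with rfl | ham
    · exact Or.inl .rfl
    · exact Or.inr (Or.inl ⟨m, ham, hmb, h.mem m⟩)
  · rintro ⟨j, ⟨hj1, hj2⟩, rfl⟩
    refine ⟨?_, j, rfl⟩
    rcases le_total m j with hmj | hmj
    · exact h.joinedIn_of_mem_bridged hmj fun c h1 h2 => hgap c (by omega) (by omega)
    · exact (h.joinedIn_of_mem_bridged hmj fun c h1 h2 => hgap c (by omega) (by omega)).symm

lemma ncard_image_Ico (h : G.IsCyclicChain n K u) {a b : ℤ} (hab : a ≤ b) (hb : b ≤ a + n) :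
    ((u '' Set.Ico a b).ncard : ℤ) = b - a := by
  rw [Set.InjOn.ncard_image, ← Finset.coe_Ico, Set.ncard_coe_finset, Int.card_Ico]
  · omega
  · intro i hi j hj hij
    rcases lt_trichotomy i j with hlt | rfl | hlt
    · exact absurd hij (h.vertex_ne hlt (by have := hi.1; have := hj.2; omega))
    · rfl
    · exact absurd hij.symm (h.vertex_ne hlt (by have := hj.1; have := hi.2; omega))

lemma odd_ncard_iff (h : G.IsCyclicChain n K u) {a b m : ℤ} (ha : a ∉ bridged K u F)
    (hb : b ∉ bridged K u F) (hgap : ∀ c, a < c → c < b → c ∈ bridged K u F) (ham : a ≤ m)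
    (hmb : m < b) :
    Odd ({y | G.JoinedIn F (u m) y} ∩ Set.range u).ncard ↔ Odd (b - a) := by
  rw [h.joined_inter_range ha hb hgap ham hmb, ← Int.odd_coe_nat, h.ncard_image_Ico (by omega)
    (le_add_of_forall_mem h.pos h.periodic_bridged ha hgap)]

lemma isRootedForest_of_odd (h : G.IsCyclicChain n K u) (hac : G.IsAcyclicSet F)
    (hodd : ∀ x ∈ V(G), Odd ({y | G.JoinedIn F x y} ∩ Set.range u).ncard) (i : ℤ) :
    (K i).IsRootedForest (F ∩ E(K i)) (u (i - 1)) (u i) := by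
  refine ⟨hac.of_le (h.le i), fun z hz => ?_⟩
  suffices (K i).JoinedIn F z (u (i - 1)) ∨ (K i).JoinedIn F z (u i) from
    this.imp JoinedIn.inter_edgeSet JoinedIn.inter_edgeSet
  by_contra! hcon
  have hemp : {y | G.JoinedIn F z y} ∩ Set.range u = ∅ := by
    rw [Set.eq_empty_iff_forall_notMem]
    rintro y ⟨hy, j, rfl⟩
    have hy' := h.joinedIn_of_not_joinedIn hz hcon.1 hcon.2 hy
    rcases h.eq_or_eq_of_vertex_mem (hy'.mem hz) with h' | h'
    · exact hcon.1 (h' ▸ hy')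
    · exact hcon.2 (h' ▸ hy')
  have := hodd z ((h.le i).vertexSet_mono hz)
  rw [hemp] at this
  simp at this

lemma hasOddGaps_of_odd (h : G.IsCyclicChain n K u) (hn : Even n)
    (hodd : ∀ x ∈ V(G), Odd ({y | G.JoinedIn F x y} ∩ Set.range u).ncard) :
    HasOddGaps (bridged K u F) := by
  have hu : ∀ i, u i ∈ V(G) := fun i => (h.le i).vertexSet_mono (h.mem i)
  refine ⟨?_, fun a b hab ha hb hgap =>
    (h.odd_ncard_iff ha hb hgap le_rfl hab).1 (hodd _ (hu a))⟩
  -- otherwise all the attachment vertices are in one component, and their number is even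
  by_contra! hall
  have heq : {y | G.JoinedIn F (u 0) y} ∩ Set.range u = u '' Set.Ico 0 n := by
    ext y
    constructor
    · rintro ⟨-, j, rfl⟩
      obtain ⟨m, h1, h2, -, hm⟩ := h.exists_eq_mem_Ico j 0
      exact ⟨m, ⟨h1, by omega⟩, hm⟩
    · rintro ⟨j, hj, rfl⟩
      exact ⟨h.joinedIn_of_mem_bridged hj.1 fun c _ _ => hall c, j, rfl⟩
  have := hodd _ (hu 0)
  rw [heq, ← Int.odd_coe_nat, h.ncard_image_Ico h.pos.le (by omega), sub_zero] at this
  exact Int.not_even_iff_odd.2 this hn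

/-- An edge `f` of `K i` whose deletion separates `u (i - 1)` and `u i` in `K i`, with one end on
each side. Going around the cycle does not reconnect its ends, as some other `K a` is not
bridged. -/
lemma not_joinedIn_of_sides (h : G.IsCyclicChain n K u) (hS : ∃ a, a ∉ bridged K u F) {i : ℤ}
    {f : β} (hf : f ∈ F) (hl : (K i).IsLink f x y)
    (hx : (K i).JoinedIn (F \ {f}) x (u (i - 1))) (hy : (K i).JoinedIn (F \ {f}) y (u i))
    (hxy : ¬ (K i).JoinedIn (F \ {f}) x y) : ¬ G.JoinedIn (F \ {f}) x y := by
  obtain ⟨a, hai, ha, hgap⟩ := exists_last_notMem_lt h.pos h.periodic_bridged hS i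
  have hle := le_add_of_forall_mem h.pos h.periodic_bridged ha hgap
  have hsub : F \ {f} ⊆ F := Set.sdiff_subset
  have hi : i ∈ bridged K u F :=
    ((hx.mono le_rfl hsub).symm.trans (hl.joinedIn hf)).trans (hy.mono le_rfl hsub)
  have hlt : i < a + n := by
    refine lt_of_le_of_ne hle ?_
    rintro rfl
    exact ha ((h.periodic_bridged a).mp hi)
  have ha' : ¬ (K a).JoinedIn (F \ {f}) (u (a - 1)) (u a) := fun h' => ha (h'.mono le_rfl hsub)
  have hi' : ¬ (K i).JoinedIn (F \ {f}) (u (i - 1)) (u i) := fun h' =>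
    hxy ((hx.trans h').trans hy.symm)
  have hyne : y ≠ u (i - 1) := by
    rintro rfl
    exact hxy hx
  intro hG
  rcases hG.mem_of_closed (h.between_closed hai hle ha' hi') (Or.inr (Or.inr hx.symm)) with
    h' | ⟨c, hc1, hc2, h'⟩ | h'
  · rcases h.eq_of_mem a i y hai hlt (h'.mem (h.mem a)) hl.right_mem with ⟨rfl, rfl⟩ | ⟨rfl, rfl⟩
    · rw [add_sub_cancel_right] at hyne
      exact hyne rfl
    · rw [h.apply_add_sub_one] at h'
      exact ha' h'.symm
  · rcases h.eq_of_mem c i y hc2 (by omega) h' hl.right_mem with ⟨rfl, rfl⟩ | ⟨h', -⟩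
    · rw [add_sub_cancel_right] at hyne
      exact hyne rfl
    · omega
  · exact hxy (hx.trans h')

lemma isAcyclicSet_of_isRootedForest (h : G.IsCyclicChain n K u) (hF : F ⊆ E(G))
    (hroot : ∀ i, (K i).IsRootedForest (F ∩ E(K i)) (u (i - 1)) (u i))
    (hS : ∃ a, a ∉ bridged K u F) : G.IsAcyclicSet F := by
  refine isAcyclicSet_of_forall_not_joinedIn hF fun f hf x y hl => ?_
  obtain ⟨i, -, -, hli⟩ := h.exists_isLink hl 0
  have hxy : ¬ (K i).JoinedIn (F \ {f}) x y := fun h' => by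
    refine (hroot i).1.not_joinedIn ⟨hf, hli.edge_mem⟩ hli (h'.inter_edgeSet.mono le_rfl ?_)
    exact fun g hg => ⟨⟨hg.1.1, hg.2⟩, hg.1.2⟩
  intro hG
  by_cases hx1 : (K i).JoinedIn (F \ {f}) x (u (i - 1))
  · by_cases hy2 : (K i).JoinedIn (F \ {f}) y (u i)
    · exact h.not_joinedIn_of_sides hS hf hli hx1 hy2 hxy hG
    · have hy1 : ¬ (K i).JoinedIn (F \ {f}) y (u (i - 1)) := fun h' => hxy (hx1.trans h'.symm)
      exact hxy (h.joinedIn_of_not_joinedIn hli.right_mem hy1 hy2 hG.symm).symm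
  · by_cases hx2 : (K i).JoinedIn (F \ {f}) x (u i)
    · have hy2 : ¬ (K i).JoinedIn (F \ {f}) y (u i) := fun h' => hxy (hx2.trans h'.symm)
      by_cases hy1 : (K i).JoinedIn (F \ {f}) y (u (i - 1))
      · exact h.not_joinedIn_of_sides hS hf hli.symm hy1 hx2 (fun h' => hxy h'.symm) hG.symm
      · exact hxy (h.joinedIn_of_not_joinedIn hli.right_mem hy1 hy2 hG.symm).symm
    · exact hxy (h.joinedIn_of_not_joinedIn hli.left_mem hx1 hx2 hG)

lemma odd_of_hasOddGaps (h : G.IsCyclicChain n K u)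
    (hroot : ∀ i, (K i).IsRootedForest (F ∩ E(K i)) (u (i - 1)) (u i))
    (hgaps : HasOddGaps (bridged K u F)) (hx : x ∈ V(G)) :
    Odd ({y | G.JoinedIn F x y} ∩ Set.range u).ncard := by
  obtain ⟨m, hm⟩ : ∃ m, G.JoinedIn F x (u m) := by
    obtain ⟨i, hi⟩ := h.exists_vertex x hx
    rcases (hroot i).2 x hi with h' | h'
    · exact ⟨_, h'.mono (h.le i) Set.inter_subset_left⟩
    · exact ⟨_, h'.mono (h.le i) Set.inter_subset_left⟩
  have heq : {y | G.JoinedIn F x y} = {y | G.JoinedIn F (u m) y} :=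
    Set.ext fun y => ⟨hm.symm.trans, hm.trans⟩
  obtain ⟨a, ham, ha, hagap⟩ := exists_last_notMem_lt h.pos h.periodic_bridged hgaps.1 (m + 1)
  obtain ⟨b, hmb, hb, hbgap⟩ := exists_first_notMem_gt h.pos h.periodic_bridged hgaps.1 m
  have hgap : ∀ c, a < c → c < b → c ∈ bridged K u F := by
    intro c h1 h2
    rcases lt_or_ge m c with hc | hc
    · exact hbgap c hc h2
    · exact hagap c h1 (by omega)
  rw [heq, h.odd_ncard_iff ha hb hgap (by omega) hmb]
  exact hgaps.2 a b (by omega) ha hb hgap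

/-- A set `F` of edges of a cyclic chain of even length is feasible, with respect to the set of
attachment vertices, if and only if it restricts in each `K i` to a spanning tree or to a spanning
forest with two components that separates the attachment vertices, and any two cyclically
consecutive indices at which it separates them have odd distance. That distance is the number of
attachment vertices in the component of `F` between the two subgraphs. -/
theorem mem_feasibleSets_iff (h : G.IsCyclicChain n K u) (hn : Even n) :
    F ∈ G.feasibleSets (Set.range u) ↔ F ⊆ E(G) ∧
      (∀ i, (K i).IsRootedForest (F ∩ E(K i)) (u (i - 1)) (u i)) ∧
      HasOddGaps (bridged K u F) := by
  rw [Graph.mem_feasibleSets_iff h.isConnected_union ?_ (Set.range_nonempty u)]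
  · constructor
    · rintro ⟨hac, hodd⟩
      exact ⟨hac.1, h.isRootedForest_of_odd hac hodd, h.hasOddGaps_of_odd hn hodd⟩
    · rintro ⟨hF, hroot, hgaps⟩
      exact ⟨h.isAcyclicSet_of_isRootedForest hF hroot hgaps.1,
        fun x hx => h.odd_of_hasOddGaps hroot hgaps hx⟩
  · rintro _ ⟨i, rfl⟩
    exact (h.le i).vertexSet_mono (h.mem i)

end IsCyclicChain

end Graph

/-! ### Indices modulo `n` -/

/-- The representative in `1, …, n` of the residue class of `i` modulo `n`. -/
def cyclicIndex (n : ℕ) (i : ℤ) : ℕ := ((i - 1) % n).toNat + 1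

section cyclicIndex

variable {n : ℕ}

lemma natCast_cyclicIndex (hn : 0 < n) (i : ℤ) : (cyclicIndex n i : ℤ) = (i - 1) % n + 1 := by
  have := Int.emod_nonneg (i - 1) (by omega : (n : ℤ) ≠ 0)
  rw [cyclicIndex]
  omega

lemma cyclicIndex_mem (hn : 0 < n) (i : ℤ) : cyclicIndex n i ∈ Set.Icc 1 n := by
  have h1 := natCast_cyclicIndex hn i
  have h2 := Int.emod_nonneg (i - 1) (by omega : (n : ℤ) ≠ 0)
  have h3 := Int.emod_lt_of_pos (i - 1) (by omega : (0 : ℤ) < n)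
  exact ⟨by omega, by omega⟩

lemma periodic_cyclicIndex (n : ℕ) : Function.Periodic (cyclicIndex n) (n : ℤ) := fun i => by
  rw [cyclicIndex, cyclicIndex, show i + (n : ℤ) - 1 = i - 1 + n by ring, Int.add_emod_right]

lemma cyclicIndex_natCast {i : ℕ} (hi : i ∈ Set.Icc 1 n) : cyclicIndex n i = i := by
  obtain ⟨h1, h2⟩ := hi
  have h3 := natCast_cyclicIndex (by omega : 0 < n) i
  rw [Int.emod_eq_of_lt (by omega) (by omega)] at h3
  omega

lemma Function.Periodic.map_cyclicIndex {δ : Type*} {φ : ℤ → δ} (hφ : Function.Periodic φ (n : ℤ))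
    (hn : 0 < n) (i : ℤ) : φ (cyclicIndex n i) = φ i := by
  rw [natCast_cyclicIndex hn, Int.emod_def,
    show i - 1 - (n : ℤ) * ((i - 1) / n) + 1 = i - (i - 1) / n * n by ring]
  exact (hφ.int_mul ((i - 1) / n)).sub_eq i

lemma cyclicIndex_ne (hn : 0 < n) {i j : ℤ} (hij : i < j) (hj : j < i + n) :
    cyclicIndex n i ≠ cyclicIndex n j := by
  intro h
  have h1 := natCast_cyclicIndex hn i
  rw [h, natCast_cyclicIndex hn j] at h1
  have h2 : (i - 1) % n = (j - 1) % n := by omega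
  have h3 := Int.ModEq.dvd h2
  have h4 := Int.le_of_dvd (by omega) h3
  omega

lemma cyclicIndex_add_one (hn : 0 < n) (i : ℤ) :
    cyclicIndex n (i + 1) = Graph.cyclicSucc n (cyclicIndex n i) := by
  have hp : Function.Periodic (fun i : ℤ => cyclicIndex n (i + 1)) (n : ℤ) := fun i => by
    simp only
    rw [← periodic_cyclicIndex n (i + 1)]
    ring_nf
  have h := hp.map_cyclicIndex hn i
  rw [← h]
  have hm := cyclicIndex_mem hn i
  rw [Graph.cyclicSucc]
  split_ifs with hin
  · rw [hin, add_comm, periodic_cyclicIndex n 1]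
    exact cyclicIndex_natCast (i := 1) ⟨le_rfl, hn⟩
  · refine cyclicIndex_natCast (i := cyclicIndex n i + 1) ⟨by omega, ?_⟩
    have := hm.2
    omega

lemma cyclicIndex_two_mul_sub_one {k : ℕ} (hk : 0 < k) (m : ℤ) :
    cyclicIndex (2 * k) (2 * m - 1) = 2 * cyclicIndex k m - 1 := by
  have h1 := natCast_cyclicIndex (by omega : 0 < 2 * k) (2 * m - 1)
  have h2 := natCast_cyclicIndex hk m
  have h3 := Int.mul_emod_mul_of_pos (m - 1) (k : ℤ) (by norm_num : (0 : ℤ) < 2)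
  rw [show 2 * m - 1 - 1 = 2 * (m - 1) by ring] at h1
  push_cast at h1
  omega

lemma cyclicIndex_two_mul {k : ℕ} (hk : 0 < k) (m : ℤ) :
    cyclicIndex (2 * k) (2 * m) = 2 * cyclicIndex k m := by
  have h := cyclicIndex_add_one (by omega : 0 < 2 * k) (2 * m - 1)
  have hm := cyclicIndex_mem hk m
  rw [sub_add_cancel, cyclicIndex_two_mul_sub_one hk, Graph.cyclicSucc, if_neg (by omega)] at h
  have := hm.1
  omega

end cyclicIndex

/-! ### The wheel graph -/

namespace Graph

variable {α β : Type*}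

lemma isCyclicWheel_wheelGraph {k : ℕ} (hk : 2 ≤ k) {e : ℕ → β}
    (he : Set.InjOn e (Set.Icc 1 (2 * k))) :
    (wheelGraph k e he).IsCyclicWheel k 0 (cyclicIndex k) (fun i => e (cyclicIndex (2 * k) i)) where
  two_le := by omega
  periodic_vertex := periodic_cyclicIndex k
  periodic_edge i := by
    have := periodic_cyclicIndex (2 * k) i
    push_cast at this
    simp only [this]
  vertex_ne_center j := by
    have := (cyclicIndex_mem (by omega : 0 < k) j).1
    omega
  vertex_ne i j h1 h2 := cyclicIndex_ne (by omega) h1 h2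
  edge_ne i j h1 h2 h := cyclicIndex_ne (n := 2 * k) (by omega) h1 (by push_cast; exact h2)
    (he (cyclicIndex_mem (by omega) i) (cyclicIndex_mem (by omega) j) h)
  rim m := by
    refine ⟨_, cyclicIndex_mem (by omega) _, rfl, ?_⟩
    have hm := (cyclicIndex_mem (by omega : 0 < k) m).1
    have hodd : Odd (2 * cyclicIndex k m - 1) := ⟨cyclicIndex k m - 1, by omega⟩
    rw [cyclicIndex_two_mul_sub_one (by omega), wheelEnds, if_pos hodd,
      cyclicIndex_add_one (by omega),
      show (2 * cyclicIndex k m - 1 + 1) / 2 = cyclicIndex k m by omega]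
  spoke m := by
    refine ⟨_, cyclicIndex_mem (by omega) _, rfl, ?_⟩
    rw [cyclicIndex_two_mul (by omega), wheelEnds,
      if_neg (Nat.not_odd_iff_even.2 (even_two_mul _)), cyclicIndex_add_one (by omega),
      Nat.mul_div_cancel_left _ (by norm_num)]
  exists_edge := by
    rintro _ ⟨i, hi, rfl⟩
    exact ⟨i, by rw [cyclicIndex_natCast hi]⟩
  exists_vertex x hx := by
    rcases Nat.eq_zero_or_pos x with rfl | hpos
    · exact Or.inl rfl
    · exact Or.inr ⟨x, (cyclicIndex_natCast ⟨hpos, hx.2⟩).symm⟩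

namespace IsCyclicWheel

variable {γ : Type*} {W : Graph γ β} {k : ℤ} {s : γ} {t : ℤ → γ} {e : ℤ → β}

lemma not_isLoop (h : W.IsCyclicWheel k s t e) (i : ℤ) : ¬ W.cycleMatroid.IsLoop (e i) := by
  have hk := h.two_le
  rcases Int.even_or_odd' i with ⟨m, rfl | rfl⟩
  · exact not_isLoop_cycleMatroid (h.spoke m) (h.vertex_ne_center _).symm
  · have hrim := h.rim (m + 1)
    rw [show 2 * (m + 1) - 1 = 2 * m + 1 by ring] at hrim
    exact not_isLoop_cycleMatroid hrim (h.vertex_ne _ _ (by omega) (by omega))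

lemma not_isColoop (h : W.IsCyclicWheel k s t e) (i : ℤ) : ¬ W.cycleMatroid.IsColoop (e i) := by
  have hk := h.two_le
  rcases Int.even_or_odd' i with ⟨m, rfl | rfl⟩
  · refine not_isColoop_cycleMatroid (h.spoke m) ?_
    refine JoinedIn.trans ((h.spoke (m + 1)).joinedIn ⟨(h.spoke (m + 1)).edge_mem, ?_⟩)
      ((h.rim (m + 1)).symm.joinedIn ⟨(h.rim (m + 1)).edge_mem, ?_⟩)
    · exact (h.edge_ne (2 * m) (2 * (m + 1)) (by omega) (by omega)).symm
    · exact (h.edge_ne (2 * m) (2 * (m + 1) - 1) (by omega) (by omega)).symm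
  · have hrim := h.rim (m + 1)
    rw [show 2 * (m + 1) - 1 = 2 * m + 1 by ring] at hrim
    refine not_isColoop_cycleMatroid hrim ?_
    refine JoinedIn.trans ((h.spoke m).symm.joinedIn ⟨(h.spoke m).edge_mem, ?_⟩)
      ((h.spoke (m + 1)).joinedIn ⟨(h.spoke (m + 1)).edge_mem, ?_⟩)
    · exact h.edge_ne (2 * m) (2 * m + 1) (by omega) (by omega)
    · exact (h.edge_ne (2 * m + 1) (2 * (m + 1)) (by omega) (by omega)).symm

end IsCyclicWheel

end Graph

/-! ### The chain of bags of a cyclic decomposition -/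

namespace Graph

variable {α β : Type*} {G : Graph α β} {T : Set α} {k : ℕ} {B : ℕ → Set α}

/-- Unrolled form of the condition on intersections of bags: only consecutive bags meet, and these
meet in a single vertex. -/
lemma IsCyclicDecomposition.eq_of_mem (hk : 2 ≤ k)
    (hB : G.IsCyclicDecomposition T (cycleGraph (2 * k)) B) {v : ℤ → α}
    (hv : ∀ i, v i ∈ B (cyclicIndex (2 * k) i)) (hv' : ∀ i, v i ∈ B (cyclicIndex (2 * k) (i + 1)))
    (i j : ℤ) (x : α) (hij : i < j) (hj : j < i + (2 * k : ℕ))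
    (hxi : x ∈ B (cyclicIndex (2 * k) i)) (hxj : x ∈ B (cyclicIndex (2 * k) j)) :
    (j = i + 1 ∧ x = v i) ∨ (j = i + (2 * k : ℕ) - 1 ∧ x = v j) := by
  have hpos : 0 < 2 * k := by omega
  have hmem := cyclicIndex_mem hpos
  have huniq : ∀ i x, x ∈ B (cyclicIndex (2 * k) i) → x ∈ B (cyclicIndex (2 * k) (i + 1)) →
      x = v i := by
    intro i x hx hx'
    have hne := cyclicIndex_ne hpos (by omega : i < i + 1) (by omega)
    have hle : (B (cyclicIndex (2 * k) i) ∩ B (cyclicIndex (2 * k) (i + 1))).encard ≤ 1 := by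
      rw [hB.encard_inter _ (hmem i) _ (hmem (i + 1)) hne, Set.encard_le_one_iff]
      have key : ∀ f, (cycleGraph (2 * k)).IsLink f (cyclicIndex (2 * k) i)
          (cyclicIndex (2 * k) (i + 1)) → f = cyclicIndex (2 * k) i := by
        rintro f ⟨-, hf⟩
        rcases Sym2.eq_iff.1 hf with ⟨h1, -⟩ | ⟨h1, h2⟩
        · exact h1.symm
        · rw [← h2, ← cyclicIndex_add_one hpos] at h1
          exact absurd h1 (cyclicIndex_ne hpos (by omega) (by omega))
      exact fun a b ha hb => (key a ha).trans (key b hb).symm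
    exact Set.encard_le_one_iff.1 hle _ _ ⟨hx, hx'⟩ ⟨hv i, hv' i⟩
  have hne := cyclicIndex_ne hpos hij hj
  have hpos' : 0 < (B (cyclicIndex (2 * k) i) ∩ B (cyclicIndex (2 * k) j)).encard :=
    Set.encard_pos.2 ⟨x, hxi, hxj⟩
  rw [hB.encard_inter _ (hmem i) _ (hmem j) hne] at hpos'
  obtain ⟨f, -, hf⟩ := Set.encard_pos.1 hpos'
  rcases Sym2.eq_iff.1 hf with ⟨h1, h2⟩ | ⟨h1, h2⟩
  · rw [← h1, ← cyclicIndex_add_one hpos] at h2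
    have hji : j = i + 1 := by
      by_contra hn
      exact cyclicIndex_ne hpos (by omega : i + 1 < j) (by omega) h2.symm
    subst hji
    exact Or.inl ⟨rfl, huniq i x hxi hxj⟩
  · rw [← h2, ← cyclicIndex_add_one hpos, ← periodic_cyclicIndex (2 * k) i] at h1
    have hji : j + 1 = i + (2 * k : ℕ) := by
      by_contra hn
      exact cyclicIndex_ne hpos (by omega : j + 1 < i + (2 * k : ℕ)) (by omega) h1.symm
    refine Or.inr ⟨by omega, huniq j x hxj ?_⟩
    rwa [hji, periodic_cyclicIndex]

section

variable {Gs : ℕ → Graph α β} {u : ℕ → α}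

lemma IsNiceCyclicDecomposition.isCyclicChain (hk : 2 ≤ k)
    (hB : G.IsNiceCyclicDecomposition T (cycleGraph (2 * k)) B) (hBlast : B (2 * k + 1) = B 1)
    (hGs : ∀ i ∈ Set.Icc 1 (2 * k), Gs i ≤ G ∧ V(Gs i) = B i)
    (hcover : ∀ f ∈ E(G), ∃! i, i ∈ Set.Icc 1 (2 * k) ∧ f ∈ E(Gs i))
    (hu : ∀ i ∈ Set.Icc 1 (2 * k), u i ∈ B i ∩ B (i + 1)) :
    G.IsCyclicChain (2 * k : ℕ) (fun i => Gs (cyclicIndex (2 * k) i))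
      (fun i => u (cyclicIndex (2 * k) i)) := by
  have hpos : 0 < 2 * k := by omega
  have hmem := cyclicIndex_mem hpos
  have hV : ∀ i, V(Gs (cyclicIndex (2 * k) i)) = B (cyclicIndex (2 * k) i) :=
    fun i => (hGs _ (hmem i)).2
  have hv : ∀ i, u (cyclicIndex (2 * k) i) ∈ B (cyclicIndex (2 * k) i) :=
    fun i => (hu _ (hmem i)).1
  have hv' : ∀ i, u (cyclicIndex (2 * k) i) ∈ B (cyclicIndex (2 * k) (i + 1)) := fun i => by
    have := (hu _ (hmem i)).2
    rw [cyclicIndex_add_one hpos, cyclicSucc]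
    split_ifs with h
    · rw [h, hBlast] at this
      rwa [h]
    · exact this
  have heq := hB.toIsCyclicDecomposition.eq_of_mem hk hv hv'
  refine
    { four_le := by omega
      periodic_graph := fun i => congrArg Gs (periodic_cyclicIndex (2 * k) i)
      periodic_vertex := fun i => congrArg u (periodic_cyclicIndex (2 * k) i)
      le := fun i => (hGs _ (hmem i)).1
      isConnected := fun i => ?_
      mem := fun i => hV i ▸ hv i
      mem_succ := fun i => hV (i + 1) ▸ hv' i
      eq_of_mem := fun i j x h1 h2 h3 h4 => heq i j x h1 h2 (hV i ▸ h3) (hV j ▸ h4)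
      exists_edge := fun f hf => ?_
      exists_vertex := fun x hx => ?_ }
  · -- an edge of the bag that belongs to another subgraph is a loop
    have hconn := hB.connected _ (hmem i)
    refine ⟨hV i ▸ hconn.1, fun x hx y hy => ?_⟩
    rw [hV i] at hx hy
    have hr := hconn.2 x hx y hy
    clear hx hy
    induction hr with
    | refl => exact .refl
    | @tail b c _ hbc ih =>
      obtain ⟨f, hl, hb, hc⟩ := hbc
      by_cases hbc : b = c
      · exact hbc ▸ ih
      · refine ih.tail ⟨f, hl.of_le_of_mem (hGs _ (hmem i)).1 ?_⟩
        obtain ⟨m, ⟨hm, hfm⟩, -⟩ := hcover f hl.edge_mem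
        obtain ⟨j, hj, hmj⟩ := (periodic_cyclicIndex (2 * k)).exists_mem_Ico
          (by omega : (0 : ℤ) < (2 * k : ℕ)) m i
        rw [cyclicIndex_natCast hm] at hmj
        rcases hj.1.eq_or_lt with rfl | hij
        · exact hmj ▸ hfm
        · exfalso
          have hl' := hl.of_le_of_mem (hGs _ hm).1 hfm
          rw [hmj] at hl'
          have hbj := hl'.left_mem
          have hcj := hl'.right_mem
          rw [hV j] at hbj hcj
          rcases heq i j b hij hj.2 hb hbj with ⟨h1, rfl⟩ | ⟨h1, rfl⟩ <;>
          rcases heq i j c hij hj.2 hc hcj with ⟨h2, rfl⟩ | ⟨h2, rfl⟩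
          · exact hbc rfl
          · omega
          · omega
          · exact hbc rfl
  · obtain ⟨m, ⟨hm, hfm⟩, -⟩ := hcover f hf
    exact ⟨m, by rwa [cyclicIndex_natCast hm]⟩
  · rw [← hB.iUnion_eq] at hx
    simp only [Set.mem_iUnion, exists_prop] at hx
    obtain ⟨m, hm, hxm⟩ := hx
    refine ⟨m, ?_⟩
    rwa [cyclicIndex_natCast hm, (hGs m hm).2]

/-- The set `T` consists of the attachment vertices: they lie in `T` because intersections of
bags do, and each bag contains two of them but no more than two elements of `T`. -/
lemma IsNiceCyclicDecomposition.eq_range (hk : 2 ≤ k) (hGT : G.IsGraft T)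
    (hB : G.IsNiceCyclicDecomposition T (cycleGraph (2 * k)) B)
    (hGs : ∀ i ∈ Set.Icc 1 (2 * k), Gs i ≤ G ∧ V(Gs i) = B i)
    (h : G.IsCyclicChain (2 * k : ℕ) (fun i => Gs (cyclicIndex (2 * k) i))
      (fun i => u (cyclicIndex (2 * k) i))) :
    T = Set.range fun i : ℤ => u (cyclicIndex (2 * k) i) := by
  have hpos : 0 < 2 * k := by omega
  have hmem := cyclicIndex_mem hpos
  have hmB : ∀ i, u (cyclicIndex (2 * k) i) ∈ B (cyclicIndex (2 * k) i) := fun i =>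
    (hGs _ (hmem i)).2 ▸ h.mem i
  have hsB : ∀ i, u (cyclicIndex (2 * k) i) ∈ B (cyclicIndex (2 * k) (i + 1)) := fun i =>
    (hGs _ (hmem (i + 1))).2 ▸ h.mem_succ i
  have huT : ∀ i, u (cyclicIndex (2 * k) i) ∈ T := fun i =>
    hB.inter_subset _ (hmem i) _ (hmem (i + 1))
      (cyclicIndex_ne hpos (by omega) (by omega)) ⟨hmB i, hsB i⟩
  refine Set.Subset.antisymm (fun x hx => ?_) ?_
  · by_contra hxr
    have hxV := hGT.subset hx
    rw [← hB.iUnion_eq] at hxV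
    simp only [Set.mem_iUnion, exists_prop] at hxV
    obtain ⟨m, hm, hxm⟩ := hxV
    have hm' : cyclicIndex (2 * k) m = m := cyclicIndex_natCast hm
    have hm1 : u (cyclicIndex (2 * k) m) ∈ T ∩ B m := by
      refine ⟨huT _, ?_⟩
      have := hmB m
      rwa [hm'] at this ⊢
    have hm2 : u (cyclicIndex (2 * k) (m - 1)) ∈ T ∩ B m := by
      refine ⟨huT _, ?_⟩
      have := hsB (m - 1)
      rwa [sub_add_cancel, hm'] at this
    have hne : u (cyclicIndex (2 * k) (m - 1)) ≠ u (cyclicIndex (2 * k) m) :=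
      h.vertex_ne (by omega) (by omega)
    have h3 : ({x, u (cyclicIndex (2 * k) (m - 1)), u (cyclicIndex (2 * k) m)} :
        Set α).encard = 3 :=
      Set.encard_eq_three.2 ⟨_, _, _, fun h' => hxr ⟨_, h'.symm⟩, fun h' => hxr ⟨_, h'.symm⟩,
        hne, rfl⟩
    have hsub : ({x, u (cyclicIndex (2 * k) (m - 1)), u (cyclicIndex (2 * k) m)} : Set α) ⊆
        T ∩ B m := by
      rintro y (rfl | rfl | rfl)
      · exact ⟨hx, hxm⟩
      · exact hm2
      · exact hm1
    have := (Set.encard_le_encard hsub).trans (hB.encard_le m hm)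
    rw [h3] at this
    exact absurd this (by decide)
  · rintro _ ⟨i, rfl⟩
    exact huT i

/-! ### The summands -/

variable {e : ℕ → β}

lemma bagMatroid_ground (i : ℕ) : (bagMatroid Gs u e i).E = insert (e i) E(Gs i) := by
  rw [bagMatroid]
  split_ifs
  · rfl
  · rfl

lemma joinedIn_inter_edgeSet {K : Graph α β} {F : Set β} {x y : α} :
    K.JoinedIn (F ∩ E(K)) x y ↔ K.JoinedIn F x y :=
  ⟨fun h => h.mono le_rfl Set.inter_subset_left, JoinedIn.inter_edgeSet⟩

/-- Passing to complements for even `i`, which accounts for the dual matroid, each base of the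
`i`-th summand becomes a forest `F` rooted at the attachment vertices; the base avoids `e i` if
`F` joins these and `i` is odd, or if it separates them and `i` is even. -/
lemma isBase_bagMatroid_iff {i : ℕ} (hconn : (Gs i).IsConnected) (he : e i ∉ E(Gs i))
    (hx : u (i - 1) ∈ V(Gs i)) (hy : u i ∈ V(Gs i)) {F X : Set β}
    (hodd : Odd i → X = F ∩ E(Gs i)) (heven : Even i → X = E(Gs i) \ F) :
    ((bagMatroid Gs u e i).IsBase X ↔ (Gs i).IsRootedForest (F ∩ E(Gs i)) (u (i - 1)) (u i) ∧
      (Odd i ↔ (Gs i).JoinedIn F (u (i - 1)) (u i))) ∧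
    ((bagMatroid Gs u e i).IsBase (insert (e i) X) ↔
      (Gs i).IsRootedForest (F ∩ E(Gs i)) (u (i - 1)) (u i) ∧
      ¬ (Odd i ↔ (Gs i).JoinedIn F (u (i - 1)) (u i))) := by
  have heF : e i ∉ F ∩ E(Gs i) := fun h => he h.2
  have h1 := isBase_addEdge_iff hconn he hx hy heF
  have h2 := isBase_addEdge_insert_iff hconn he hx hy heF
  rw [joinedIn_inter_edgeSet] at h1 h2
  rcases Nat.even_or_odd i with hi | hi
  · have hi' := Nat.not_odd_iff_even.2 hi
    rw [bagMatroid, if_neg hi', heven hi]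
    have hsub : E(Gs i) \ F ⊆ insert (e i) E(Gs i) := Set.sdiff_subset.trans (Set.subset_insert _ _)
    rw [Matroid.dual_isBase_iff hsub, Matroid.dual_isBase_iff
      (Set.insert_subset (Set.mem_insert _ _) hsub), cycleMatroid_ground, edgeSet_addEdge]
    have e1 : insert (e i) E(Gs i) \ (E(Gs i) \ F) = insert (e i) (F ∩ E(Gs i)) := by
      ext f
      by_cases hf : f = e i
      · subst hf
        simp [he]
      · simp only [Set.mem_sdiff, Set.mem_insert_iff, hf, false_or, Set.mem_inter_iff]
        tauto
    have e2 : insert (e i) E(Gs i) \ insert (e i) (E(Gs i) \ F) = F ∩ E(Gs i) := by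
      ext f
      by_cases hf : f = e i
      · subst hf
        simp [he]
      · simp only [Set.mem_sdiff, Set.mem_insert_iff, hf, false_or, Set.mem_inter_iff]
        tauto
    rw [e1, e2, h1, h2]
    simp only [hi', false_iff, not_not, and_self]
  · rw [bagMatroid, if_pos hi, hodd hi, h1, h2]
    simp only [hi, true_iff, and_self]

lemma isTwoSumFamily_bagMatroid (hk : 2 ≤ k) (hfin : E(G).Finite)
    (hGs : ∀ i ∈ Set.Icc 1 (2 * k), Gs i ≤ G)
    (hcover : ∀ f ∈ E(G), ∃! i, i ∈ Set.Icc 1 (2 * k) ∧ f ∈ E(Gs i))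
    (hconn : ∀ i ∈ Set.Icc 1 (2 * k), (Gs i).IsConnected)
    (hu : ∀ i ∈ Set.Icc 1 (2 * k), u (i - 1) ∈ V(Gs i) ∧ u i ∈ V(Gs i) ∧ u (i - 1) ≠ u i)
    (he : Set.InjOn e (Set.Icc 1 (2 * k))) (hnew : ∀ i ∈ Set.Icc 1 (2 * k), e i ∉ E(G)) :
    Matroid.IsTwoSumFamily (wheelGraph k e he).cycleMatroid (bagMatroid Gs u e) e
      (fun i => E(Gs i)) (2 * k) := by
  have hsub : ∀ i ∈ Set.Icc 1 (2 * k), E(Gs i) ⊆ E(G) := fun i hi => (hGs i hi).edgeSet_mono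
  have hei : ∀ i ∈ Set.Icc 1 (2 * k), e i ∉ E(Gs i) := fun i hi h => hnew i hi (hsub i hi h)
  have hW := isCyclicWheel_wheelGraph hk he
  have hl : ∀ i ∈ Set.Icc 1 (2 * k),
      ¬ ((Gs i).addEdge (e i) (u (i - 1)) (u i)).cycleMatroid.IsLoop (e i) :=
    fun i hi => not_isLoop_cycleMatroid isLink_addEdge (hu i hi).2.2
  have hc : ∀ i ∈ Set.Icc 1 (2 * k),
      ¬ ((Gs i).addEdge (e i) (u (i - 1)) (u i)).cycleMatroid.IsColoop (e i) :=
    fun i hi => not_isColoop_addEdge (hconn i hi) (hei i hi) (hu i hi).1 (hu i hi).2.1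
  refine
    { finite := fun i hi => hfin.subset (hsub i hi)
      injOn := he
      ground := rfl
      ground_summand := fun i _ => bagMatroid_ground i
      disjoint_ground := fun i hi => Set.disjoint_left.2 ?_
      disjoint := fun i hi j hj hij => Set.disjoint_left.2 fun f hf hf' => hij ?_
      not_isLoop := fun i hi => ?_
      not_isColoop := fun i hi => ?_
      not_isLoop_summand := fun i hi => ?_
      not_isColoop_summand := fun i hi => ?_ }
  · rintro _ hf ⟨j, hj, rfl⟩
    exact hnew j hj (hsub i hi hf)
  · exact (hcover f (hsub i hi hf)).unique ⟨hi, hf⟩ ⟨hj, hf'⟩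
  · have := hW.not_isLoop i
    rwa [cyclicIndex_natCast hi] at this
  · have := hW.not_isColoop i
    rwa [cyclicIndex_natCast hi] at this
  · rw [bagMatroid]
    split_ifs
    · exact hl i hi
    · exact fun h => hc i hi (Matroid.dual_isLoop_iff_isColoop.1 h)
  · rw [bagMatroid]
    split_ifs
    · exact hc i hi
    · exact fun h => hl i hi (Matroid.dual_isColoop_iff_isLoop.1 h)

end

end Graph

/-! ### Feasible sets and bases -/

theorem mainTheorem6 {α β : Type*} (k : ℕ) (hk : 2 ≤ k)
    (G : Graph α β) (T : Set α) (hGT : G.IsGraft T)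
    (B : ℕ → Set α) (hB : G.IsNiceCyclicDecomposition T (Graph.cycleGraph (2 * k)) B)
    (hBlast : B (2 * k + 1) = B 1)
    (Gs : ℕ → Graph α β) (hGs : ∀ i ∈ Set.Icc 1 (2 * k), Gs i ≤ G ∧ V(Gs i) = B i)
    (hcover : ∀ f ∈ E(G), ∃! i, i ∈ Set.Icc 1 (2 * k) ∧ f ∈ E(Gs i))
    (u : ℕ → α) (hu : ∀ i ∈ Set.Icc 1 (2 * k), u i ∈ B i ∩ B (i + 1)) (hu0 : u 0 = u (2 * k))
    (e : ℕ → β) (he : Set.InjOn e (Set.Icc 1 (2 * k)))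
    (hnew : ∀ i ∈ Set.Icc 1 (2 * k), e i ∉ E(G)) :
    (∀ i < 2 * k, (Graph.wheelTwoSum k e he Gs u i).HasTwoSum (Graph.bagMatroid Gs u e (i + 1))) ∧
    (Graph.wheelTwoSum k e he Gs u (2 * k)).E = E(G) ∧
    G.feasibleSets T = (fun X => X ∆ ⋃ i ∈ Set.Icc 1 k, E(Gs (2 * i))) ''
      {X | (Graph.wheelTwoSum k e he Gs u (2 * k)).IsBase X} := by
  have hpos : 0 < 2 * k := by omega
  have hmem := cyclicIndex_mem hpos
  have hchain := hB.isCyclicChain hk hBlast hGs hcover hu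
  have hT := hB.eq_range hk hGT hGs hchain
  have hW := Graph.isCyclicWheel_wheelGraph hk he
  have hcast : ∀ {i : ℕ}, i ∈ Set.Icc 1 (2 * k) → cyclicIndex (2 * k) i = i := cyclicIndex_natCast
  -- for `i = 1` the predecessor has index `2 * k` on the left and `0` on the right
  have hu' : ∀ i : ℤ, u (cyclicIndex (2 * k) (i - 1)) = u (cyclicIndex (2 * k) i - 1) := by
    intro i
    have h1 := cyclicIndex_add_one hpos (i - 1)
    have h2 := (hmem (i - 1)).1
    rw [sub_add_cancel, Graph.cyclicSucc] at h1
    split_ifs at h1 with h3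
    · rw [h1, h3, ← hu0]
    · rw [h1, Nat.add_sub_cancel]
  have hconn : ∀ i ∈ Set.Icc 1 (2 * k), (Gs i).IsConnected := fun i hi => by
    have := hchain.isConnected i
    rwa [hcast hi] at this
  have huV : ∀ i ∈ Set.Icc 1 (2 * k), u (i - 1) ∈ V(Gs i) ∧ u i ∈ V(Gs i) ∧ u (i - 1) ≠ u i := by
    intro i hi
    have h1 := hchain.mem_pred i
    have h2 := hchain.mem i
    have h3 := hchain.vertex_ne (by omega : (i : ℤ) - 1 < i) (by omega)
    simp only [hu', hcast hi] at h1 h2 h3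
    exact ⟨h1, h2, h3⟩
  have hfam := Graph.isTwoSumFamily_bagMatroid hk hGT.finite_edgeSet (fun i hi => (hGs i hi).1)
    hcover hconn huV he hnew
  have hunion : ⋃ i ∈ Set.Icc 1 (2 * k), E(Gs i) = E(G) := by
    refine Set.Subset.antisymm (Set.iUnion₂_subset fun i hi => (hGs i hi).1.edgeSet_mono) ?_
    intro f hf
    obtain ⟨i, ⟨hi, hfi⟩, -⟩ := hcover f hf
    exact Set.mem_biUnion hi hfi
  refine ⟨fun i hi => hfam.hasTwoSum hi, hfam.ground_iteratedTwoSum.trans hunion, ?_⟩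
  ext F
  rw [hT, hchain.mem_feasibleSets_iff ⟨(k : ℤ), by push_cast; ring⟩]
  set U := ⋃ i ∈ Set.Icc 1 k, E(Gs (2 * i)) with hU
  have hUsub : U ⊆ E(G) := Set.iUnion₂_subset fun i hi =>
    (hGs (2 * i) ⟨by have := hi.1; omega, by have := hi.2; omega⟩).1.edgeSet_mono
  have himage : F ∈ (fun X => X ∆ U) '' {X | (Graph.wheelTwoSum k e he Gs u (2 * k)).IsBase X} ↔
      (Graph.wheelTwoSum k e he Gs u (2 * k)).IsBase (F ∆ U) := by
    constructor
    · rintro ⟨X, hX, rfl⟩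
      simp only [symmDiff_symmDiff_cancel_right]
      exact hX
    · exact fun h => ⟨F ∆ U, h, symmDiff_symmDiff_cancel_right _ _⟩
  have hFU : F ∆ U ⊆ E(G) ↔ F ⊆ E(G) := by
    constructor
    · intro h f hf
      by_cases hfU : f ∈ U
      · exact hUsub hfU
      · exact h (Set.mem_symmDiff.2 (Or.inl ⟨hf, hfU⟩))
    · exact fun h => Set.symmDiff_subset_union.trans (Set.union_subset h hUsub)
  -- `U` contains all edges of the bags of even index and no others
  have hinter : ∀ i ∈ Set.Icc 1 (2 * k), ∀ f ∈ E(Gs i), f ∈ U ↔ Even i := by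
    intro i hi f hf
    rw [hU]
    simp only [Set.mem_iUnion, exists_prop]
    constructor
    · rintro ⟨j, hj, hfj⟩
      have := (hcover f ((hGs i hi).1.edgeSet_mono hf)).unique ⟨hi, hf⟩
        ⟨⟨by have := hj.1; omega, by have := hj.2; omega⟩, hfj⟩
      rw [this]
      exact even_two_mul j
    · rintro ⟨j, rfl⟩
      refine ⟨j, ⟨by have := hi.1; omega, by have := hi.2; omega⟩, ?_⟩
      rwa [two_mul]
  have hbase : ∀ i ∈ Set.Icc 1 (2 * k), _ := fun i hi =>
    Graph.isBase_bagMatroid_iff (e := e) (hconn i hi)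
      (fun h => hnew i hi ((hGs i hi).1.edgeSet_mono h)) (huV i hi).1 (huV i hi).2.1
      (F := F) (X := (F ∆ U) ∩ E(Gs i))
      (fun hodd => by
        ext f
        simp only [Set.mem_inter_iff, Set.mem_symmDiff]
        have := hinter i hi f
        have := Nat.not_even_iff_odd.2 hodd
        tauto)
      (fun heven => by
        ext f
        simp only [Set.mem_inter_iff, Set.mem_symmDiff, Set.mem_sdiff]
        have := hinter i hi f
        tauto)
  rw [himage, Graph.wheelTwoSum, hfam.isBase_iteratedTwoSum_iff, hunion, hFU]
  refine and_congr_right fun _ => ?_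
  have hper := hchain.periodic_bridged (F := F)
  have hbr : ∀ i : ℤ, i ∈ Graph.IsCyclicChain.bridged (fun i => Gs (cyclicIndex (2 * k) i))
      (fun i => u (cyclicIndex (2 * k) i)) F ↔ (Gs (cyclicIndex (2 * k) i)).JoinedIn F
        (u (cyclicIndex (2 * k) i - 1)) (u (cyclicIndex (2 * k) i)) := fun i => by
    rw [← hu']
    rfl
  rw [← hW.isBase_iff_hasOddGaps (by push_cast at hper; exact hper)]
  -- the tree of the wheel that corresponds to `F`
  have hsub : (fun i => e (cyclicIndex (2 * k) i)) '' {i | Odd i ↔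
      i ∈ Graph.IsCyclicChain.bridged (fun i => Gs (cyclicIndex (2 * k) i))
        (fun i => u (cyclicIndex (2 * k) i)) F} ⊆ e '' Set.Icc 1 (2 * k) := by
    rintro _ ⟨i, -, rfl⟩
    exact ⟨_, hmem i, rfl⟩
  have hmemA : ∀ i ∈ Set.Icc 1 (2 * k), e i ∈ (fun i => e (cyclicIndex (2 * k) i)) '' {i | Odd i ↔
      i ∈ Graph.IsCyclicChain.bridged (fun i => Gs (cyclicIndex (2 * k) i))
        (fun i => u (cyclicIndex (2 * k) i)) F} ↔
      (Odd i ↔ (Gs i).JoinedIn F (u (i - 1)) (u i)) := by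
    intro i hi
    have h1 := hW.apply_mem_iff (by push_cast at hper; exact hper) i
    rw [hbr, hcast hi, Int.odd_coe_nat] at h1
    exact h1
  generalize (fun i => e (cyclicIndex (2 * k) i)) '' {i | Odd i ↔
      i ∈ Graph.IsCyclicChain.bridged (fun i => Gs (cyclicIndex (2 * k) i))
        (fun i => u (cyclicIndex (2 * k) i)) F} = A₀ at hsub hmemA ⊢
  constructor
  · rintro ⟨hroot, hN⟩
    refine ⟨A₀, hN, fun i hi => ?_⟩
    have h2 := hroot i
    simp only [hu', hcast hi] at h2
    rw [hmemA i hi, (hbase i hi).1, (hbase i hi).2]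
    exact ⟨fun h => ⟨h2, h⟩, fun h => ⟨h2, h⟩⟩
  · rintro ⟨A, hA, hAM⟩
    have hall : ∀ i ∈ Set.Icc 1 (2 * k),
        (Gs i).IsRootedForest (F ∩ E(Gs i)) (u (i - 1)) (u i) ∧
        (e i ∈ A ↔ (Odd i ↔ (Gs i).JoinedIn F (u (i - 1)) (u i))) := by
      intro i hi
      have h1 := hAM i hi
      rw [(hbase i hi).1, (hbase i hi).2] at h1
      by_cases heA : e i ∈ A
      · exact ⟨(h1.1 heA).1, iff_of_true heA (h1.1 heA).2⟩
      · exact ⟨(h1.2 heA).1, iff_of_false heA (h1.2 heA).2⟩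
    have hAA₀ : A = A₀ := by
      ext f
      constructor
      · intro hf
        obtain ⟨i, hi, rfl⟩ := hA.subset_ground hf
        exact (hmemA i hi).2 ((hall i hi).2.1 hf)
      · intro hf
        obtain ⟨i, hi, rfl⟩ := hsub hf
        exact (hall i hi).2.2 ((hmemA i hi).1 hf)
    refine ⟨fun i => ?_, hAA₀ ▸ hA⟩
    simp only [hu']
    exact (hall _ (hmem i)).1
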